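/- Let $0<T<\infty$ and let $U=\mathbb R^3/\mathbb Z^3$ (the cube $[0,1]^3$ with periodic boundary conditions). Let $f_0\in L^1(U\times\mathbb R^3)$ and $g_0\in L^1(\mathbb R^3)$ be admissible, i.e. probability densities with $\int f_0(x,v)(1+|v|^2)\,dx\,dv<\infty$, $\int g_0(v)(1+|v|^2)\,dv<\infty$ and $\operatorname{ess\,sup}_v g_0(v)(1+|v|^4)<\infty$ (representatives of $f_0,g_0$ are fixed). Write $[a]_+=\max(a,0)$ and $$\Lambda(v)=\int_{\mathbb S^2}\int_{\mathbb R^3}g_0(\bar v)[(v-\bar v)\cdot\nu]_+\,d\bar v\,d\nu,\qquad Q^+[f](x,v)=\int_{\mathbb S^2}\int_{\mathbb R^3}f(x,v')g_0(\bar v')[(v-\bar v)\cdot\nu]_+\,d\bar v\,d\nu,$$ with $v'=v+\nu\cdot(\bar v-v)\,\nu$ and $\bar v'=\bar v-\nu\cdot(\bar v-v)\,\nu$. *Linear Boltzmann equation.* Let $Af=-v\cdot\partial_xf-\Lambda f$ (in the sense of distributions) with domain $D(A)=\{f\in L^1(U\times\mathbb R^3): v\cdot\partial_xf+\Lambda f\in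 L^1(U\times\mathbb R^3)\}$, and $Bf=Q^+[f]$ with domain $D(B)=\{f\in L^1(U\times\mathbb R^3): Q^+[f]\in L^1(U\times\mathbb R^3)\}$. A mild solution of $\partial_tf_t=-v\cdot\partial_xf_t+Q^+[f_t]-\Lambda f_t$, $f_{t=0}=f_0$, is an integrable function $f:[0,T]\to L^1(U\times\mathbb R^3)$ such that for all $t\in[0,T]$: $\int_0^tf_\theta\,d\theta\in D(A)\cap D(B)$ and $(A+B)\int_0^tf_\theta\,d\theta=f_t-f_0$. *Collision trees.* Let $\mathcal{MT}$ be the set of all $\Phi=((x_0,v_0),(t_1,\nu_1,v_1),\dots,(t_n,\nu_n,v_n))$ with $n=n(\Phi)\ge0$, $(x_0,v_0)\in U\times\mathbb R^3$, $(t_j,\nu_j,v_j)\in(0,T]\times\mathbb S^2\times\mathbb R^3$ and $t_1<\dots<t_n$, with the measure $d\Phi=dx_0\,dv_0\prod_j dt_j\,d\nu_j\,dv_j$ on each set $\{n(\Phi)=n\}$. The tagged particle of $\Phi$ starts at $(x_0,v_0)$, moves by $\dot x=v$ with constant velocity between the times $t_j$, and has $v(t_j)=v(t_j^-)-\nu_j\cdot(v(t_j^-)-v_j)\,\nu_j$.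 Put $\tau(\Phi)=0$ if $n=0$. If $n\ge1$, let $(\tau,\nu,v')=(t_n,\nu_n,v_n)$ be the final collision and let $\bar\Phi$ be $\Phi$ without it. The idealized equation is $$\partial_tP_t(\Phi)=\mathcal Q_t^+[P_t](\Phi)-P_t(\Phi)\,\Lambda(v(\tau)),\qquad P_0(\Phi)=f_0(x_0,v_0)\,\mathbf 1_{n(\Phi)=0},$$ where $\mathcal Q^+_t[P_t](\Phi)=\delta(t-\tau)\,P_t(\bar\Phi)\,g_0(v')\,[(v(\tau^-)-v')\cdot\nu]_+$ if $n(\Phi)\ge1$ and $\mathcal Q^+_t[P_t](\Phi)=0$ if $n(\Phi)=0$. It is understood for each $\Phi$ in the form integrated over $[0,t]$, for all $t\in[0,T]$, the mass of $\delta(\cdot-\tau)$ being counted when $t\ge\tau$. **Theorem.** The linear Boltzmann equation has a unique mild solution $f:[0,T]\to L^1(U\times\mathbb R^3)$, and there is a solution $P:[0,T]\to L^1(\mathcal{MT})$ of the idealized equation such that for every $t\in[0,T]$ and every measurable $\Omega\subset U\times\mathbb R^3$, with $S_t(\Omega)=\{\Phi\in\mathcal{MT}:(x(t),v(t))\in\Omega\}$,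 $$\int_\Omega f_t(x,v)\,dx\,dv=\int_{S_t(\Omega)}P_t(\Phi)\,d\Phi .$$ -/

import Mathlib

open MeasureTheory Set
open scoped ContDiff

noncomputable section

namespace RayleighGas

/-- Velocity space `ℝ³`. -/
abbrev Vel : Type := EuclideanSpace ℝ (Fin 3)

/-- `U = [0,1]³` with periodic boundary conditions, with its Lebesgue (Haar) measure of mass one. -/
abbrev Torus : Type := Fin 3 → UnitAddCircle

/-- The one-particle phase space `U × ℝ³`, with Lebesgue measure `volume`. -/
abbrev Phase : Type := Torus × Vel

/-- The unit sphere `𝕊²`. -/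
abbrev Sph : Type := Metric.sphere (0 : Vel) 1

/-- Surface measure on `𝕊²` (total mass `4π`). -/
def surf : Measure Sph := (volume : Measure Vel).toSphere

/-- The projection `ℝ³ → ℝ³ / ℤ³`. -/
def toTorus (y : Vel) : Torus := fun i => (y i : UnitAddCircle)

/-- Free flow of the tagged particle: `(x, v) ↦ (x + t v, v)`. -/
def freeFlow (t : ℝ) (z : Phase) : Phase := (z.1 + toTorus (t • z.2), z.2)

/-- The cross section `[(v - w) · ν]₊`. -/
def crossSection (v w : Vel) (ν : Sph) : ℝ := max (inner ℝ (v - w) (ν : Vel)) 0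

/-! ### Admissible data -/

/-- `f₀` and `g₀` (representatives of elements of `L¹`) are admissible probability densities. -/
structure Admissible (f₀ : Phase → ℝ) (g₀ : Vel → ℝ) : Prop where
  f_integrable : Integrable f₀
  f_nonneg : ∀ᵐ z, 0 ≤ f₀ z
  f_mass : ∫ z, f₀ z = 1
  g_integrable : Integrable g₀
  g_nonneg : ∀ᵐ v, 0 ≤ g₀ v
  g_mass : ∫ v, g₀ v = 1
  f_moment : Integrable fun z : Phase => f₀ z * (1 + ‖z.2‖ ^ 2)
  g_moment : Integrable fun v : Vel => g₀ v * (1 + ‖v‖ ^ 2)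
  g_bound : ∃ C : ℝ, ∀ᵐ v, g₀ v * (1 + ‖v‖ ^ 4) ≤ C

/-! ### The linear Boltzmann equation -/

/-- `L¹(U × ℝ³)`. -/
abbrev L1 : Type := Lp ℝ 1 (volume : Measure Phase)

/-- The collision frequency `∫_{𝕊²} ∫_{ℝ³} g₀(w) [(v - w) · ν]₊ dw dν`. -/
def lossRate (g₀ : Vel → ℝ) (v : Vel) : ℝ :=
  ∫ ν, (∫ w, g₀ w * crossSection v w ν) ∂surf

/-- The integrand `f(x, v') g₀(w') [(v - w) · ν]₊` of the gain term, where
`v' = v + ν · (w - v) ν` and `w' = w - ν · (w - v) ν`. -/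
def gainIntegrand (g₀ : Vel → ℝ) (f : Phase → ℝ) (z : Phase) (ν : Sph) (w : Vel) : ℝ :=
  f (z.1, z.2 + inner ℝ (ν : Vel) (w - z.2) • (ν : Vel))
    * g₀ (w - inner ℝ (ν : Vel) (w - z.2) • (ν : Vel)) * crossSection z.2 w ν

/-- The gain term `Q⁺[f]`. -/
def gainTerm (g₀ : Vel → ℝ) (f : Phase → ℝ) (z : Phase) : ℝ :=
  ∫ ν, (∫ w, gainIntegrand g₀ f z ν w) ∂surf

/-- Test functions `C_c^∞(U × ℝ³)`, `U` the torus; smoothness is that of the periodic lift. -/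
def IsTestFunction (φ : Phase → ℝ) : Prop :=
  ContDiff ℝ ∞ (fun p : Vel × Vel => φ (toTorus p.1, p.2)) ∧ HasCompactSupport φ

/-- `v · ∂ₓ φ (x, v)`. -/
def transport (φ : Phase → ℝ) (z : Phase) : ℝ := deriv (fun s : ℝ => φ (freeFlow s z)) 0

/-- `f ∈ D(A)` and `A f = h`, that is, `-v · ∂ₓ f - Q⁻[f] = h ∈ L¹` in the sense of distributions. -/
def IsA (g₀ : Vel → ℝ) (f h : L1) : Prop :=
  ∀ φ : Phase → ℝ, IsTestFunction φ →
    ∫ z, f z * (transport φ z - lossRate g₀ z.2 * φ z) = ∫ z, h z * φ z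

/-- `f ∈ D(B)` and `B f = h`, that is, `Q⁺[f] = h ∈ L¹`, the integral defining `Q⁺[f]` being
absolutely convergent almost everywhere. -/
def IsB (g₀ : Vel → ℝ) (f h : L1) : Prop :=
  (∀ᵐ z : Phase, Integrable (fun p : Sph × Vel => gainIntegrand g₀ f z p.1 p.2)
      (surf.prod volume)) ∧
    (h : Phase → ℝ) =ᵐ[volume] gainTerm g₀ f

/-- `f ∈ D(A) ∩ D(B)` and `(A + B) f = h`. -/
def IsAPlusB (g₀ : Vel → ℝ) (f h : L1) : Prop :=
  ∃ a b : L1, IsA g₀ f a ∧ IsB g₀ f b ∧ h = a + b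

/-- `u` is a mild solution on `[0, T]` of `∂ₜ u = L u`, `u(0) = u₀`, where the operator `L` on
`L¹` is given by its graph. The time integrals are Bochner integrals in `L¹`. -/
def IsMildSolution (L : L1 → L1 → Prop) (T : ℝ) (u₀ : L1) (u : ℝ → L1) : Prop :=
  IntervalIntegrable u volume 0 T ∧
    ∀ t ∈ Icc (0 : ℝ) T, L (∫ θ in (0 : ℝ)..t, u θ) (u t - u₀)

/-! ### Collision trees -/

/-- The marker `(t_j, ν_j, v_j)` of a collision. -/
abbrev Marker : Type := ℝ × Sph × Vel

/-- The initial data `(x₀, v₀)` of the root and a list of `n` markers, for some `n`. -/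
abbrev Tree : Type := Σ n : ℕ, Phase × (Fin n → Marker)

/-- The set `MT` of collision trees: the collision times lie in `(0, T]` and the collisions are
listed in their order in time. -/
def MT (T : ℝ) : Set Tree :=
  {Φ | (∀ j, (Φ.2.2 j).1 ∈ Ioc 0 T) ∧ StrictMono fun j => (Φ.2.2 j).1}

/-- Lebesgue measure on trees: on the trees with `n` collisions it is
`dx₀ dv₀ ∏ⱼ dtⱼ dνⱼ dvⱼ`. -/
def treeMeasure : Measure Tree :=
  Measure.sum fun n : ℕ =>
    ((volume : Measure Phase).prod
      (Measure.pi fun _ : Fin n => (volume : Measure ℝ).prod (surf.prod (volume : Measure Vel)))).map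
      (Sigma.mk n)

/-- The final collision time `τ(Φ)`, which is `0` if there is no collision. -/
def finalTime : Tree → ℝ
  | ⟨0, _⟩ => 0
  | ⟨n + 1, d⟩ => (d.2 (Fin.last n)).1

/-- The pruned tree, without its final collision (a tree without collisions is left unchanged). -/
def prune : Tree → Tree
  | ⟨0, d⟩ => ⟨0, d⟩
  | ⟨n + 1, d⟩ => ⟨n, d.1, Fin.init d.2⟩

/-- The velocity `v - ν · (v - w) ν` of the tagged particle after a collision with a background
particle of velocity `w`. -/
def scatter (v : Vel) (ν : Sph) (w : Vel) : Vel := v - inner ℝ (ν : Vel) (v - w) • (ν : Vel)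

/-- The position and velocity of the tagged particle at time `t`, for `n` collisions listed in their
order in time: free flow between collisions, and `scatter` at each collision. -/
def rootAux : (n : ℕ) → Phase → (Fin n → Marker) → ℝ → Phase
  | 0, z, _, t => freeFlow t z
  | n + 1, z, m, t =>
      let last := m (Fin.last n)
      if t < last.1 then rootAux n z (Fin.init m) t
      else
        let before := rootAux n z (Fin.init m) last.1
        freeFlow (t - last.1) (before.1, scatter before.2 last.2.1 last.2.2)

/-- `(x(t), v(t))` for the tagged particle of the tree `Φ`. -/
def root (Φ : Tree) (t : ℝ) : Phase := rootAux Φ.1 Φ.2.1 Φ.2.2 t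

/-- `S_t(Ω)`: the collision trees whose tagged particle is in `Ω` at time `t`. -/
def treesIn (T t : ℝ) (Ω : Set Phase) : Set Tree := {Φ ∈ MT T | root Φ t ∈ Ω}

/-! ### The idealized equation -/

/-- The coefficient of `δ(t - τ)` in the gain term `𝒬⁺[p](Φ)`:
`p(Φ̄) g₀(v') [(v(τ⁻) - v') · ν]₊` where `(τ, ν, v')` is the final collision, and `0` if there is
no collision. The velocity `v(τ⁻)` is that of the root of the pruned tree at time `τ`. -/
def treeGain (g₀ : Vel → ℝ) (p : Tree → ℝ) : Tree → ℝ
  | ⟨0, _⟩ => 0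
  | ⟨n + 1, d⟩ =>
      let last := d.2 (Fin.last n)
      let Ψ := prune ⟨n + 1, d⟩
      p Ψ * (g₀ last.2.2 * crossSection (root Ψ last.1).2 last.2.2 last.2.1)

/-- The loss term `𝒬⁻[p](Φ) = p(Φ) ∫∫ g₀(w) [(v(τ) - w) · ν]₊ dw dν`. -/
def treeLoss (g₀ : Vel → ℝ) (p : Tree → ℝ) (Φ : Tree) : ℝ :=
  p Φ * lossRate g₀ (root Φ (finalTime Φ)).2

/-- `P : [0, T] → L¹(MT)` solves `∂ₜ P_t(Φ) = δ(t - τ) (…) - 𝒬⁻[P_t](Φ)` with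
`P₀(Φ) = f₀(x₀, v₀) 1_{n(Φ) = 0}`. Since the right-hand side is a measure in time, the equation is
read in integrated form over `[0, t]` for every `t`, so that the jump at `t = τ` is included in
`P_τ(Φ)`. -/
structure IsIdealizedSolution (f₀ : Phase → ℝ) (g₀ : Vel → ℝ) (T : ℝ) (P : ℝ → Tree → ℝ) :
    Prop where
  integrable : ∀ t ∈ Icc (0 : ℝ) T, IntegrableOn (P t) (MT T) treeMeasure
  initial : ∀ Φ ∈ MT T, P 0 Φ = if Φ.1 = 0 then f₀ Φ.2.1 else 0
  time_integrable : ∀ Φ ∈ MT T, IntervalIntegrable (fun s => P s Φ) volume 0 T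
  equation : ∀ Φ ∈ MT T, ∀ t ∈ Icc (0 : ℝ) T,
    P t Φ = P 0 Φ + (∫ s in Icc (0 : ℝ) t, treeGain g₀ (P s) Φ ∂(Measure.dirac (finalTime Φ)))
      - ∫ s in (0 : ℝ)..t, treeLoss g₀ (P s) Φ

end RayleighGas

end

noncomputable section

namespace RayleighGas

open scoped ENNReal

/-!
Existence. The solution is the sum over `n` of the density of particles that have collided `n`
times so far, each term being the Duhamel integral of the gain of the previous one. In `[0, ∞]` the
series needs no estimate. Tested against a weight, its terms telescope: this bounds the mass and,
since collisions increase the mean of `1 + ‖v‖` at most at a rate proportional to the mass, the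
first velocity moment, which controls the gain and the loss and makes the sum a mild solution.

Uniqueness. A solution of `A H = a` satisfies `r ‖H‖ + ‖Λ H‖ ≤ ‖r H - a‖` for every `r > 0`. Only
the case of fixed velocity needs an argument: there the Fourier coefficients of `H` in `x` solve an
algebraic equation, which identifies `H` with the resolvent of the transport operator. As
`‖B H‖ ≤ ‖Λ H‖`, the operator `A + B` is dissipative, and the norm of the time integral of the
difference of two mild solutions does not increase.

Trees. For a fixed tree the idealized equation says that `P_t` starts with `f₀(x₀, v₀)`, jumps at
the collision times and decays exponentially. Integrating out the last collision, whose effect on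
the velocity is undone by the measure-preserving involution `(v, v̄) ↦ (v', v̄')`, shows by
induction on `n` that the trees with `n` collisions transport `P_t` to the `n`-th term of the
series.
-/

/-! ### Free flow and collisions -/

@[fun_prop]
lemma continuous_toTorus : Continuous toTorus :=
  continuous_pi fun _ => (AddCircle.continuous_mk' 1).comp (by fun_prop)

lemma toTorus_add (a b : Vel) : toTorus (a + b) = toTorus a + toTorus b := by
  ext; simp [toTorus]

lemma toTorus_zero : toTorus 0 = 0 := by
  ext; simp [toTorus]

lemma continuous_freeFlow : Continuous fun p : ℝ × Phase => freeFlow p.1 p.2 := by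
  unfold freeFlow; fun_prop

@[fun_prop]
lemma measurable_freeFlow {α : Type*} [MeasurableSpace α] {t : α → ℝ} {z : α → Phase}
    (ht : Measurable t) (hz : Measurable z) : Measurable fun a => freeFlow (t a) (z a) :=
  continuous_freeFlow.measurable.comp (ht.prodMk hz)

@[simp] lemma freeFlow_zero (z : Phase) : freeFlow 0 z = z := by
  simp [freeFlow, toTorus_zero]

@[simp] lemma freeFlow_snd (t : ℝ) (z : Phase) : (freeFlow t z).2 = z.2 := rfl

lemma freeFlow_freeFlow (s t : ℝ) (z : Phase) :
    freeFlow s (freeFlow t z) = freeFlow (s + t) z := by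
  simp only [freeFlow, add_smul, toTorus_add, Prod.mk.injEq, and_true]
  abel

lemma measurePreserving_freeFlow (t : ℝ) : MeasurePreserving (freeFlow t) := by
  have hshear : MeasurePreserving (fun p : Vel × Torus => (p.1, p.2 + toTorus (t • p.1)))
      (volume.prod volume) (volume.prod volume) :=
    MeasurePreserving.skew_product (g := fun v x => x + toTorus (t • v)) (MeasurePreserving.id _)
      (Continuous.measurable (by fun_prop))
      (Filter.Eventually.of_forall fun v => map_add_right_eq_self _ _)
  exact (Measure.measurePreserving_swap.comp hshear).comp Measure.measurePreserving_swap

/-- The velocity of the background particle after a collision. -/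
def rebound (v : Vel) (ν : Sph) (w : Vel) : Vel := w - inner ℝ (ν : Vel) (w - v) • (ν : Vel)

lemma add_inner_smul_eq_scatter (v w : Vel) (ν : Sph) :
    v + inner ℝ (ν : Vel) (w - v) • (ν : Vel) = scatter v ν w := by
  rw [scatter, ← neg_sub w v, inner_neg_right, neg_smul, sub_neg_eq_add]

lemma inner_sph_self (ν : Sph) : inner ℝ (ν : Vel) (ν : Vel) = 1 := by
  rw [real_inner_self_eq_norm_sq, norm_eq_of_mem_sphere, one_pow]

lemma inner_scatter (v w : Vel) (ν : Sph) :
    inner ℝ (ν : Vel) (scatter v ν w) = inner ℝ (ν : Vel) w := by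
  rw [scatter, inner_sub_right, inner_smul_right, inner_sph_self, inner_sub_right]; ring

lemma inner_rebound (v w : Vel) (ν : Sph) :
    inner ℝ (ν : Vel) (rebound v ν w) = inner ℝ (ν : Vel) v := by
  rw [rebound, inner_sub_right, inner_smul_right, inner_sph_self, inner_sub_right]; ring

lemma scatter_scatter (v w : Vel) (ν : Sph) :
    scatter (scatter v ν w) ν (rebound v ν w) = v := by
  rw [scatter, inner_sub_right, inner_scatter, inner_rebound, scatter, inner_sub_right]
  module

lemma rebound_rebound (v w : Vel) (ν : Sph) :
    rebound (scatter v ν w) ν (rebound v ν w) = w := by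
  rw [rebound, inner_sub_right, inner_scatter, inner_rebound, rebound, inner_sub_right]
  module

lemma scatter_neg (v w : Vel) (ν : Sph) : scatter v (-ν) w = scatter v ν w := by
  simp [scatter]

lemma rebound_neg (v w : Vel) (ν : Sph) : rebound v (-ν) w = rebound v ν w := by
  simp [rebound]

lemma crossSection_scatter_rebound_neg (v w : Vel) (ν : Sph) :
    crossSection (scatter v ν w) (rebound v ν w) (-ν) = crossSection v w ν := by
  simp only [crossSection, real_inner_comm (_ : Vel) (_ - _), coe_neg_sphere, inner_neg_left,
    inner_sub_right, inner_scatter, inner_rebound, neg_sub_neg]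

@[fun_prop]
lemma measurable_scatter {X : Type*} [MeasurableSpace X] {v w : X → Vel} {ν : X → Sph}
    (hv : Measurable v) (hν : Measurable ν) (hw : Measurable w) :
    Measurable fun x => scatter (v x) (ν x) (w x) := by
  unfold scatter; fun_prop

@[fun_prop]
lemma measurable_rebound {X : Type*} [MeasurableSpace X] {v w : X → Vel} {ν : X → Sph}
    (hv : Measurable v) (hν : Measurable ν) (hw : Measurable w) :
    Measurable fun x => rebound (v x) (ν x) (w x) := by
  unfold rebound; fun_prop

@[fun_prop]
lemma measurable_crossSection {X : Type*} [MeasurableSpace X] {v w : X → Vel} {ν : X → Sph}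
    (hv : Measurable v) (hw : Measurable w) (hν : Measurable ν) :
    Measurable fun x => crossSection (v x) (w x) (ν x) := by
  unfold crossSection; fun_prop

lemma crossSection_nonneg (v w : Vel) (ν : Sph) : 0 ≤ crossSection v w ν := le_max_right _ _

lemma crossSection_le (v w : Vel) (ν : Sph) : crossSection v w ν ≤ ‖v‖ + ‖w‖ := by
  refine max_le ?_ (by positivity)
  calc inner ℝ (v - w) (ν : Vel) ≤ ‖v - w‖ * ‖(ν : Vel)‖ := real_inner_le_norm _ _
    _ ≤ ‖v‖ + ‖w‖ := by simpa using norm_sub_le v w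

section MeasurePreserving

variable {E : Type*} [NormedAddCommGroup E] [NormedSpace ℝ E] [MeasurableSpace E] [BorelSpace E]

lemma measurePreserving_of_linear_involution [FiniteDimensional ℝ E] (μ : Measure E)
    [μ.IsAddHaarMeasure] {f : E →ₗ[ℝ] E} (hf : f ∘ₗ f = LinearMap.id) :
    MeasurePreserving f μ μ := by
  have hdet : LinearMap.det f * LinearMap.det f = 1 := by
    rw [← LinearMap.det_comp, hf, LinearMap.det_id]
  have hne : LinearMap.det f ≠ 0 := left_ne_zero_of_mul_eq_one hdet
  have habs : |(LinearMap.det f)⁻¹| = 1 := by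
    rw [abs_inv, inv_eq_one, abs_eq zero_le_one]
    exact mul_self_eq_one_iff.1 hdet
  refine ⟨(LinearMap.continuous_of_finiteDimensional _).measurable, ?_⟩
  rw [Measure.map_linearMap_addHaar_eq_smul_addHaar _ hne, habs, ENNReal.ofReal_one, one_smul]

open scoped Pointwise in
lemma measurePreserving_neg_toSphere (μ : Measure E) [μ.IsNegInvariant] :
    MeasurePreserving (fun ν : Metric.sphere (0 : E) 1 => -ν) μ.toSphere μ.toSphere := by
  have hneg : Measurable fun ν : Metric.sphere (0 : E) 1 => -ν := continuous_neg.measurable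
  refine ⟨hneg, Measure.ext fun s hs => ?_⟩
  have hcone : (Ioo (0 : ℝ) 1 • (Subtype.val '' ((fun ν : Metric.sphere (0 : E) 1 => -ν) ⁻¹' s)))
      = Neg.neg ⁻¹' (Ioo (0 : ℝ) 1 • (Subtype.val '' s)) := by
    ext v
    simp only [mem_smul, exists_mem_image, mem_preimage]
    exact ⟨fun ⟨r, hr, y, hy, hv⟩ => ⟨r, hr, -y, hy, by simp [← hv]⟩,
      fun ⟨r, hr, y, hy, hv⟩ => ⟨r, hr, -y, by simpa using hy, by simp [hv]⟩⟩
  rw [Measure.map_apply hneg hs, Measure.toSphere_apply' _ hs, Measure.toSphere_apply' _ (hneg hs),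
    hcone]
  exact congrArg _ <|
    (Measure.measurePreserving_neg μ).measure_preimage_equiv (f := MeasurableEquiv.neg E) _

end MeasurePreserving

instance : IsFiniteMeasure surf := inferInstanceAs (IsFiniteMeasure (volume.toSphere))

/-- The measure `dx dv dν dw` on pairs of colliding particles. -/
abbrev collisionMeasure : Measure (Phase × Sph × Vel) := volume.prod (surf.prod volume)

lemma lintegral_collisionMeasure {G : Phase × Sph × Vel → ℝ≥0∞} (hG : Measurable G) :
    ∫⁻ p, G p ∂collisionMeasure
      = ∫⁻ x : Torus, ∫⁻ ν, (∫⁻ q : Vel × Vel, G ((x, q.1), ν, q.2)) ∂surf := by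
  calc ∫⁻ p, G p ∂collisionMeasure
      = ∫⁻ x : Torus, ∫⁻ v : Vel, ∫⁻ ν, (∫⁻ w, G ((x, v), ν, w)) ∂surf := by
        rw [lintegral_prod _ hG.aemeasurable, Measure.volume_eq_prod,
          lintegral_prod _ hG.lintegral_prod_right'.aemeasurable]
        exact lintegral_congr fun x => lintegral_congr fun v =>
          lintegral_prod (fun y => G ((x, v), y)) (by fun_prop)
    _ = ∫⁻ x : Torus, ∫⁻ ν, (∫⁻ v : Vel, ∫⁻ w, G ((x, v), ν, w)) ∂surf :=
        lintegral_congr fun x => lintegral_lintegral_swap (Measurable.aemeasurable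
          (Measurable.lintegral_prod_right'
            (f := fun q : (Vel × Sph) × Vel => G ((x, q.1.1), q.1.2, q.2)) (by fun_prop)))
    _ = ∫⁻ x : Torus, ∫⁻ ν, (∫⁻ q : Vel × Vel, G ((x, q.1), ν, q.2)) ∂surf := by
        refine lintegral_congr fun x => lintegral_congr fun ν => ?_
        rw [Measure.volume_eq_prod, lintegral_prod _ (by fun_prop)]

/-- The collision map, with the direction reversed, so that it preserves the cross section. -/
def collide (p : Phase × Sph × Vel) : Phase × Sph × Vel :=
  ((p.1.1, scatter p.1.2 p.2.1 p.2.2), -p.2.1, rebound p.1.2 p.2.1 p.2.2)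

@[fun_prop]
lemma measurable_collide : Measurable collide := by
  unfold collide; fun_prop

/-- For a fixed direction, the collision as a linear map of the pair of velocities. -/
def collideLin (ν : Sph) : Vel × Vel →ₗ[ℝ] Vel × Vel where
  toFun p := (scatter p.1 ν p.2, rebound p.1 ν p.2)
  map_add' p q := by
    simp only [scatter, rebound, Prod.fst_add, Prod.snd_add, inner_sub_right, inner_add_right,
      Prod.mk_add_mk, Prod.mk.injEq]
    constructor <;> module
  map_smul' c p := by
    simp only [scatter, rebound, Prod.smul_fst, Prod.smul_snd, inner_sub_right, inner_smul_right,
      RingHom.id_apply, Prod.smul_mk, Prod.mk.injEq]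
    constructor <;> module

lemma measurePreserving_collideLin (ν : Sph) : MeasurePreserving (collideLin ν) :=
  measurePreserving_of_linear_involution ((volume : Measure Vel).prod volume) <|
    LinearMap.ext fun p => Prod.ext (scatter_scatter p.1 p.2 ν) (rebound_rebound p.1 p.2 ν)

lemma measurePreserving_collide : MeasurePreserving collide collisionMeasure collisionMeasure := by
  refine ⟨measurable_collide, Measure.ext_of_lintegral _ fun F hF => ?_⟩
  rw [lintegral_map hF measurable_collide, lintegral_collisionMeasure (by fun_prop),
    lintegral_collisionMeasure hF]
  refine lintegral_congr fun x => ?_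
  calc ∫⁻ ν, (∫⁻ q : Vel × Vel, F (collide ((x, q.1), ν, q.2))) ∂surf
      = ∫⁻ ν, (∫⁻ q : Vel × Vel, F ((x, q.1), -ν, q.2)) ∂surf :=
        lintegral_congr fun ν => (measurePreserving_collideLin ν).lintegral_comp
          (f := fun q : Vel × Vel => F ((x, q.1), -ν, q.2)) (by fun_prop)
    _ = ∫⁻ ν, (∫⁻ q : Vel × Vel, F ((x, q.1), ν, q.2)) ∂surf :=
        (measurePreserving_neg_toSphere volume).lintegral_comp
          (f := fun ν => ∫⁻ q : Vel × Vel, F ((x, q.1), ν, q.2))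
          (Measurable.lintegral_prod_right'
            (f := fun r : Sph × Vel × Vel => F ((x, r.2.1), r.1, r.2.2)) (by fun_prop))

/-! ### Gain and loss of nonnegative densities -/

/-- The gain term `Q⁺[f]`, with values in `[0, ⊤]`. -/
def eGain (g : Vel → ℝ≥0∞) (f : Phase → ℝ≥0∞) (z : Phase) : ℝ≥0∞ :=
  ∫⁻ p : Sph × Vel, f (z.1, scatter z.2 p.1 p.2) * g (rebound z.2 p.1 p.2) *
    ENNReal.ofReal (crossSection z.2 p.2 p.1) ∂(surf.prod volume)

/-- The adjoint of the gain term: the rate of creation of the weight `ψ` by the collisions of a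
particle at `z`. -/
def eGainAdjoint (g : Vel → ℝ≥0∞) (ψ : Phase → ℝ≥0∞) (z : Phase) : ℝ≥0∞ :=
  ∫⁻ p : Sph × Vel, ψ (z.1, scatter z.2 p.1 p.2) * g p.2 *
    ENNReal.ofReal (crossSection z.2 p.2 p.1) ∂(surf.prod volume)

/-- The collision frequency, with values in `[0, ⊤]`. -/
def eLossRate (g : Vel → ℝ≥0∞) (v : Vel) : ℝ≥0∞ :=
  ∫⁻ p : Sph × Vel, g p.2 * ENNReal.ofReal (crossSection v p.2 p.1) ∂(surf.prod volume)

/-- The weight `1 + ‖v‖`, which dominates the collision frequency. -/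
def velWeight (z : Phase) : ℝ≥0∞ := ENNReal.ofReal (1 + ‖z.2‖)

/-- A bound for the rate at which collisions create `velWeight`. -/
def weightRate (g : Vel → ℝ≥0∞) : ℝ≥0∞ :=
  ∫⁻ p : Sph × Vel, g p.2 * ENNReal.ofReal (2 * ‖p.2‖ ^ 2) ∂(surf.prod volume)

@[fun_prop]
lemma measurable_velWeight : Measurable velWeight := by unfold velWeight; fun_prop

section Gain

variable {g : Vel → ℝ≥0∞}

lemma measurable_eGain {α : Type*} [MeasurableSpace α] (hg : Measurable g)
    {f : α → Phase → ℝ≥0∞} (hf : Measurable (Function.uncurry f)) :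
    Measurable (Function.uncurry fun a => eGain g (f a)) := by
  have : Measurable fun q : (α × Phase) × Sph × Vel =>
      f q.1.1 (q.1.2.1, scatter q.1.2.2 q.2.1 q.2.2) :=
    hf.comp (g := Function.uncurry f)
      (f := fun q : (α × Phase) × Sph × Vel => (q.1.1, (q.1.2.1, scatter q.1.2.2 q.2.1 q.2.2)))
      (by fun_prop)
  exact Measurable.lintegral_prod_right' (f := fun q : (α × Phase) × Sph × Vel =>
    f q.1.1 (q.1.2.1, scatter q.1.2.2 q.2.1 q.2.2) * g (rebound q.1.2.2 q.2.1 q.2.2) *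
      ENNReal.ofReal (crossSection q.1.2.2 q.2.2 q.2.1)) (by fun_prop)

lemma measurable_eGainAdjoint (hg : Measurable g) {ψ : Phase → ℝ≥0∞} (hψ : Measurable ψ) :
    Measurable (eGainAdjoint g ψ) :=
  Measurable.lintegral_prod_right' (f := fun q : Phase × Sph × Vel =>
    ψ (q.1.1, scatter q.1.2 q.2.1 q.2.2) * g q.2.2 *
      ENNReal.ofReal (crossSection q.1.2 q.2.2 q.2.1)) (by fun_prop)

lemma measurable_eLossRate (hg : Measurable g) : Measurable (eLossRate g) :=
  Measurable.lintegral_prod_right' (f := fun q : Vel × Sph × Vel =>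
    g q.2.2 * ENNReal.ofReal (crossSection q.1 q.2.2 q.2.1)) (by fun_prop)

lemma lintegral_mul_eGain (hg : Measurable g) {f ψ : Phase → ℝ≥0∞}
    (hf : Measurable f) (hψ : Measurable ψ) :
    ∫⁻ z, ψ z * eGain g f z = ∫⁻ z, f z * eGainAdjoint g ψ z := by
  calc ∫⁻ z, ψ z * eGain g f z
      = ∫⁻ q : Phase × Sph × Vel, ψ q.1 * (f (q.1.1, scatter q.1.2 q.2.1 q.2.2) *
          g (rebound q.1.2 q.2.1 q.2.2) *
          ENNReal.ofReal (crossSection q.1.2 q.2.2 q.2.1)) ∂collisionMeasure := by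
        rw [lintegral_prod _ (by fun_prop)]
        exact lintegral_congr fun z => (lintegral_const_mul _ (by fun_prop)).symm
    _ = ∫⁻ q : Phase × Sph × Vel, f q.1 * (ψ (q.1.1, scatter q.1.2 q.2.1 q.2.2) * g q.2.2 *
          ENNReal.ofReal (crossSection q.1.2 q.2.2 q.2.1)) ∂collisionMeasure := by
        rw [← measurePreserving_collide.lintegral_comp (by fun_prop)]
        refine lintegral_congr fun q => ?_
        simp only [collide, scatter_neg, rebound_neg, crossSection_scatter_rebound_neg,
          scatter_scatter, rebound_rebound]
        ring
    _ = ∫⁻ z, f z * eGainAdjoint g ψ z := by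
        rw [lintegral_prod _ (by fun_prop)]
        exact lintegral_congr fun z => by rw [eGainAdjoint, ← lintegral_const_mul _ (by fun_prop)]

lemma eGainAdjoint_one (g : Vel → ℝ≥0∞) (z : Phase) : eGainAdjoint g 1 z = eLossRate g z.2 := by
  simp only [eGainAdjoint, eLossRate, Pi.one_apply, one_mul]

lemma norm_scatter_sq (v w : Vel) (ν : Sph) :
    ‖scatter v ν w‖ ^ 2 = ‖v‖ ^ 2 - inner ℝ (ν : Vel) v ^ 2 + inner ℝ (ν : Vel) w ^ 2 := by
  rw [scatter, norm_sub_sq_real, inner_smul_right, norm_smul, real_inner_comm (ν : Vel) v,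
    inner_sub_right, norm_eq_of_mem_sphere, mul_one, Real.norm_eq_abs, sq_abs]
  ring

lemma norm_scatter_mul_crossSection_le (v w : Vel) (ν : Sph) :
    (1 + ‖scatter v ν w‖) * crossSection v w ν
      ≤ (1 + ‖v‖) * crossSection v w ν + 2 * ‖w‖ ^ 2 := by
  have hsq := norm_scatter_sq v w ν
  have hcross : crossSection v w ν = max (inner ℝ (ν : Vel) v - inner ℝ (ν : Vel) w) 0 := by
    rw [crossSection, real_inner_comm, inner_sub_right]
  have hcross0 := crossSection_nonneg v w ν
  have hbw : |inner ℝ (ν : Vel) w| ≤ ‖w‖ := by simpa using abs_real_inner_le_norm (ν : Vel) w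
  generalize inner ℝ (ν : Vel) v = a, inner ℝ (ν : Vel) w = b at hsq hcross hbw
  rcases le_or_gt (b ^ 2) (a ^ 2) with hba | hab
  · have hslower : ‖scatter v ν w‖ ≤ ‖v‖ :=
      le_of_sq_le_sq (by linarith) (norm_nonneg _)
    nlinarith [sq_nonneg ‖w‖]
  · -- A collision accelerates the particle only if `|a| < |b|`, when the cross section is small.
    have hfaster : ‖scatter v ν w‖ ≤ ‖v‖ + |b| := by
      refine le_of_sq_le_sq ?_ (by positivity)
      nlinarith [sq_abs b, abs_nonneg b, norm_nonneg v, sq_nonneg a]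
    have hsmall : crossSection v w ν ≤ 2 * |b| := by
      rw [hcross]
      refine max_le ?_ (by positivity)
      linarith [le_abs_self a, neg_abs_le b, sq_lt_sq.1 hab]
    calc (1 + ‖scatter v ν w‖) * crossSection v w ν
        ≤ (1 + (‖v‖ + |b|)) * crossSection v w ν := by gcongr
      _ = (1 + ‖v‖) * crossSection v w ν + |b| * crossSection v w ν := by ring
      _ ≤ (1 + ‖v‖) * crossSection v w ν + ‖w‖ * (2 * ‖w‖) := by gcongr; linarith
      _ = (1 + ‖v‖) * crossSection v w ν + 2 * ‖w‖ ^ 2 := by ring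

lemma eGainAdjoint_velWeight_le (hg : Measurable g) (z : Phase) :
    eGainAdjoint g velWeight z ≤ velWeight z * eLossRate g z.2 + weightRate g := by
  rw [eLossRate, weightRate, ← lintegral_const_mul _ (by fun_prop),
    ← lintegral_add_left (by fun_prop)]
  refine lintegral_mono fun p => ?_
  dsimp only
  rw [mul_assoc, mul_left_comm, mul_left_comm (velWeight z), ← mul_add]
  gcongr
  rw [velWeight, velWeight, ← ENNReal.ofReal_mul (by positivity),
    ← ENNReal.ofReal_mul (by positivity), ← ENNReal.ofReal_add
      (mul_nonneg (by positivity) (crossSection_nonneg _ _ _)) (by positivity)]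
  exact ENNReal.ofReal_le_ofReal (norm_scatter_mul_crossSection_le _ _ _)

lemma eLossRate_le (hg : Measurable g) (v : Vel) :
    eLossRate g v ≤ ENNReal.ofReal (1 + ‖v‖) *
      ∫⁻ p : Sph × Vel, g p.2 * ENNReal.ofReal (1 + ‖p.2‖) ∂(surf.prod volume) := by
  rw [eLossRate, ← lintegral_const_mul _ (by fun_prop)]
  refine lintegral_mono fun p => ?_
  dsimp only
  rw [mul_left_comm, ← ENNReal.ofReal_mul (by positivity)]
  gcongr
  nlinarith [crossSection_le v p.2 p.1, norm_nonneg v, norm_nonneg p.2]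

end Gain

lemma exists_measurable_toReal_ae_eq {α : Type*} [MeasurableSpace α] {μ : Measure α} {u : α → ℝ}
    (hu : AEMeasurable u μ) (hu0 : 0 ≤ᵐ[μ] u) :
    ∃ f : α → ℝ≥0∞, Measurable f ∧ (∀ a, f a ≠ ⊤) ∧ u =ᵐ[μ] fun a => (f a).toReal := by
  refine ⟨fun a => ENNReal.ofReal (hu.mk u a), by fun_prop, fun a => ENNReal.ofReal_ne_top, ?_⟩
  filter_upwards [hu.ae_eq_mk, hu0] with a hmk ha
  rw [ENNReal.toReal_ofReal (hmk ▸ ha), hmk]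

lemma lintegral_mul_ofReal_ne_top_of_integrable {α : Type*} [MeasurableSpace α] {μ : Measure α}
    {f : α → ℝ≥0∞} {u w : α → ℝ} (hf : ∀ a, f a ≠ ⊤) (hu : u =ᵐ[μ] fun a => (f a).toReal)
    (hw : Integrable (fun a => u a * w a) μ) : ∫⁻ a, f a * ENNReal.ofReal (w a) ∂μ ≠ ⊤ := by
  have huw : ∀ᵐ a ∂μ, f a * ENNReal.ofReal (w a) = ENNReal.ofReal (u a * w a) := by
    filter_upwards [hu] with a ha
    rw [ha, ENNReal.ofReal_mul ENNReal.toReal_nonneg, ENNReal.ofReal_toReal (hf a)]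
  rw [lintegral_congr_ae huw]
  exact hw.lintegral_lt_top.ne

/-- `g` is a measurable version with values in `[0, ⊤)` of the background density `g₀`, with finite
second moment. -/
structure IsBackground (g₀ : Vel → ℝ) (g : Vel → ℝ≥0∞) : Prop where
  measurable : Measurable g
  ne_top : ∀ v, g v ≠ ⊤
  ae_eq : g₀ =ᵐ[volume] fun v => (g v).toReal
  moment_ne_top : ∫⁻ v, g v * ENNReal.ofReal (1 + ‖v‖ ^ 2) ≠ ⊤

lemma exists_isBackground {g₀ : Vel → ℝ} (hg : AEMeasurable g₀) (hg0 : 0 ≤ᵐ[volume] g₀)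
    (hm : Integrable fun v : Vel => g₀ v * (1 + ‖v‖ ^ 2)) : ∃ g, IsBackground g₀ g := by
  obtain ⟨g, hgm, hgt, hae⟩ := exists_measurable_toReal_ae_eq hg hg0
  exact ⟨g, hgm, hgt, hae, lintegral_mul_ofReal_ne_top_of_integrable hgt hae hm⟩

namespace IsBackground

variable {g₀ : Vel → ℝ} {g : Vel → ℝ≥0∞}

lemma lintegral_prod_mul_ne_top (hb : IsBackground g₀ g) {a : Vel → ℝ} {c : ℝ}
    (hac : ∀ v, a v ≤ c * (1 + ‖v‖ ^ 2)) :
    ∫⁻ p : Sph × Vel, g p.2 * ENNReal.ofReal (a p.2) ∂(surf.prod volume) ≠ ⊤ := by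
  have hg := hb.measurable
  refine ne_top_of_le_ne_top ?_
    (lintegral_mono fun p => mul_le_mul_right (ENNReal.ofReal_le_ofReal (hac p.2)) _)
  rw [lintegral_prod _ (by fun_prop)]
  dsimp only
  rw [lintegral_const]
  refine ENNReal.mul_ne_top ?_ (measure_ne_top _ _)
  simp only [ENNReal.ofReal_mul' (show 0 ≤ 1 + ‖_‖ ^ 2 by positivity), mul_left_comm (g _)]
  rw [lintegral_const_mul _ (by fun_prop)]
  exact ENNReal.mul_ne_top ENNReal.ofReal_ne_top hb.moment_ne_top

lemma weightRate_ne_top (hb : IsBackground g₀ g) : weightRate g ≠ ⊤ :=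
  hb.lintegral_prod_mul_ne_top (c := 2) (a := fun v => 2 * ‖v‖ ^ 2) fun v => by linarith

lemma lintegral_prod_one_add_norm_ne_top (hb : IsBackground g₀ g) :
    ∫⁻ p : Sph × Vel, g p.2 * ENNReal.ofReal (1 + ‖p.2‖) ∂(surf.prod volume) ≠ ⊤ :=
  hb.lintegral_prod_mul_ne_top (c := 2) (a := fun v => 1 + ‖v‖) fun v => by
    nlinarith [sq_nonneg (‖v‖ - 1)]

lemma eLossRate_ne_top (hb : IsBackground g₀ g) (v : Vel) : eLossRate g v ≠ ⊤ :=
  ne_top_of_le_ne_top (ENNReal.mul_ne_top ENNReal.ofReal_ne_top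
    hb.lintegral_prod_one_add_norm_ne_top) (eLossRate_le hb.measurable v)

lemma lossRate_eq_toReal (hb : IsBackground g₀ g) (v : Vel) :
    lossRate g₀ v = (eLossRate g v).toReal := by
  have hg := hb.measurable
  have hmeas : Measurable fun ν : Sph => ∫⁻ w, g w * ENNReal.ofReal (crossSection v w ν) :=
    Measurable.lintegral_prod_right' (f := fun q : Sph × Vel =>
      g q.2 * ENNReal.ofReal (crossSection v q.2 q.1)) (by fun_prop)
  have htonelli : eLossRate g v
      = ∫⁻ ν, (∫⁻ w, g w * ENNReal.ofReal (crossSection v w ν)) ∂surf :=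
    lintegral_prod _ (by fun_prop)
  have hinner : ∀ ν : Sph, ∫ w, g₀ w * crossSection v w ν
      = (∫⁻ w, g w * ENNReal.ofReal (crossSection v w ν)).toReal := fun ν => by
    have hae : ∀ᵐ w, g₀ w * crossSection v w ν
        = (g w * ENNReal.ofReal (crossSection v w ν)).toReal := by
      filter_upwards [hb.ae_eq] with w hw
      rw [hw, ENNReal.toReal_mul, ENNReal.toReal_ofReal (crossSection_nonneg _ _ _)]
    rw [integral_congr_ae hae, integral_toReal (by fun_prop) (Filter.Eventually.of_forall fun w =>
      ENNReal.mul_lt_top (hb.ne_top w).lt_top ENNReal.ofReal_lt_top)]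
  simp only [lossRate, hinner]
  rw [htonelli, integral_toReal hmeas.aemeasurable]
  exact ae_lt_top hmeas (htonelli ▸ hb.eLossRate_ne_top v)

lemma ofReal_lossRate (hb : IsBackground g₀ g) (v : Vel) :
    ENNReal.ofReal (lossRate g₀ v) = eLossRate g v := by
  rw [hb.lossRate_eq_toReal, ENNReal.ofReal_toReal (hb.eLossRate_ne_top v)]

lemma lossRate_nonneg (hb : IsBackground g₀ g) (v : Vel) : 0 ≤ lossRate g₀ v :=
  hb.lossRate_eq_toReal v ▸ ENNReal.toReal_nonneg

lemma exists_lossRate_le (hb : IsBackground g₀ g) :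
    ∃ C : ℝ, ∀ v, lossRate g₀ v ≤ C * (1 + ‖v‖) := by
  refine ⟨(∫⁻ p : Sph × Vel, g p.2 * ENNReal.ofReal (1 + ‖p.2‖) ∂(surf.prod volume)).toReal,
    fun v => ?_⟩
  rw [hb.lossRate_eq_toReal, mul_comm, ← ENNReal.toReal_ofReal (show 0 ≤ 1 + ‖v‖ by positivity),
    ← ENNReal.toReal_mul]
  exact ENNReal.toReal_mono (ENNReal.mul_ne_top ENNReal.ofReal_ne_top
    hb.lintegral_prod_one_add_norm_ne_top) (eLossRate_le hb.measurable v)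

lemma measurable_lossRate (hb : IsBackground g₀ g) : Measurable (lossRate g₀) := by
  rw [show lossRate g₀ = fun v => (eLossRate g v).toReal from funext hb.lossRate_eq_toReal]
  exact (measurable_eLossRate hb.measurable).ennreal_toReal

end IsBackground

/-! ### Transport with damping -/

/-- The probability `exp (- t L(v))` of no collision during a time `t`. -/
def survival (L : Vel → ℝ) (t : ℝ) (v : Vel) : ℝ≥0∞ := ENNReal.ofReal (Real.exp (-(t * L v)))

/-- Damped free transport of the density `f`. -/
def eTransport (L : Vel → ℝ) (f : Phase → ℝ≥0∞) (t : ℝ) (z : Phase) : ℝ≥0∞ :=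
  survival L t z.2 * f (freeFlow (-t) z)

/-- Duhamel's formula for the damped free transport of a source `q` in time. -/
def eDuhamel (L : Vel → ℝ) (q : ℝ → Phase → ℝ≥0∞) (t : ℝ) (z : Phase) : ℝ≥0∞ :=
  ∫⁻ s in Ioc 0 t, eTransport L (q s) (t - s) z

/-- Data `f` at time zero, as a measure on space-time. -/
def initMeasure (f : Phase → ℝ≥0∞) : Measure (ℝ × Phase) :=
  (Measure.dirac 0).prod (volume.withDensity f)

/-- A source `q` in positive time, as a measure on space-time. -/
def sourceMeasure (q : ℝ → Phase → ℝ≥0∞) : Measure (ℝ × Phase) :=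
  ((volume.restrict (Ioi 0)).prod volume).withDensity (Function.uncurry q)

/-- `u t` is at each time `t ≥ 0` the density of the particles emitted by `ρ` up to time `t`, which
move freely and survive for a time `s` with probability `exp (- s L(v))`. This is a weak form of
`∂ₜ u = -v · ∂ₓ u - L u + ρ`. -/
def Evolves (L : Vel → ℝ) (ρ : Measure (ℝ × Phase)) (u : ℝ → Phase → ℝ≥0∞) : Prop :=
  ∀ t, 0 ≤ t → ∀ ψ : Phase → ℝ≥0∞, Measurable ψ → ∫⁻ z, ψ z * u t z =
    ∫⁻ p in {p | p.1 ≤ t}, survival L (t - p.1) p.2.2 * ψ (freeFlow (t - p.1) p.2) ∂ρ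

instance (f : Phase → ℝ≥0∞) : SFinite (initMeasure f) := by unfold initMeasure; infer_instance

instance (q : ℝ → Phase → ℝ≥0∞) : SFinite (sourceMeasure q) := by
  unfold sourceMeasure; infer_instance

section

variable {L : Vel → ℝ}

@[fun_prop]
lemma measurable_survival {α : Type*} [MeasurableSpace α] {t : α → ℝ} {v : α → Vel}
    (hL : Measurable L) (ht : Measurable t) (hv : Measurable v) :
    Measurable fun a => survival L (t a) (v a) := by
  unfold survival; fun_prop

lemma measurable_eTransport {α : Type*} [MeasurableSpace α] {q : α → Phase → ℝ≥0∞} {t : α → ℝ}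
    {z : α → Phase} (hL : Measurable L) (hq : Measurable (Function.uncurry q)) (ht : Measurable t)
    (hz : Measurable z) : Measurable fun a => eTransport L (q a) (t a) (z a) :=
  (by fun_prop : Measurable fun a => survival L (t a) (z a).2).mul
    (hq.comp (f := fun a => (a, freeFlow (-(t a)) (z a))) (by fun_prop))

lemma measurableSet_fst_le {α : Type*} [MeasurableSpace α] (t : ℝ) :
    MeasurableSet {p : ℝ × α | p.1 ≤ t} :=
  measurableSet_le measurable_fst measurable_const

lemma lintegral_initMeasure {f : Phase → ℝ≥0∞} (hf : Measurable f) {F : ℝ × Phase → ℝ≥0∞}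
    (hF : Measurable F) {t : ℝ} (ht : 0 ≤ t) :
    ∫⁻ p in {p | p.1 ≤ t}, F p ∂(initMeasure f) = ∫⁻ z, f z * F (0, z) := by
  rw [← lintegral_indicator (measurableSet_fst_le t), initMeasure, Measure.dirac_prod,
    lintegral_map (hF.indicator (measurableSet_fst_le t)) (by fun_prop),
    lintegral_withDensity_eq_lintegral_mul _ hf
      (g := fun z => {p : ℝ × Phase | p.1 ≤ t}.indicator F (0, z))
      ((hF.indicator (measurableSet_fst_le t)).comp (by fun_prop))]
  simp [indicator, ht]

lemma lintegral_sourceMeasure {q : ℝ → Phase → ℝ≥0∞} (hq : Measurable (Function.uncurry q))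
    {F : ℝ × Phase → ℝ≥0∞} (hF : Measurable F) (t : ℝ) :
    ∫⁻ p in {p | p.1 ≤ t}, F p ∂(sourceMeasure q)
      = ∫⁻ s in Ioc 0 t, ∫⁻ z, q s z * F (s, z) := by
  rw [← lintegral_indicator (measurableSet_fst_le t), sourceMeasure,
    lintegral_withDensity_eq_lintegral_mul _ hq (hF.indicator (measurableSet_fst_le t)),
    lintegral_prod _ (hq.mul (hF.indicator (measurableSet_fst_le t))).aemeasurable,
    ← lintegral_indicator measurableSet_Ioi, ← lintegral_indicator measurableSet_Ioc]
  refine lintegral_congr fun s => ?_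
  by_cases h0 : 0 < s <;> by_cases h1 : s ≤ t <;> simp [indicator, h0, h1, Function.uncurry]

lemma ae_initMeasure_fst_nonneg (f : Phase → ℝ≥0∞) : ∀ᵐ p ∂initMeasure f, 0 ≤ p.1 := by
  have : MeasurableSet {p : ℝ × Phase | 0 ≤ p.1} := measurableSet_le measurable_const measurable_fst
  rw [initMeasure, Measure.dirac_prod, ae_map_iff (by fun_prop) this]
  simp

lemma ae_sourceMeasure_fst_nonneg (q : ℝ → Phase → ℝ≥0∞) : ∀ᵐ p ∂sourceMeasure q, 0 ≤ p.1 := by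
  refine (withDensity_absolutelyContinuous _ _).ae_le ?_
  have : ∀ᵐ s : ℝ ∂(volume.restrict (Ioi 0)), 0 ≤ s :=
    (ae_restrict_mem measurableSet_Ioi).mono fun _ hs => le_of_lt hs
  exact Measure.quasiMeasurePreserving_fst.ae this

lemma evolves_eTransport (hL : Measurable L) {f : Phase → ℝ≥0∞} (hf : Measurable f) :
    Evolves L (initMeasure f) (eTransport L f) := by
  intro t ht ψ hψ
  rw [lintegral_initMeasure hf (by fun_prop) ht,
    ← (measurePreserving_freeFlow t).lintegral_comp (f := fun z => ψ z * eTransport L f t z)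
      (hψ.mul (measurable_eTransport (q := fun _ : Phase => f) hL (by fun_prop) measurable_const
        measurable_id))]
  refine lintegral_congr fun z => ?_
  simp only [eTransport, freeFlow_freeFlow, freeFlow_snd, neg_add_cancel, freeFlow_zero, sub_zero]
  ring

lemma evolves_eDuhamel (hL : Measurable L) {q : ℝ → Phase → ℝ≥0∞}
    (hq : Measurable (Function.uncurry q)) : Evolves L (sourceMeasure q) (eDuhamel L q) := by
  intro t _ ψ hψ
  have hm : Measurable fun p : Phase × ℝ => eTransport L (q p.2) (t - p.2) p.1 :=
    measurable_eTransport hL (q := fun p : Phase × ℝ => q p.2)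
      (hq.comp (f := fun x : (Phase × ℝ) × Phase => (x.1.2, x.2)) (by fun_prop)) (by fun_prop)
      (by fun_prop)
  rw [lintegral_sourceMeasure hq (by fun_prop)]
  calc ∫⁻ z, ψ z * eDuhamel L q t z
      = ∫⁻ z, ∫⁻ s in Ioc 0 t, ψ z * eTransport L (q s) (t - s) z := by
        refine lintegral_congr fun z => (lintegral_const_mul _ ?_).symm
        exact hm.comp (f := fun s : ℝ => (z, s)) (by fun_prop)
    _ = ∫⁻ s in Ioc 0 t, ∫⁻ z, ψ z * eTransport L (q s) (t - s) z :=
        lintegral_lintegral_swap ((hψ.comp measurable_fst).mul hm).aemeasurable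
    _ = _ := by
        refine setLIntegral_congr_fun measurableSet_Ioc fun s hs => ?_
        have hqs : Measurable (q s) := hq.comp (f := fun z : Phase => (s, z)) (by fun_prop)
        have hts : 0 ≤ t - s := sub_nonneg.2 hs.2
        have := evolves_eTransport hL hqs (t - s) hts ψ hψ
        rw [lintegral_initMeasure hqs (by fun_prop) hts] at this
        simpa only [sub_zero] using this

lemma Evolves.add {ρ₁ ρ₂ : Measure (ℝ × Phase)} {u₁ u₂ : ℝ → Phase → ℝ≥0∞}
    (h₁ : Evolves L ρ₁ u₁) (h₂ : Evolves L ρ₂ u₂) (hu : ∀ t, Measurable (u₁ t)) :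
    Evolves L (ρ₁ + ρ₂) (fun t z => u₁ t z + u₂ t z) := by
  intro t ht ψ hψ
  have := hu t
  simp_rw [mul_add]
  rw [lintegral_add_left (by fun_prop), h₁ t ht ψ hψ, h₂ t ht ψ hψ, Measure.restrict_add,
    lintegral_add_measure]

lemma lintegral_exp_decay {c a b : ℝ} (hc : 0 ≤ c) (hab : a ≤ b) :
    ∫⁻ s in Ioc a b, ENNReal.ofReal (c * Real.exp (-((s - a) * c)))
      = ENNReal.ofReal (1 - Real.exp (-((b - a) * c))) := by
  have hcont : Continuous fun s : ℝ => c * Real.exp (-((s - a) * c)) := by fun_prop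
  have hderiv : ∀ s ∈ uIcc a b, HasDerivAt (fun s : ℝ => -Real.exp (-((s - a) * c)))
      (c * Real.exp (-((s - a) * c))) s := by
    intro s _
    have : HasDerivAt (fun s : ℝ => -((s - a) * c)) (-(1 * c)) s :=
      (((hasDerivAt_id s).sub_const a).mul_const c).neg
    exact this.exp.neg.congr_deriv (by ring)
  rw [← ofReal_integral_eq_lintegral_ofReal (hcont.intervalIntegrable a b).1
      (.of_forall fun s => mul_nonneg hc (Real.exp_nonneg _)),
    ← intervalIntegral.integral_of_le hab,
    intervalIntegral.integral_eq_sub_of_hasDerivAt hderiv (hcont.intervalIntegrable _ _)]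
  simp only [sub_self, zero_mul, neg_zero, Real.exp_zero]
  ring_nf

lemma survival_add_lintegral_loss {v : Vel} (hv : 0 ≤ L v) {r t : ℝ} (hrt : r ≤ t) :
    survival L (t - r) v + ∫⁻ s in Ioc r t, ENNReal.ofReal (L v) * survival L (s - r) v = 1 := by
  have hexp : Real.exp (-((t - r) * L v)) ≤ 1 :=
    Real.exp_le_one_iff.2 (neg_nonpos.2 (mul_nonneg (sub_nonneg.2 hrt) hv))
  simp only [survival, ← ENNReal.ofReal_mul hv]
  rw [lintegral_exp_decay hv hrt, ← ENNReal.ofReal_add (Real.exp_nonneg _) (sub_nonneg.2 hexp),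
    add_sub_cancel, ENNReal.ofReal_one]

lemma lintegral_Ioc_lintegral_fst_le {α : Type*} [MeasurableSpace α] {ρ : Measure (ℝ × α)}
    [SFinite ρ] (hρ : ∀ᵐ p ∂ρ, 0 ≤ p.1) {F : ℝ → ℝ × α → ℝ≥0∞}
    (hF : Measurable (Function.uncurry F)) (t : ℝ) :
    ∫⁻ s in Ioc 0 t, (∫⁻ p in {p | p.1 ≤ s}, F s p ∂ρ)
      = ∫⁻ p in {p | p.1 ≤ t}, (∫⁻ s in Ioc p.1 t, F s p) ∂ρ := by
  have hmeas : Measurable fun q : ℝ × ℝ × α => {p : ℝ × α | p.1 ≤ q.1}.indicator (F q.1) q.2 := by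
    have : MeasurableSet {q : ℝ × ℝ × α | q.2.1 ≤ q.1} :=
      measurableSet_le (by fun_prop) (by fun_prop)
    exact hF.indicator this
  simp_rw [← lintegral_indicator (measurableSet_fst_le _)]
  rw [lintegral_lintegral_swap hmeas.aemeasurable]
  refine lintegral_congr_ae ?_
  filter_upwards [hρ] with p hp
  simp only [indicator_apply, mem_ofPred_eq]
  by_cases hpt : p.1 ≤ t
  · rw [if_pos hpt, ← lintegral_indicator measurableSet_Ioc,
      ← lintegral_indicator measurableSet_Ioc]
    refine lintegral_congr_ae ?_
    filter_upwards [Measure.ae_ne volume p.1] with s hs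
    rcases lt_or_gt_of_ne hs with h | h
    · simp [h.not_ge, h.not_gt]
    · simp [indicator, h, h.le, hp.trans_lt h]
  · rw [if_neg hpt, setLIntegral_congr_fun measurableSet_Ioc (g := fun _ => 0) fun s hs =>
      if_neg fun h => hpt (h.trans hs.2), lintegral_zero]

lemma Evolves.balance (hL : Measurable L) (hL0 : ∀ v, 0 ≤ L v) {ρ : Measure (ℝ × Phase)} [SFinite ρ]
    (hρ : ∀ᵐ p ∂ρ, 0 ≤ p.1) {u : ℝ → Phase → ℝ≥0∞} (h : Evolves L ρ u) {m : Phase → ℝ≥0∞}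
    (hm : Measurable m) (hinv : ∀ s z, m (freeFlow s z) = m z) {t : ℝ} (ht : 0 ≤ t) :
    (∫⁻ z, m z * u t z) + ∫⁻ s in Ioc 0 t, ∫⁻ z, (m z * ENNReal.ofReal (L z.2)) * u s z
      = ∫⁻ p in {p | p.1 ≤ t}, m p.2 ∂ρ := by
  have hlost : ∫⁻ s in Ioc 0 t, ∫⁻ z, (m z * ENNReal.ofReal (L z.2)) * u s z
      = ∫⁻ p in {p | p.1 ≤ t},
        (∫⁻ s in Ioc p.1 t,
          m p.2 * (ENNReal.ofReal (L p.2.2) * survival L (s - p.1) p.2.2)) ∂ρ := by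
    rw [← lintegral_Ioc_lintegral_fst_le hρ (by unfold Function.uncurry; fun_prop)]
    refine setLIntegral_congr_fun measurableSet_Ioc fun s hs => ?_
    rw [h s hs.1.le (fun z => m z * ENNReal.ofReal (L z.2)) (by fun_prop)]
    simp only [hinv, freeFlow_snd]
    exact lintegral_congr fun p => by ring
  rw [hlost, h t ht m hm, ← lintegral_add_left (by fun_prop)]
  refine setLIntegral_congr_fun (measurableSet_fst_le t) fun p hp => ?_
  have hsurv : Measurable fun s => ENNReal.ofReal (L p.2.2) * survival L (s - p.1) p.2.2 := by
    fun_prop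
  calc survival L (t - p.1) p.2.2 * m (freeFlow (t - p.1) p.2) + ∫⁻ s in Ioc p.1 t,
          m p.2 * (ENNReal.ofReal (L p.2.2) * survival L (s - p.1) p.2.2)
      = m p.2 * (survival L (t - p.1) p.2.2
          + ∫⁻ s in Ioc p.1 t, ENNReal.ofReal (L p.2.2) * survival L (s - p.1) p.2.2) := by
        rw [hinv, lintegral_const_mul _ hsurv, mul_add, mul_comm]
    _ = m p.2 := by rw [survival_add_lintegral_loss (hL0 _) hp, mul_one]

end

/-! ### The series of solutions with `n` collisions -/

/-- The density of the tagged particles with exactly `n` collisions before time `t`. -/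
def collisionSeries (g₀ : Vel → ℝ) (g : Vel → ℝ≥0∞) (f : Phase → ℝ≥0∞) : ℕ → ℝ → Phase → ℝ≥0∞
  | 0 => eTransport (lossRate g₀) f
  | n + 1 => eDuhamel (lossRate g₀) fun s => eGain g (collisionSeries g₀ g f n s)

/-- The solution of the linear Boltzmann equation, as a sum over the number of collisions. -/
def eSolution (g₀ : Vel → ℝ) (g : Vel → ℝ≥0∞) (f : Phase → ℝ≥0∞) (t : ℝ) (z : Phase) : ℝ≥0∞ :=
  ∑' n, collisionSeries g₀ g f n t z

lemma measurable_eDuhamel {L : Vel → ℝ} (hL : Measurable L) {q : ℝ → Phase → ℝ≥0∞}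
    (hq : Measurable (Function.uncurry q)) : Measurable (Function.uncurry (eDuhamel L q)) := by
  have hm : Measurable fun p : (ℝ × Phase) × ℝ => eTransport L (q p.2) (p.1.1 - p.2) p.1.2 :=
    measurable_eTransport hL (q := fun p : (ℝ × Phase) × ℝ => q p.2)
      (hq.comp (f := fun x : ((ℝ × Phase) × ℝ) × Phase => (x.1.2, x.2)) (by fun_prop))
      (by fun_prop) (by fun_prop)
  have hS : MeasurableSet {p : (ℝ × Phase) × ℝ | 0 < p.2 ∧ p.2 ≤ p.1.1} :=
    (measurableSet_lt measurable_const measurable_snd).inter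
      (measurableSet_le measurable_snd measurable_fst.fst)
  convert (hm.indicator hS).lintegral_prod_right' (ν := volume) using 1
  ext ⟨t, z⟩
  exact (lintegral_indicator measurableSet_Ioc _).symm

lemma eGain_tsum {g : Vel → ℝ≥0∞} (hg : Measurable g) {q : ℕ → Phase → ℝ≥0∞}
    (hq : ∀ n, Measurable (q n)) (z : Phase) :
    eGain g (fun z => ∑' n, q n z) z = ∑' n, eGain g (q n) z := by
  simp only [eGain]
  rw [← lintegral_tsum fun n => by have := hq n; fun_prop]
  simp_rw [ENNReal.tsum_mul_right]

lemma eDuhamel_tsum {L : Vel → ℝ} (hL : Measurable L) {q : ℕ → ℝ → Phase → ℝ≥0∞}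
    (hq : ∀ n, Measurable (Function.uncurry (q n))) (t : ℝ) (z : Phase) :
    eDuhamel L (fun s z => ∑' n, q n s z) t z = ∑' n, eDuhamel L (q n) t z := by
  simp only [eDuhamel, eTransport, ← ENNReal.tsum_mul_left]
  refine lintegral_tsum fun n => Measurable.aemeasurable ?_
  exact Measurable.mul (by fun_prop)
    ((hq n).comp (f := fun s : ℝ => (s, freeFlow (-(t - s)) z)) (by fun_prop))

namespace IsBackground

variable {g₀ : Vel → ℝ} {g : Vel → ℝ≥0∞} {f m : Phase → ℝ≥0∞} {t : ℝ} {K : ℝ≥0∞}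

lemma measurable_collisionSeries (hb : IsBackground g₀ g) (hf : Measurable f) (n : ℕ) :
    Measurable (Function.uncurry (collisionSeries g₀ g f n)) := by
  induction n with
  | zero =>
    exact measurable_eTransport hb.measurable_lossRate (q := fun _ : ℝ × Phase => f)
      (by fun_prop) measurable_fst measurable_snd
  | succ n ih =>
    exact measurable_eDuhamel hb.measurable_lossRate (measurable_eGain hb.measurable ih)

lemma measurable_collisionSeries_apply (hb : IsBackground g₀ g) (hf : Measurable f) (n : ℕ)
    (t : ℝ) : Measurable (collisionSeries g₀ g f n t) :=
  (hb.measurable_collisionSeries hf n).comp (f := fun z : Phase => (t, z)) (by fun_prop)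

lemma measurable_eSolution (hb : IsBackground g₀ g) (hf : Measurable f) :
    Measurable (Function.uncurry (eSolution g₀ g f)) :=
  Measurable.tsum fun n => hb.measurable_collisionSeries hf n

lemma measurable_eSolution_apply (hb : IsBackground g₀ g) (hf : Measurable f) (t : ℝ) :
    Measurable (eSolution g₀ g f t) :=
  (hb.measurable_eSolution hf).comp (f := fun z : Phase => (t, z)) (by fun_prop)

lemma balance_collisionSeries_zero (hb : IsBackground g₀ g) (hf : Measurable f)
    (hm : Measurable m) (hinv : ∀ s z, m (freeFlow s z) = m z) (ht : 0 ≤ t) :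
    (∫⁻ z, m z * collisionSeries g₀ g f 0 t z)
        + ∫⁻ s in Ioc 0 t, ∫⁻ z, (m z * eLossRate g z.2) * collisionSeries g₀ g f 0 s z
      = ∫⁻ z, m z * f z := by
  have := (evolves_eTransport hb.measurable_lossRate hf).balance hb.measurable_lossRate
    hb.lossRate_nonneg (ae_initMeasure_fst_nonneg f) hm hinv ht
  simp only [hb.ofReal_lossRate] at this
  rw [collisionSeries, this, lintegral_initMeasure hf (by fun_prop) ht]
  simp_rw [mul_comm]

lemma balance_collisionSeries_succ (hb : IsBackground g₀ g) (hf : Measurable f)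
    (hm : Measurable m) (hinv : ∀ s z, m (freeFlow s z) = m z) (ht : 0 ≤ t) (n : ℕ) :
    (∫⁻ z, m z * collisionSeries g₀ g f (n + 1) t z)
        + ∫⁻ s in Ioc 0 t, ∫⁻ z, (m z * eLossRate g z.2) * collisionSeries g₀ g f (n + 1) s z
      = ∫⁻ s in Ioc 0 t, ∫⁻ z, eGainAdjoint g m z * collisionSeries g₀ g f n s z := by
  have hq := measurable_eGain hb.measurable (hb.measurable_collisionSeries hf n)
  have := (evolves_eDuhamel hb.measurable_lossRate hq).balance hb.measurable_lossRate
    hb.lossRate_nonneg (ae_sourceMeasure_fst_nonneg _) hm hinv ht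
  simp only [hb.ofReal_lossRate] at this
  rw [collisionSeries, this, lintegral_sourceMeasure hq (by fun_prop)]
  refine lintegral_congr fun s => ?_
  simp_rw [mul_comm _ (m _), mul_comm (eGainAdjoint _ _ _)]
  exact lintegral_mul_eGain hb.measurable (hb.measurable_collisionSeries_apply hf n s) hm

lemma lintegral_eGainAdjoint_mul_collisionSeries_le (hb : IsBackground g₀ g) (hf : Measurable f)
    (hm : Measurable m) (hK : ∀ z, eGainAdjoint g m z ≤ m z * eLossRate g z.2 + K) (n : ℕ) :
    ∫⁻ s in Ioc 0 t, ∫⁻ z, eGainAdjoint g m z * collisionSeries g₀ g f n s z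
      ≤ (∫⁻ s in Ioc 0 t, ∫⁻ z, (m z * eLossRate g z.2) * collisionSeries g₀ g f n s z)
        + K * ∫⁻ s in Ioc 0 t, ∫⁻ z, collisionSeries g₀ g f n s z := by
  have hmeas := hb.measurable_collisionSeries hf n
  have hloss : Measurable fun p : ℝ × Phase =>
      (m p.2 * eLossRate g p.2.2) * collisionSeries g₀ g f n p.1 p.2 := by
    have := measurable_eLossRate hb.measurable
    exact Measurable.mul (by fun_prop) hmeas
  have hmass : Measurable fun s : ℝ => ∫⁻ z, collisionSeries g₀ g f n s z :=
    hmeas.lintegral_prod_right'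
  rw [← lintegral_const_mul _ hmass, ← lintegral_add_left hloss.lintegral_prod_right']
  refine lintegral_mono fun s => ?_
  have hs := hb.measurable_collisionSeries_apply hf n s
  dsimp only
  rw [← lintegral_const_mul _ hs, ← lintegral_add_right _ (hs.const_mul K)]
  refine lintegral_mono fun z => ?_
  dsimp only
  grw [hK z, add_mul]

lemma sum_collisionSeries_le (hb : IsBackground g₀ g) (hf : Measurable f) (hm : Measurable m)
    (hinv : ∀ s z, m (freeFlow s z) = m z)
    (hK : ∀ z, eGainAdjoint g m z ≤ m z * eLossRate g z.2 + K) (ht : 0 ≤ t) (N : ℕ) :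
    (∑ n ∈ Finset.range (N + 1), ∫⁻ z, m z * collisionSeries g₀ g f n t z)
        + ∫⁻ s in Ioc 0 t, ∫⁻ z, (m z * eLossRate g z.2) * collisionSeries g₀ g f N s z
      ≤ (∫⁻ z, m z * f z) + K * ∑ n ∈ Finset.range N,
        ∫⁻ s in Ioc 0 t, ∫⁻ z, collisionSeries g₀ g f n s z := by
  induction N with
  | zero => simpa using (hb.balance_collisionSeries_zero hf hm hinv ht).le
  | succ N ih =>
    rw [Finset.sum_range_succ _ (N + 1), add_assoc,
      hb.balance_collisionSeries_succ hf hm hinv ht, Finset.sum_range_succ (fun n =>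
        ∫⁻ s in Ioc 0 t, ∫⁻ z, collisionSeries g₀ g f n s z) N, mul_add, ← add_assoc]
    refine le_trans ?_ (add_le_add_left ih _)
    rw [add_assoc]
    exact add_le_add_right (hb.lintegral_eGainAdjoint_mul_collisionSeries_le hf hm hK N) _

lemma lintegral_mul_eSolution (hb : IsBackground g₀ g) (hf : Measurable f) (hm : Measurable m)
    (t : ℝ) : ∫⁻ z, m z * eSolution g₀ g f t z
      = ∑' n, ∫⁻ z, m z * collisionSeries g₀ g f n t z := by
  rw [← lintegral_tsum (f := fun n z => m z * collisionSeries g₀ g f n t z) fun n =>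
    (hm.mul (hb.measurable_collisionSeries_apply hf n t)).aemeasurable]
  simp_rw [eSolution, ENNReal.tsum_mul_left]

lemma sum_lintegral_collisionSeries_le (hb : IsBackground g₀ g) (hf : Measurable f) (N : ℕ) :
    ∑ n ∈ Finset.range N, ∫⁻ s in Ioc 0 t, ∫⁻ z, collisionSeries g₀ g f n s z
      ≤ ∫⁻ s in Ioc 0 t, ∫⁻ z, eSolution g₀ g f s z := by
  rw [← lintegral_finsetSum (f := fun n s => ∫⁻ z, collisionSeries g₀ g f n s z) _
    fun n _ => (hb.measurable_collisionSeries hf n).lintegral_prod_right']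
  refine lintegral_mono fun s => ?_
  dsimp only
  rw [← lintegral_finsetSum _ fun n _ => hb.measurable_collisionSeries_apply hf n s]
  exact lintegral_mono fun z => ENNReal.sum_le_tsum _

lemma lintegral_mul_eSolution_le (hb : IsBackground g₀ g) (hf : Measurable f) (hm : Measurable m)
    (hinv : ∀ s z, m (freeFlow s z) = m z)
    (hK : ∀ z, eGainAdjoint g m z ≤ m z * eLossRate g z.2 + K) (ht : 0 ≤ t) :
    ∫⁻ z, m z * eSolution g₀ g f t z
      ≤ (∫⁻ z, m z * f z) + K * ∫⁻ s in Ioc 0 t, ∫⁻ z, eSolution g₀ g f s z := by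
  rw [hb.lintegral_mul_eSolution hf hm]
  refine ENNReal.tsum_le_of_sum_range_le fun N => ?_
  calc ∑ n ∈ Finset.range N, ∫⁻ z, m z * collisionSeries g₀ g f n t z
      ≤ ∑ n ∈ Finset.range (N + 1), ∫⁻ z, m z * collisionSeries g₀ g f n t z :=
        Finset.sum_le_sum_of_subset (Finset.range_subset_range.2 N.le_succ)
    _ ≤ (∫⁻ z, m z * f z) + K * ∑ n ∈ Finset.range N,
          ∫⁻ s in Ioc 0 t, ∫⁻ z, collisionSeries g₀ g f n s z :=
        le_self_add.trans (hb.sum_collisionSeries_le hf hm hinv hK ht N)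
    _ ≤ _ := by grw [hb.sum_lintegral_collisionSeries_le hf N]

lemma lintegral_eSolution_le (hb : IsBackground g₀ g) (hf : Measurable f) (ht : 0 ≤ t) :
    ∫⁻ z, eSolution g₀ g f t z ≤ ∫⁻ z, f z := by
  simpa using hb.lintegral_mul_eSolution_le hf (m := 1) measurable_const (fun _ _ => rfl) (K := 0)
    (fun z => by simp [eGainAdjoint_one]) ht

lemma lintegral_velWeight_mul_eSolution_le (hb : IsBackground g₀ g) (hf : Measurable f)
    (ht : 0 ≤ t) : ∫⁻ z, velWeight z * eSolution g₀ g f t z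
      ≤ (∫⁻ z, velWeight z * f z) + weightRate g * (ENNReal.ofReal t * ∫⁻ z, f z) := by
  have hmass : ∫⁻ s in Ioc 0 t, ∫⁻ z, eSolution g₀ g f s z ≤ ENNReal.ofReal t * ∫⁻ z, f z :=
    calc ∫⁻ s in Ioc 0 t, ∫⁻ z, eSolution g₀ g f s z ≤ ∫⁻ _ in Ioc 0 t, ∫⁻ z, f z :=
          setLIntegral_mono measurable_const fun s hs => hb.lintegral_eSolution_le hf hs.1.le
      _ = ENNReal.ofReal t * ∫⁻ z, f z := by simp [mul_comm]
  grw [hb.lintegral_mul_eSolution_le hf measurable_velWeight (fun _ _ => rfl)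
    (eGainAdjoint_velWeight_le hb.measurable) ht, hmass]

lemma eSolution_eq (hb : IsBackground g₀ g) (hf : Measurable f) (t : ℝ) (z : Phase) :
    eSolution g₀ g f t z = eTransport (lossRate g₀) f t z
      + eDuhamel (lossRate g₀) (fun s => eGain g (eSolution g₀ g f s)) t z := by
  have hgain : (fun s => eGain g (eSolution g₀ g f s))
      = fun s z => ∑' n, eGain g (collisionSeries g₀ g f n s) z := by
    ext s z
    exact eGain_tsum hb.measurable (fun n => hb.measurable_collisionSeries_apply hf n s) z
  rw [eSolution, tsum_eq_zero_add' ENNReal.summable, hgain, eDuhamel_tsum hb.measurable_lossRate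
    fun n => measurable_eGain hb.measurable (hb.measurable_collisionSeries hf n)]
  rfl

lemma evolves_eSolution (hb : IsBackground g₀ g) (hf : Measurable f) :
    Evolves (lossRate g₀) (initMeasure f + sourceMeasure fun s => eGain g (eSolution g₀ g f s))
      (eSolution g₀ g f) := by
  convert (evolves_eTransport hb.measurable_lossRate hf).add (evolves_eDuhamel
    hb.measurable_lossRate (measurable_eGain hb.measurable (hb.measurable_eSolution hf)))
    (hb.measurable_collisionSeries_apply hf 0) using 1
  ext t z
  exact hb.eSolution_eq hf t z

end IsBackground

/-! ### Mild solutions for dissipative operators -/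

section Dissipative

open Filter Topology

lemma absolutelyContinuousOnInterval_of_dist_le {X Y : Type*} [PseudoMetricSpace X]
    [PseudoMetricSpace Y] {f : ℝ → X} {g : ℝ → Y} {a b : ℝ}
    (hg : AbsolutelyContinuousOnInterval g a b)
    (h : ∀ x ∈ uIcc a b, ∀ y ∈ uIcc a b, dist (f x) (f y) ≤ dist (g x) (g y)) :
    AbsolutelyContinuousOnInterval f a b := by
  rw [absolutelyContinuousOnInterval_iff] at hg ⊢
  intro ε hε
  obtain ⟨δ, hδ, H⟩ := hg ε hε
  refine ⟨δ, hδ, fun I hI hlt => lt_of_le_of_lt ?_ (H I hI hlt)⟩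
  exact Finset.sum_le_sum fun i hi => h _ (hI.1 i hi).1 _ (hI.1 i hi).2

variable {E : Type*} [NormedAddCommGroup E] [NormedSpace ℝ E]

lemma tendsto_backward_slope {u : ℝ → E} {u' : E} {x : ℝ} (hu : HasDerivAt u u' x) :
    Tendsto (fun s : ℝ => s⁻¹ • (u (x + -s) - u x)) (𝓝[>] 0) (𝓝 (-u')) := by
  have hneg : Tendsto (fun s : ℝ => -s) (𝓝[>] 0) (𝓝[<] 0) := by
    simpa using tendsto_neg_nhdsGT (a := (0 : ℝ))
  refine (hu.tendsto_slope_zero_left.comp hneg).neg.congr fun s => ?_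
  simp [inv_neg]

lemma deriv_norm_nonpos_of_dissipative {u : ℝ → E} {u' : E} {x : ℝ} (hu : HasDerivAt u u' x)
    (hN : DifferentiableAt ℝ (fun t => ‖u t‖) x)
    (hdis : ∀ s : ℝ, 0 < s → ‖u x‖ ≤ ‖u x - s • u'‖) : deriv (fun t => ‖u t‖) x ≤ 0 := by
  have hlim : Tendsto (fun s : ℝ => s⁻¹ • (‖u (x + -s)‖ - ‖u x‖)
      + ‖s⁻¹ • (u (x + -s) - u x) + u'‖) (𝓝[>] 0) (𝓝 (-deriv (fun t => ‖u t‖) x)) := by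
    simpa using (tendsto_backward_slope hN.hasDerivAt).add
      ((tendsto_backward_slope hu).add_const u').norm
  refine neg_nonneg.1 (ge_of_tendsto hlim ?_)
  filter_upwards [self_mem_nhdsWithin] with s (hs : 0 < s)
  have hstep : s⁻¹ • (u (x + -s) - u x) + u' = s⁻¹ • (u (x + -s) - (u x - s • u')) := by
    rw [sub_sub_eq_add_sub, add_sub_right_comm, smul_add, smul_smul, inv_mul_cancel₀ hs.ne',
      one_smul]
  rw [hstep, norm_smul, Real.norm_of_nonneg (inv_nonneg.2 hs.le), smul_eq_mul, ← mul_add]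
  refine mul_nonneg (inv_nonneg.2 hs.le) ?_
  have htri := norm_sub_norm_le (u x - s • u') (u (x + -s))
  rw [norm_sub_rev (u x - s • u')] at htri
  linarith [hdis s hs]

lemma absolutelyContinuousOnInterval_norm_integral {h : ℝ → E} {a b : ℝ}
    (hh : IntervalIntegrable h volume a b) :
    AbsolutelyContinuousOnInterval (fun t => ‖∫ θ in a..t, h θ‖) a b := by
  have hsub : ∀ {x}, x ∈ uIcc a b → IntervalIntegrable h volume a x := fun hx =>
    hh.mono_set (uIcc_subset_uIcc_left hx)
  refine absolutelyContinuousOnInterval_of_dist_le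
    (hh.norm.absolutelyContinuousOnInterval_intervalIntegral left_mem_uIcc) fun x hx y hy => ?_
  rw [Real.dist_eq, Real.dist_eq,
    intervalIntegral.integral_interval_sub_left (hsub hx).norm (hsub hy).norm]
  refine (abs_norm_sub_norm_le _ _).trans ?_
  rw [intervalIntegral.integral_interval_sub_left (hsub hx) (hsub hy)]
  exact intervalIntegral.norm_integral_le_abs_integral_norm

/-- Uniqueness of mild solutions for a dissipative operator, given by its graph `D`. -/
lemma integral_eq_zero_of_dissipative [CompleteSpace E] {D : E → E → Prop}
    (hD : ∀ x y, D x y → ∀ s : ℝ, 0 < s → ‖x‖ ≤ ‖x - s • y‖) {T : ℝ} {h : ℝ → E}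
    (hint : IntervalIntegrable h volume 0 T)
    (heq : ∀ t ∈ Icc (0 : ℝ) T, D (∫ θ in (0 : ℝ)..t, h θ) (h t)) {t : ℝ} (ht : t ∈ Icc (0 : ℝ) T) :
    ∫ θ in (0 : ℝ)..t, h θ = 0 := by
  have hht : IntervalIntegrable h volume 0 t := by
    refine hint.mono_set (uIcc_subset_uIcc_left ?_)
    rwa [uIcc_of_le (ht.1.trans ht.2)]
  have hac := absolutelyContinuousOnInterval_norm_integral hht
  have hderiv : ∀ᵐ x ∂(volume.restrict (Ioc 0 t)),
      deriv (fun t => ‖∫ θ in (0 : ℝ)..t, h θ‖) x ≤ 0 := by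
    rw [ae_restrict_iff' measurableSet_Ioc]
    filter_upwards [hac.ae_differentiableAt, hht.ae_hasDerivAt_integral] with x hdiff hderiv hx
    have hx' : x ∈ uIcc 0 t := by
      rw [uIcc_of_le ht.1]; exact ⟨hx.1.le, hx.2⟩
    exact deriv_norm_nonpos_of_dissipative (hderiv hx' 0 left_mem_uIcc) (hdiff hx')
      (hD _ _ (heq x ⟨hx.1.le, hx.2.trans ht.2⟩))
  have hnonpos := integral_nonpos_of_ae hderiv
  rw [← intervalIntegral.integral_of_le ht.1, hac.integral_deriv_eq_sub,
    intervalIntegral.integral_same, norm_zero, sub_zero] at hnonpos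
  exact norm_le_zero_iff.1 hnonpos

end Dissipative

/-! ### Parametrized families in `L¹` -/

lemma measurable_of_measurable_dist {α X : Type*} [MeasurableSpace α] [PseudoMetricSpace X]
    [SecondCountableTopology X] [MeasurableSpace X] [BorelSpace X] {f : α → X}
    (hf : ∀ x, Measurable fun a => dist (f a) x) : Measurable f := by
  refine measurable_of_isOpen fun U hU => ?_
  choose! r hr hrU using Metric.isOpen_iff.1 hU
  obtain ⟨S, -, hS, hSeq⟩ := TopologicalSpace.isOpen_biUnion_countable U
    (fun x => Metric.ball x (r x)) fun _ _ => Metric.isOpen_ball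
  have hcover : U = ⋃ x ∈ S, Metric.ball x (r x) := by
    rw [hSeq]
    exact Subset.antisymm (fun x hx => mem_biUnion hx (Metric.mem_ball_self (hr x hx)))
      (iUnion₂_subset hrU)
  rw [hcover, preimage_iUnion₂]
  exact MeasurableSet.biUnion hS fun x _ => measurableSet_lt (hf x) measurable_const

section FamiliesInL1

variable {Θ X : Type*} [MeasurableSpace Θ] [MeasurableSpace X] {μ : Measure X}

lemma integrable_coeFn_mul (F : Lp ℝ 1 μ) {ψ : X → ℝ} (hψ : Measurable ψ) {M : ℝ}
    (hM : ∀ x, ‖ψ x‖ ≤ M) : Integrable (fun x => F x * ψ x) μ :=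
  (L1.integrable_coeFn F).mul_bdd hψ.aestronglyMeasurable (Filter.Eventually.of_forall hM)

lemma integral_coeFn_sub_mul (F F' : Lp ℝ 1 μ) {ψ : X → ℝ} (hψ : Measurable ψ) {M : ℝ}
    (hM : ∀ x, ‖ψ x‖ ≤ M) :
    ∫ x, (F - F') x * ψ x ∂μ = (∫ x, F x * ψ x ∂μ) - ∫ x, F' x * ψ x ∂μ := by
  rw [← integral_sub (integrable_coeFn_mul F hψ hM) (integrable_coeFn_mul F' hψ hM)]
  refine integral_congr_ae ?_
  filter_upwards [Lp.coeFn_sub F F'] with x hx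
  rw [hx, Pi.sub_apply, sub_mul]

lemma norm_toL1 {v : X → ℝ} (hv : Integrable v μ) : ‖hv.toL1 v‖ = ∫ x, ‖v x‖ ∂μ := by
  rw [L1.norm_eq_integral_norm]
  exact integral_congr_ae (hv.coeFn_toL1.fun_comp norm)

lemma enorm_eq_lintegral_of_ae_eq {v : Lp ℝ 1 μ} {v' : X → ℝ} (h : v =ᵐ[μ] v') :
    ‖v‖ₑ = ∫⁻ x, ‖v' x‖ₑ ∂μ := by
  rw [Lp.enorm_def, eLpNorm_one_eq_lintegral_enorm]
  exact lintegral_congr_ae (h.fun_comp (‖·‖ₑ))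

variable [MeasurableSpace.CountablyGenerated X] [SFinite μ] {ρ : Measure Θ} {u : Θ → X → ℝ}

lemma stronglyMeasurable_toL1 (hu : Measurable (Function.uncurry u))
    (hi : ∀ t, Integrable (u t) μ) : StronglyMeasurable fun t => (hi t).toL1 (u t) := by
  borelize ↥(Lp ℝ 1 μ)
  have : Fact ((1 : ℝ≥0∞) ≠ ⊤) := ⟨ENNReal.one_ne_top⟩
  refine Measurable.stronglyMeasurable (measurable_of_measurable_dist fun k => ?_)
  have hdist : ∀ t, dist ((hi t).toL1 (u t)) k = ∫ x, ‖u t x - k x‖ ∂μ := by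
    intro t
    rw [L1.dist_eq_integral_dist]
    refine integral_congr_ae ?_
    filter_upwards [(hi t).coeFn_toL1] with x hx
    rw [hx, dist_eq_norm]
  simp_rw [hdist]
  refine StronglyMeasurable.measurable (StronglyMeasurable.integral_prod_right
    (f := fun t x => ‖u t x - k x‖) ?_)
  exact (hu.stronglyMeasurable.sub
    ((Lp.stronglyMeasurable k).comp_measurable measurable_snd)).norm

lemma integrable_toL1 (hu : Measurable (Function.uncurry u)) (hi : ∀ t, Integrable (u t) μ)
    (hI : Integrable (Function.uncurry u) (ρ.prod μ)) :
    Integrable (fun t => (hi t).toL1 (u t)) ρ := by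
  refine ⟨(stronglyMeasurable_toL1 hu hi).aestronglyMeasurable, ?_⟩
  rw [← hasFiniteIntegral_norm_iff]
  refine hI.integral_norm_prod_left.2.congr' (Filter.Eventually.of_forall fun t => ?_)
  simp only [norm_toL1, Function.uncurry_apply_pair]

lemma coeFn_integral_toL1 [SFinite ρ] (hu : Measurable (Function.uncurry u))
    (hi : ∀ t, Integrable (u t) μ) (hI : Integrable (Function.uncurry u) (ρ.prod μ)) :
    ⇑(∫ t, (hi t).toL1 (u t) ∂ρ) =ᵐ[μ] fun x => ∫ t, u t x ∂ρ := by
  refine Integrable.ae_eq_of_forall_setIntegral_eq _ _ (L1.integrable_coeFn _)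
    hI.integral_prod_right fun s _ _ => ?_
  have hclm : ∀ k : Lp ℝ 1 μ, ∫ x in s, k x ∂μ
      = (L1.integralCLM ∘L LpToLpRestrictCLM X ℝ ℝ μ 1 s) k := by
    intro k
    rw [ContinuousLinearMap.comp_apply, ← L1.integral_def, ← integral_congr_ae
      (LpToLpRestrictCLM_coeFn ℝ s k), L1.integral_eq_integral]
  have hset : ∀ t, ∫ x in s, (hi t).toL1 (u t) x ∂μ = ∫ x in s, u t x ∂μ := fun t =>
    integral_congr_ae (ae_restrict_of_ae (hi t).coeFn_toL1)
  rw [hclm, ← ContinuousLinearMap.integral_comp_comm _ (integrable_toL1 hu hi hI)]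
  simp_rw [← hclm, hset]
  exact integral_integral_swap (hI.mono_measure (Measure.prod_mono le_rfl Measure.restrict_le_self))

end FamiliesInL1

/-! ### The gain term on `L¹` -/

section GainOnL1

variable {g₀ : Vel → ℝ} {g : Vel → ℝ≥0∞}

lemma measurable_eGain_apply (hg : Measurable g) {k : Phase → ℝ≥0∞} (hk : Measurable k) :
    Measurable (eGain g k) :=
  (measurable_eGain (α := Unit) hg (f := fun _ => k) (by fun_prop)).comp
    (f := fun z : Phase => ((), z)) (by fun_prop)

lemma lintegral_eGain (hg : Measurable g) {k : Phase → ℝ≥0∞} (hk : Measurable k) :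
    ∫⁻ z, eGain g k z = ∫⁻ z, k z * eLossRate g z.2 := by
  simpa [eGainAdjoint_one] using lintegral_mul_eGain hg hk (ψ := 1) measurable_const

/-- A version of `gainIntegrand g₀ F` that is jointly measurable whenever `F` is, `g` being a
background density for `g₀`. -/
def gainVersion (g : Vel → ℝ≥0∞) (F : Phase → ℝ) (z : Phase) (p : Sph × Vel) : ℝ :=
  F (z.1, scatter z.2 p.1 p.2) * (g (rebound z.2 p.1 p.2)).toReal * crossSection z.2 p.2 p.1

lemma measurable_gainVersion (hg : Measurable g) {F : Phase → ℝ} (hF : Measurable F) :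
    Measurable (Function.uncurry (gainVersion g F)) := by
  have : Measurable fun v => (g v).toReal := hg.ennreal_toReal
  simp only [gainVersion, Function.uncurry_def]
  fun_prop

namespace IsBackground

variable (hb : IsBackground g₀ g) {F F' : Phase → ℝ}
include hb

lemma lintegral_enorm_gainVersion (z : Phase) :
    ∫⁻ p, ‖gainVersion g F z p‖ₑ ∂(surf.prod volume) = eGain g (fun z => ‖F z‖ₑ) z := by
  refine lintegral_congr fun p => ?_
  rw [gainVersion, enorm_mul, enorm_mul, Real.enorm_of_nonneg ENNReal.toReal_nonneg,
    ENNReal.ofReal_toReal (hb.ne_top _), Real.enorm_of_nonneg (crossSection_nonneg _ _ _)]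

lemma gainIntegrand_ae_eq (hF : F' =ᵐ[volume] F) :
    ∀ᵐ z : Phase, ∀ᵐ p : Sph × Vel ∂(surf.prod volume),
      gainIntegrand g₀ F' z p.1 p.2 = gainVersion g F z p := by
  have hF₁ : ∀ᵐ q ∂collisionMeasure, F' q.1 = F q.1 :=
    Measure.quasiMeasurePreserving_fst.ae hF
  have hg₁ : ∀ᵐ q ∂collisionMeasure, g₀ q.2.2 = (g q.2.2).toReal :=
    (Measure.quasiMeasurePreserving_snd.comp Measure.quasiMeasurePreserving_snd).ae hb.ae_eq
  have hcollide := measurePreserving_collide.quasiMeasurePreserving.ae (hF₁.and hg₁)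
  filter_upwards [Measure.ae_ae_of_ae_prod hcollide] with z hz
  filter_upwards [hz] with p hp
  have hFp : F' (z.1, scatter z.2 p.1 p.2) = F (z.1, scatter z.2 p.1 p.2) := hp.1
  have hgp : g₀ (rebound z.2 p.1 p.2) = (g (rebound z.2 p.1 p.2)).toReal := hp.2
  rw [gainVersion, ← hFp, ← hgp, gainIntegrand, add_inner_smul_eq_scatter, rebound]

lemma ae_integrable_gainVersion (hm : Measurable F)
    (hfin : ∫⁻ z, ‖F z‖ₑ * eLossRate g z.2 ≠ ⊤) :
    ∀ᵐ z : Phase, Integrable (gainVersion g F z) (surf.prod volume) := by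
  rw [← lintegral_eGain hb.measurable hm.enorm] at hfin
  filter_upwards [ae_lt_top (measurable_eGain_apply hb.measurable hm.enorm) hfin] with z hz
  refine ⟨((measurable_gainVersion hb.measurable hm).comp
    measurable_prodMk_left).aestronglyMeasurable, ?_⟩
  rwa [HasFiniteIntegral, hb.lintegral_enorm_gainVersion]

lemma ae_integrable_gainIntegrand (hm : Measurable F) (hF : F' =ᵐ[volume] F)
    (hfin : ∫⁻ z, ‖F z‖ₑ * eLossRate g z.2 ≠ ⊤) :
    ∀ᵐ z : Phase, Integrable (fun p : Sph × Vel => gainIntegrand g₀ F' z p.1 p.2)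
      (surf.prod volume) := by
  filter_upwards [hb.ae_integrable_gainVersion hm hfin, hb.gainIntegrand_ae_eq hF] with z hz hz'
  exact hz.congr (hz'.mono fun p hp => hp.symm)

lemma gainTerm_ae_eq (hm : Measurable F) (hF : F' =ᵐ[volume] F)
    (hfin : ∫⁻ z, ‖F z‖ₑ * eLossRate g z.2 ≠ ⊤) :
    gainTerm g₀ F' =ᵐ[volume] fun z => ∫ p, gainVersion g F z p ∂(surf.prod volume) := by
  filter_upwards [hb.ae_integrable_gainIntegrand hm hF hfin, hb.gainIntegrand_ae_eq hF]
    with z hz hz'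
  rw [gainTerm, ← integral_congr_ae hz', integral_prod _ hz]

lemma lintegral_enorm_gainTerm_le (hm : Measurable F) (hF : F' =ᵐ[volume] F)
    (hfin : ∫⁻ z, ‖F z‖ₑ * eLossRate g z.2 ≠ ⊤) :
    ∫⁻ z, ‖gainTerm g₀ F' z‖ₑ ≤ ∫⁻ z, ‖F z‖ₑ * eLossRate g z.2 := by
  rw [← lintegral_eGain hb.measurable hm.enorm]
  refine lintegral_mono_ae ?_
  filter_upwards [hb.gainTerm_ae_eq hm hF hfin] with z hz
  rw [hz, ← hb.lintegral_enorm_gainVersion]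
  exact enorm_integral_le_lintegral_enorm _

lemma integrable_gainTerm (hm : Measurable F) (hF : F' =ᵐ[volume] F)
    (hfin : ∫⁻ z, ‖F z‖ₑ * eLossRate g z.2 ≠ ⊤) : Integrable (gainTerm g₀ F') := by
  refine ⟨?_, (hb.lintegral_enorm_gainTerm_le hm hF hfin).trans_lt hfin.lt_top⟩
  exact (StronglyMeasurable.integral_prod_right
    (measurable_gainVersion hb.measurable hm).stronglyMeasurable).aestronglyMeasurable.congr
    (hb.gainTerm_ae_eq hm hF hfin).symm

lemma exists_isB {F : L1} {k : Phase → ℝ≥0∞} (hk : Measurable k)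
    (hkF : F =ᵐ[volume] fun z => (k z).toReal) (hfin : ∫⁻ z, k z * eLossRate g z.2 ≠ ⊤) :
    ∃ b : L1, IsB g₀ F b ∧ b =ᵐ[volume] fun z => (eGain g k z).toReal := by
  have hfin' : ∫⁻ z, ‖(k z).toReal‖ₑ * eLossRate g z.2 ≠ ⊤ := by
    refine ne_top_of_le_ne_top hfin (lintegral_mono fun z => ?_)
    gcongr
    rw [Real.enorm_of_nonneg ENNReal.toReal_nonneg]
    exact ENNReal.ofReal_toReal_le
  have hi := hb.integrable_gainTerm hk.ennreal_toReal hkF hfin'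
  refine ⟨hi.toL1 _, ⟨hb.ae_integrable_gainIntegrand hk.ennreal_toReal hkF hfin',
    hi.coeFn_toL1⟩, hi.coeFn_toL1.trans ?_⟩
  have hgm := hb.measurable
  rw [← lintegral_eGain hgm hk] at hfin
  filter_upwards [hb.gainTerm_ae_eq hk.ennreal_toReal hkF hfin',
    ae_lt_top (measurable_eGain_apply hgm hk) hfin] with z hz hlt
  have hm : Measurable fun p : Sph × Vel => k (z.1, scatter z.2 p.1 p.2) *
      g (rebound z.2 p.1 p.2) * ENNReal.ofReal (crossSection z.2 p.2 p.1) := by fun_prop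
  rw [hz, eGain, ← integral_toReal hm.aemeasurable (ae_lt_top hm hlt.ne)]
  refine integral_congr_ae (Filter.Eventually.of_forall fun p => ?_)
  simp only [gainVersion, ENNReal.toReal_mul, ENNReal.toReal_ofReal (crossSection_nonneg _ _ _)]

lemma enorm_le_of_isB {F b : L1} (h : IsB g₀ F b) (hfin : ∫⁻ z, ‖F z‖ₑ * eLossRate g z.2 ≠ ⊤) :
    ‖b‖ₑ ≤ ∫⁻ z, ‖F z‖ₑ * eLossRate g z.2 := by
  rw [enorm_eq_lintegral_of_ae_eq h.2]
  exact hb.lintegral_enorm_gainTerm_le (Lp.stronglyMeasurable F).measurable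
    Filter.EventuallyEq.rfl hfin

end IsBackground

end GainOnL1

/-! ### Test functions -/

lemma isOpenQuotientMap_toTorus : IsOpenQuotientMap toTorus := by
  have hcoord : IsOpenQuotientMap (Pi.map fun (_ : Fin 3) (y : ℝ) => (y : UnitAddCircle)) :=
    IsOpenQuotientMap.piMap fun _ => QuotientAddGroup.isOpenQuotientMap_mk
  exact hcoord.comp (PiLp.homeomorph 2 (fun _ : Fin 3 => ℝ)).isOpenQuotientMap

lemma isOpenQuotientMap_phase :
    IsOpenQuotientMap (fun p : Vel × Vel => ((toTorus p.1, p.2) : Phase)) :=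
  isOpenQuotientMap_toTorus.prodMap IsOpenQuotientMap.id

lemma freeFlow_toTorus (s : ℝ) (y v : Vel) :
    freeFlow s (toTorus y, v) = (toTorus (y + s • v), v) := by
  simp [freeFlow, toTorus_add]

/-- The generator of `damped L`, formally adjoint to `f ↦ -v · ∂ₓ f - L f`. -/
def dampedGenerator (L : Vel → ℝ) (φ : Phase → ℝ) (z : Phase) : ℝ :=
  transport φ z - L z.2 * φ z

/-- The expectation of `ψ` along the free flow with killing at rate `L`, after time `t`. -/
def damped (L : Vel → ℝ) (ψ : Phase → ℝ) (t : ℝ) (z : Phase) : ℝ :=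
  Real.exp (-(t * L z.2)) * ψ (freeFlow t z)

lemma measurable_damped {α : Type*} [MeasurableSpace α] {L : Vel → ℝ} {ψ : Phase → ℝ} {t : α → ℝ}
    {z : α → Phase} (hL : Measurable L) (hψ : Measurable ψ) (ht : Measurable t)
    (hz : Measurable z) : Measurable fun a => damped L ψ (t a) (z a) := by
  unfold damped
  fun_prop

lemma norm_damped_le {L : Vel → ℝ} (hL : ∀ v, 0 ≤ L v) {ψ : Phase → ℝ} {M : ℝ}
    (hψ : ∀ z, ‖ψ z‖ ≤ M) {t : ℝ} (ht : 0 ≤ t) (z : Phase) : ‖damped L ψ t z‖ ≤ M := by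
  rw [damped, norm_mul, Real.norm_of_nonneg (Real.exp_nonneg _)]
  refine (mul_le_of_le_one_left (norm_nonneg _) ?_).trans (hψ _)
  rw [Real.exp_le_one_iff, neg_nonpos]
  exact mul_nonneg ht (hL _)

namespace IsTestFunction

variable {φ : Phase → ℝ}

lemma continuous (hφ : IsTestFunction φ) : Continuous φ :=
  isOpenQuotientMap_phase.isQuotientMap.continuous_iff.2 hφ.1.continuous

lemma hasDerivAt_lift (hφ : IsTestFunction φ) (y v : Vel) (s : ℝ) :
    HasDerivAt (fun s => φ (freeFlow s (toTorus y, v)))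
      (fderiv ℝ (fun p : Vel × Vel => φ (toTorus p.1, p.2)) (y + s • v, v) (v, 0)) s := by
  have hline : HasDerivAt (fun s : ℝ => ((y + s • v, v) : Vel × Vel)) (v, 0) s := by
    have : HasDerivAt (fun s : ℝ => y + s • v) v s := by
      simpa using ((hasDerivAt_id s).smul_const v).const_add y
    exact this.prodMk (hasDerivAt_const s v)
  simp_rw [freeFlow_toTorus]
  exact (hφ.1.differentiable (by simp) (y + s • v, v)).hasFDerivAt.comp_hasDerivAt s hline

lemma transport_toTorus (hφ : IsTestFunction φ) (y v : Vel) : transport φ (toTorus y, v)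
    = fderiv ℝ (fun p : Vel × Vel => φ (toTorus p.1, p.2)) (y, v) (v, 0) := by
  rw [transport]
  simpa using (hφ.hasDerivAt_lift y v 0).deriv

lemma hasDerivAt (hφ : IsTestFunction φ) (z : Phase) (s : ℝ) :
    HasDerivAt (fun s => φ (freeFlow s z)) (transport φ (freeFlow s z)) s := by
  obtain ⟨⟨y, v⟩, rfl⟩ := isOpenQuotientMap_phase.surjective z
  simpa only [freeFlow_toTorus, hφ.transport_toTorus] using hφ.hasDerivAt_lift y v s

lemma continuous_transport (hφ : IsTestFunction φ) : Continuous (transport φ) := by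
  refine isOpenQuotientMap_phase.isQuotientMap.continuous_iff.2 ?_
  have hfderiv : Continuous (fderiv ℝ (fun p : Vel × Vel => φ (toTorus p.1, p.2))) :=
    hφ.1.continuous_fderiv (by simp)
  exact (hfderiv.clm_apply (g := fun p : Vel × Vel => (p.2, 0)) (by fun_prop)).congr
    fun p => (hφ.transport_toTorus p.1 p.2).symm

lemma measurable_dampedGenerator (hφ : IsTestFunction φ) {L : Vel → ℝ} (hL : Measurable L) :
    Measurable (dampedGenerator L φ) := by
  have := hφ.continuous.measurable
  have := hφ.continuous_transport.measurable
  unfold dampedGenerator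
  fun_prop

lemma hasCompactSupport_transport (hφ : IsTestFunction φ) : HasCompactSupport (transport φ) := by
  refine hφ.2.mono' fun z hz => ?_
  by_contra hzs
  have hφz : φ =ᶠ[nhds z] 0 := notMem_tsupport_iff_eventuallyEq.1 hzs
  have hflow : Filter.Tendsto (fun s : ℝ => freeFlow s z) (nhds 0) (nhds z) := by
    have : Continuous fun s : ℝ => freeFlow s z :=
      continuous_freeFlow.comp (by fun_prop : Continuous fun s : ℝ => (s, z))
    simpa using this.tendsto 0
  have hφflow : (fun s : ℝ => φ (freeFlow s z)) =ᶠ[nhds 0] fun _ => 0 := hflow.eventually hφz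
  exact hz (by rw [transport, hφflow.deriv_eq, deriv_const])

lemma exists_norm_dampedGenerator_le (hφ : IsTestFunction φ) {L : Vel → ℝ} {C : ℝ}
    (hL0 : ∀ v, 0 ≤ L v) (hL : ∀ v, L v ≤ C * (1 + ‖v‖)) :
    ∃ M, ∀ z, ‖dampedGenerator L φ z‖ ≤ M := by
  obtain ⟨M₁, hM₁⟩ := hφ.hasCompactSupport_transport.exists_bound_of_continuous
    hφ.continuous_transport
  have hc : Continuous fun z : Phase => (C * (1 + ‖z.2‖)) * φ z := by
    have := hφ.continuous
    fun_prop
  obtain ⟨M₂, hM₂⟩ :=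
    (hφ.2.mul_left (f := fun z : Phase => C * (1 + ‖z.2‖))).exists_bound_of_continuous hc
  refine ⟨M₁ + M₂, fun z => (norm_sub_le _ _).trans
    (add_le_add (hM₁ z) (le_trans ?_ (hM₂ z)))⟩
  rw [Pi.mul_apply, norm_mul, norm_mul, Real.norm_of_nonneg (hL0 _)]
  gcongr
  exact (hL z.2).trans (le_abs_self _)

lemma hasDerivAt_damped (hφ : IsTestFunction φ) (L : Vel → ℝ) (z : Phase) (t : ℝ) :
    HasDerivAt (fun t => damped L φ t z) (damped L (dampedGenerator L φ) t z) t := by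
  have hexp : HasDerivAt (fun t : ℝ => -(t * L z.2)) (-(1 * L z.2)) t :=
    ((hasDerivAt_id t).mul_const _).neg
  refine (hexp.exp.mul (hφ.hasDerivAt z t)).congr_deriv ?_
  rw [damped, dampedGenerator, freeFlow_snd]
  ring

lemma integral_damped_dampedGenerator (hφ : IsTestFunction φ) (L : Vel → ℝ) (z : Phase) {r t : ℝ}
    (hrt : r ≤ t) : ∫ s in Ioc r t, damped L (dampedGenerator L φ) (s - r) z
      = damped L φ (t - r) z - φ z := by
  have hcont : Continuous fun s => damped L (dampedGenerator L φ) (s - r) z := by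
    have hflow : Continuous fun s : ℝ => freeFlow (s - r) z :=
      continuous_freeFlow.comp (by fun_prop : Continuous fun s : ℝ => (s - r, z))
    have := hφ.continuous
    have := hφ.continuous_transport
    simp only [damped, dampedGenerator, freeFlow_snd]
    fun_prop
  rw [← intervalIntegral.integral_of_le hrt, intervalIntegral.integral_eq_sub_of_hasDerivAt
    (fun s _ => (hφ.hasDerivAt_damped L z (s - r)).comp_sub_const s r)
    (hcont.intervalIntegrable _ _)]
  simp [damped]

end IsTestFunction

/-! ### Existence of a mild solution -/

/-- `f` is a measurable version with values in `[0, ⊤]` of the initial datum `f₀`, with finite first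
moment. -/
structure IsInitial (f₀ : Phase → ℝ) (f : Phase → ℝ≥0∞) : Prop where
  measurable : Measurable f
  ae_eq : f₀ =ᵐ[volume] fun z => (f z).toReal
  moment_ne_top : ∫⁻ z, velWeight z * f z ≠ ⊤

lemma exists_isInitial {f₀ : Phase → ℝ} (hf : AEMeasurable f₀) (hf0 : 0 ≤ᵐ[volume] f₀)
    (hm : Integrable fun z : Phase => f₀ z * (1 + ‖z.2‖)) : ∃ f, IsInitial f₀ f := by
  obtain ⟨f, hfm, hft, hae⟩ := exists_measurable_toReal_ae_eq hf hf0
  refine ⟨f, hfm, hae, ?_⟩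
  simpa only [velWeight, mul_comm] using lintegral_mul_ofReal_ne_top_of_integrable hft hae hm

lemma IsInitial.lintegral_ne_top {f₀ : Phase → ℝ} {f : Phase → ℝ≥0∞} (hf : IsInitial f₀ f) :
    ∫⁻ z, f z ≠ ⊤ := by
  refine ne_top_of_le_ne_top hf.moment_ne_top (lintegral_mono fun z => ?_)
  refine le_mul_of_one_le_left' ?_
  rw [velWeight, ENNReal.one_le_ofReal]
  exact le_add_of_nonneg_right (norm_nonneg _)

/-- The solution with values in `ℝ`, extended to negative times by the value at time zero: all of
its time slices are integrable. -/
def realSolution (g₀ : Vel → ℝ) (g : Vel → ℝ≥0∞) (f : Phase → ℝ≥0∞) (t : ℝ) (z : Phase) : ℝ :=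
  (eSolution g₀ g f (max t 0) z).toReal

/-- The integral over `[0, t]` of the solution. -/
def eTimeIntegral (g₀ : Vel → ℝ) (g : Vel → ℝ≥0∞) (f : Phase → ℝ≥0∞) (t : ℝ) (z : Phase) : ℝ≥0∞ :=
  ∫⁻ s in Ioc 0 t, eSolution g₀ g f s z

/-- The space-time measure of the particles which enter the free flow: those present at time zero
and those produced by the collisions. -/
def emission (g₀ : Vel → ℝ) (g : Vel → ℝ≥0∞) (f : Phase → ℝ≥0∞) : Measure (ℝ × Phase) :=
  initMeasure f + sourceMeasure fun s => eGain g (eSolution g₀ g f s)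

lemma ae_emission_fst_nonneg (g₀ : Vel → ℝ) (g : Vel → ℝ≥0∞) (f : Phase → ℝ≥0∞) :
    ∀ᵐ p ∂emission g₀ g f, 0 ≤ p.1 := by
  rw [emission, ae_add_measure_iff]
  exact ⟨ae_initMeasure_fst_nonneg _, ae_sourceMeasure_fst_nonneg _⟩

lemma integral_eq_of_lintegral_eq {X Y : Type*} [MeasurableSpace X] [MeasurableSpace Y]
    {μ : Measure X} {ν : Measure Y} {w : X → ℝ≥0∞} {e : Y → ℝ≥0∞} {θ : Y → X} (hw : Measurable w)
    (he : Measurable e) (hθ : Measurable θ) (hwt : ∀ᵐ x ∂μ, w x < ⊤) (het : ∀ᵐ y ∂ν, e y < ⊤)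
    (h : ∀ ψ : X → ℝ≥0∞, Measurable ψ → ∫⁻ x, ψ x * w x ∂μ = ∫⁻ y, e y * ψ (θ y) ∂ν)
    {φ : X → ℝ} (hφ : Measurable φ) :
    ∫ x, (w x).toReal * φ x ∂μ = ∫ y, (e y).toReal * φ (θ y) ∂ν := by
  have hmap : μ.withDensity w = (ν.withDensity e).map θ := by
    refine Measure.ext_of_lintegral _ fun ψ hψ => ?_
    rw [lintegral_map hψ hθ, lintegral_withDensity_eq_lintegral_mul _ hw hψ,
      lintegral_withDensity_eq_lintegral_mul _ he (g := fun y => ψ (θ y)) (hψ.comp hθ)]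
    simpa [mul_comm] using h ψ hψ
  calc ∫ x, (w x).toReal * φ x ∂μ = ∫ x, φ x ∂(μ.withDensity w) :=
        (integral_withDensity_eq_integral_toReal_smul hw hwt φ).symm
    _ = ∫ y, φ (θ y) ∂(ν.withDensity e) := by
        rw [hmap, integral_map hθ.aemeasurable hφ.aestronglyMeasurable]
    _ = ∫ y, (e y).toReal * φ (θ y) ∂ν :=
        integral_withDensity_eq_integral_toReal_smul he het fun y => φ (θ y)

lemma integral_Ioc_integral_fst_le {α : Type*} [MeasurableSpace α] {ρ : Measure (ℝ × α)} {t : ℝ}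
    [IsFiniteMeasure (ρ.restrict {p | p.1 ≤ t})] (hρ : ∀ᵐ p ∂ρ, 0 ≤ p.1)
    {F : ℝ → ℝ × α → ℝ} (hF : Measurable (Function.uncurry F)) {M : ℝ}
    (hM : ∀ s p, p.1 ≤ s → ‖F s p‖ ≤ M) :
    ∫ s in Ioc 0 t, (∫ p in {p | p.1 ≤ s}, F s p ∂ρ)
      = ∫ p in {p | p.1 ≤ t}, (∫ s in Ioc p.1 t, F s p) ∂ρ := by
  set K : ℝ → ℝ × α → ℝ := fun s p => {p : ℝ × α | p.1 ≤ s}.indicator (F s) p with hK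
  have hKm : Measurable (Function.uncurry K) := by
    have : MeasurableSet {q : ℝ × ℝ × α | q.2.1 ≤ q.1} :=
      measurableSet_le (by fun_prop) (by fun_prop)
    exact hF.indicator this
  have hKM : ∀ s p, ‖K s p‖ ≤ max M 0 := fun s p => by
    by_cases h : p.1 ≤ s
    · simpa [hK, h] using Or.inl (hM s p h)
    · simp [hK, h]
  calc ∫ s in Ioc 0 t, (∫ p in {p | p.1 ≤ s}, F s p ∂ρ)
      = ∫ s in Ioc 0 t, (∫ p in {p | p.1 ≤ t}, K s p ∂ρ) := by
        refine setIntegral_congr_fun measurableSet_Ioc fun s hs => ?_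
        have hst : {p : ℝ × α | p.1 ≤ s} ⊆ {p | p.1 ≤ t} := fun p hp => le_trans hp hs.2
        rw [setIntegral_indicator (measurableSet_fst_le s), inter_eq_right.2 hst]
    _ = ∫ p in {p | p.1 ≤ t}, (∫ s in Ioc 0 t, K s p) ∂ρ :=
        integral_integral_swap (Integrable.of_bound hKm.aestronglyMeasurable _
          (Filter.Eventually.of_forall fun q => hKM q.1 q.2))
    _ = ∫ p in {p | p.1 ≤ t}, (∫ s in Ioc p.1 t, F s p) ∂ρ := by
        refine integral_congr_ae ?_
        filter_upwards [ae_restrict_of_ae hρ] with p hp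
        rw [← integral_indicator measurableSet_Ioc, ← integral_indicator measurableSet_Ioc]
        refine integral_congr_ae ?_
        filter_upwards [Measure.ae_ne volume p.1] with s hs
        rcases lt_or_gt_of_ne hs with h | h
        · simp [indicator, hK, h.not_ge, h.not_gt]
        · simp [indicator, hK, h, h.le, hp.trans_lt h]

namespace IsBackground

section Existence

variable {f₀ : Phase → ℝ} {g₀ : Vel → ℝ} {g : Vel → ℝ≥0∞} {f : Phase → ℝ≥0∞}
variable (hb : IsBackground g₀ g) (hf : IsInitial f₀ f) {t : ℝ}
include hb hf

lemma lintegral_eSolution_lt_top (ht : 0 ≤ t) : ∫⁻ z, eSolution g₀ g f t z < ⊤ :=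
  (hb.lintegral_eSolution_le hf.measurable ht).trans_lt hf.lintegral_ne_top.lt_top

lemma lintegral_lintegral_eSolution_lt_top (t : ℝ) :
    ∫⁻ s in Ioc 0 t, ∫⁻ z, eSolution g₀ g f s z < ⊤ := by
  calc ∫⁻ s in Ioc 0 t, ∫⁻ z, eSolution g₀ g f s z ≤ ∫⁻ _ in Ioc 0 t, ∫⁻ z, f z :=
        setLIntegral_mono measurable_const fun s hs =>
          hb.lintegral_eSolution_le hf.measurable hs.1.le
    _ < ⊤ := by
        rw [setLIntegral_const]
        exact ENNReal.mul_lt_top hf.lintegral_ne_top.lt_top (by simp)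

lemma lintegral_lintegral_velWeight_mul_eSolution_lt_top (t : ℝ) :
    ∫⁻ s in Ioc 0 t, ∫⁻ z, velWeight z * eSolution g₀ g f s z < ⊤ := by
  calc ∫⁻ s in Ioc 0 t, ∫⁻ z, velWeight z * eSolution g₀ g f s z
      ≤ ∫⁻ _ in Ioc 0 t, ((∫⁻ z, velWeight z * f z)
          + weightRate g * (ENNReal.ofReal t * ∫⁻ z, f z)) := by
        refine setLIntegral_mono measurable_const fun s hs => ?_
        grw [hb.lintegral_velWeight_mul_eSolution_le hf.measurable hs.1.le, hs.2]
    _ < ⊤ := by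
        rw [setLIntegral_const]
        exact ENNReal.mul_lt_top (ENNReal.add_lt_top.2 ⟨hf.moment_ne_top.lt_top,
          ENNReal.mul_lt_top hb.weightRate_ne_top.lt_top (ENNReal.mul_lt_top
            ENNReal.ofReal_lt_top hf.lintegral_ne_top.lt_top)⟩) (by simp)

lemma lintegral_lintegral_eSolution_mul_eLossRate_lt_top (t : ℝ) :
    ∫⁻ s in Ioc 0 t, ∫⁻ z, eSolution g₀ g f s z * eLossRate g z.2 < ⊤ := by
  obtain ⟨C, hC⟩ := hb.exists_lossRate_le
  have hle : ∀ z : Phase, eLossRate g z.2 ≤ ENNReal.ofReal C * velWeight z := fun z => by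
    rw [← hb.ofReal_lossRate, velWeight, ← ENNReal.ofReal_mul' (by positivity)]
    exact ENNReal.ofReal_le_ofReal (hC _)
  calc ∫⁻ s in Ioc 0 t, ∫⁻ z, eSolution g₀ g f s z * eLossRate g z.2
      ≤ ∫⁻ s in Ioc 0 t, ∫⁻ z, ENNReal.ofReal C * (velWeight z * eSolution g₀ g f s z) := by
        refine lintegral_mono fun s => lintegral_mono fun z => ?_
        dsimp only
        grw [mul_comm, ← mul_assoc, hle z]
    _ = ENNReal.ofReal C * ∫⁻ s in Ioc 0 t, ∫⁻ z, velWeight z * eSolution g₀ g f s z := by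
        simp_rw [lintegral_const_mul' _ _ ENNReal.ofReal_ne_top]
    _ < ⊤ := ENNReal.mul_lt_top ENNReal.ofReal_lt_top
        (hb.lintegral_lintegral_velWeight_mul_eSolution_lt_top hf t)

lemma lintegral_lintegral_eGain_eSolution_lt_top (t : ℝ) :
    ∫⁻ s in Ioc 0 t, ∫⁻ z, eGain g (eSolution g₀ g f s) z < ⊤ := by
  simp_rw [lintegral_eGain hb.measurable (hb.measurable_eSolution_apply hf.measurable _)]
  exact hb.lintegral_lintegral_eSolution_mul_eLossRate_lt_top hf t

lemma measurable_realSolution : Measurable (Function.uncurry (realSolution g₀ g f)) :=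
  ((hb.measurable_eSolution hf.measurable).comp
    (f := fun q : ℝ × Phase => (max q.1 0, q.2)) (by fun_prop)).ennreal_toReal

lemma integrable_realSolution (t : ℝ) : Integrable (realSolution g₀ g f t) :=
  integrable_toReal_of_lintegral_ne_top
    (hb.measurable_eSolution_apply hf.measurable _).aemeasurable
    (hb.lintegral_eSolution_lt_top hf (le_max_right t 0)).ne

lemma integrable_realSolution_prod (t : ℝ) :
    Integrable (Function.uncurry (realSolution g₀ g f))
      ((volume.restrict (Ioc 0 t)).prod volume) := by
  have hm := hb.measurable_realSolution hf
  refine ⟨hm.aestronglyMeasurable, ?_⟩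
  rw [HasFiniteIntegral, lintegral_prod _ (by fun_prop)]
  refine lt_of_le_of_lt (setLIntegral_mono' measurableSet_Ioc fun s hs => ?_)
    (hb.lintegral_lintegral_eSolution_lt_top hf t)
  refine lintegral_mono fun z => ?_
  rw [Function.uncurry_apply_pair, realSolution, Real.enorm_of_nonneg ENNReal.toReal_nonneg,
    max_eq_left hs.1.le]
  exact ENNReal.ofReal_toReal_le

/-- The solution of the linear Boltzmann equation in `L¹`. -/
def solution (t : ℝ) : L1 := (hb.integrable_realSolution hf t).toL1 _

lemma coeFn_solution (ht : 0 ≤ t) :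
    hb.solution hf t =ᵐ[volume] fun z => (eSolution g₀ g f t z).toReal := by
  refine (Integrable.coeFn_toL1 _).trans (Filter.Eventually.of_forall fun z => ?_)
  rw [realSolution, max_eq_left ht]

lemma intervalIntegrable_solution (ht : 0 ≤ t) :
    IntervalIntegrable (hb.solution hf) volume 0 t := by
  rw [intervalIntegrable_iff_integrableOn_Ioc_of_le ht]
  exact integrable_toL1 (hb.measurable_realSolution hf) (hb.integrable_realSolution hf)
    (hb.integrable_realSolution_prod hf t)

lemma coeFn_integral_solution (ht : 0 ≤ t) :
    ⇑(∫ θ in (0 : ℝ)..t, hb.solution hf θ)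
      =ᵐ[volume] fun z => ∫ s in Ioc 0 t, realSolution g₀ g f s z := by
  rw [intervalIntegral.integral_of_le ht]
  exact coeFn_integral_toL1 (hb.measurable_realSolution hf) (hb.integrable_realSolution hf)
    (hb.integrable_realSolution_prod hf t)

lemma measurable_eSolution_time (z : Phase) : Measurable fun s => eSolution g₀ g f s z :=
  (hb.measurable_eSolution hf.measurable).comp (f := fun s : ℝ => (s, z)) (by fun_prop)

lemma measurable_eTimeIntegral (t : ℝ) : Measurable (eTimeIntegral g₀ g f t) :=
  ((hb.measurable_eSolution hf.measurable).comp measurable_swap).lintegral_prod_right'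
    (ν := volume.restrict (Ioc 0 t))

lemma coeFn_integral_solution_eq_eTimeIntegral (ht : 0 ≤ t) :
    ⇑(∫ θ in (0 : ℝ)..t, hb.solution hf θ)
      =ᵐ[volume] fun z => (eTimeIntegral g₀ g f t z).toReal := by
  have hlt : ∀ᵐ z, eTimeIntegral g₀ g f t z < ⊤ := by
    refine ae_lt_top (hb.measurable_eTimeIntegral hf t) ?_
    have := (hb.lintegral_lintegral_eSolution_lt_top hf t).ne
    rwa [lintegral_lintegral_swap (hb.measurable_eSolution hf.measurable).aemeasurable] at this
  filter_upwards [hb.coeFn_integral_solution hf ht, hlt] with z hz hzlt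
  have hmz := hb.measurable_eSolution_time hf z
  rw [hz, eTimeIntegral, ← integral_toReal hmz.aemeasurable (ae_lt_top hmz hzlt.ne)]
  exact setIntegral_congr_fun measurableSet_Ioc fun s hs => by
    simp only [realSolution, max_eq_left hs.1.le]

lemma lintegral_eTimeIntegral_mul_eLossRate_lt_top (t : ℝ) :
    ∫⁻ z, eTimeIntegral g₀ g f t z * eLossRate g z.2 < ⊤ := by
  have hm : Measurable fun q : ℝ × Phase => eSolution g₀ g f q.1 q.2 * eLossRate g q.2.2 :=
    (hb.measurable_eSolution hf.measurable).mul
      ((measurable_eLossRate hb.measurable).comp measurable_snd.snd)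
  have hlt := hb.lintegral_lintegral_eSolution_mul_eLossRate_lt_top hf t
  rw [lintegral_lintegral_swap hm.aemeasurable] at hlt
  simpa only [eTimeIntegral, lintegral_mul_const _ (hb.measurable_eSolution_time hf _)] using hlt

lemma eGain_eTimeIntegral (t : ℝ) (z : Phase) :
    eGain g (eTimeIntegral g₀ g f t) z
      = ∫⁻ s in Ioc 0 t, eGain g (eSolution g₀ g f s) z := by
  have hg := hb.measurable
  have hF : Measurable fun q : ℝ × Sph × Vel =>
      eSolution g₀ g f q.1 (z.1, scatter z.2 q.2.1 q.2.2) :=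
    (hb.measurable_eSolution hf.measurable).comp
      (f := fun q : ℝ × Sph × Vel => (q.1, (z.1, scatter z.2 q.2.1 q.2.2))) (by fun_prop)
  simp only [eGain, eTimeIntegral]
  rw [lintegral_lintegral_swap (by fun_prop)]
  refine lintegral_congr fun p => ?_
  have hFp := hb.measurable_eSolution_time hf (z.1, scatter z.2 p.1 p.2)
  rw [← lintegral_mul_const _ hFp, ← lintegral_mul_const _ (by fun_prop)]

lemma measurable_eGain_eSolution :
    Measurable (Function.uncurry fun s => eGain g (eSolution g₀ g f s)) :=
  measurable_eGain hb.measurable (hb.measurable_eSolution hf.measurable)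

lemma lintegral_emission {F : ℝ × Phase → ℝ≥0∞} (hF : Measurable F) (ht : 0 ≤ t) :
    ∫⁻ p in {p | p.1 ≤ t}, F p ∂emission g₀ g f = (∫⁻ z, f z * F (0, z))
      + ∫⁻ s in Ioc 0 t, ∫⁻ z, eGain g (eSolution g₀ g f s) z * F (s, z) := by
  rw [emission, Measure.restrict_add, lintegral_add_measure,
    lintegral_initMeasure hf.measurable hF ht,
    lintegral_sourceMeasure (hb.measurable_eGain_eSolution hf) hF]

lemma isFiniteMeasure_emission_restrict (ht : 0 ≤ t) :
    IsFiniteMeasure ((emission g₀ g f).restrict {p | p.1 ≤ t}) := by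
  refine ⟨?_⟩
  rw [← lintegral_one, hb.lintegral_emission hf measurable_const ht]
  simpa using ⟨hf.lintegral_ne_top.lt_top, hb.lintegral_lintegral_eGain_eSolution_lt_top hf t⟩

lemma lintegral_emission_snd {ψ : Phase → ℝ≥0∞} (hψ : Measurable ψ) (ht : 0 ≤ t) :
    ∫⁻ p in {p | p.1 ≤ t}, ψ p.2 ∂emission g₀ g f
      = ∫⁻ z, ψ z * (f z + eGain g (eTimeIntegral g₀ g f t) z) := by
  have hfm := hf.measurable
  have hqm := hb.measurable_eGain_eSolution hf
  have hqz : ∀ z, Measurable fun s => eGain g (eSolution g₀ g f s) z := fun z =>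
    hqm.comp (f := fun s : ℝ => (s, z)) (by fun_prop)
  have hswap : AEMeasurable (Function.uncurry fun s z =>
      eGain g (eSolution g₀ g f s) z * ψ z) ((volume.restrict (Ioc 0 t)).prod volume) :=
    (hqm.mul (hψ.comp measurable_snd)).aemeasurable
  rw [hb.lintegral_emission hf (by fun_prop) ht, lintegral_lintegral_swap hswap]
  simp_rw [mul_add, hb.eGain_eTimeIntegral hf, lintegral_mul_const _ (hqz _)]
  rw [lintegral_add_left (by fun_prop)]
  simp_rw [mul_comm (ψ _)]

lemma integral_emission_snd {φ : Phase → ℝ} (hφ : Measurable φ) {M : ℝ} (hM : ∀ z, ‖φ z‖ ≤ M)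
    (ht : 0 ≤ t) {F b : L1} (hF : F =ᵐ[volume] f₀)
    (hbt : b =ᵐ[volume] fun z => (eGain g (eTimeIntegral g₀ g f t) z).toReal) :
    ∫ p in {p | p.1 ≤ t}, φ p.2 ∂emission g₀ g f = (∫ z, F z * φ z) + ∫ z, b z * φ z := by
  have hgm := measurable_eGain_apply hb.measurable (hb.measurable_eTimeIntegral hf t)
  have hglt : ∀ᵐ z, eGain g (eTimeIntegral g₀ g f t) z < ⊤ := by
    refine ae_lt_top hgm ?_
    rw [lintegral_eGain hb.measurable (hb.measurable_eTimeIntegral hf t)]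
    exact (hb.lintegral_eTimeIntegral_mul_eLossRate_lt_top hf t).ne
  have hflt := ae_lt_top hf.measurable hf.lintegral_ne_top
  have hlin := integral_eq_of_lintegral_eq (μ := volume)
    (ν := (emission g₀ g f).restrict {p | p.1 ≤ t})
    (w := fun z => f z + eGain g (eTimeIntegral g₀ g f t) z) (e := 1) (θ := Prod.snd)
    (hf.measurable.add hgm) measurable_const measurable_snd
    (by filter_upwards [hflt, hglt] with z h1 h2 using ENNReal.add_lt_top.2 ⟨h1, h2⟩)
    (by simp) (fun ψ hψ => by simpa using (hb.lintegral_emission_snd hf hψ ht).symm) hφ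
  simp only [Pi.one_apply, ENNReal.toReal_one, one_mul] at hlin
  rw [← hlin,
    ← integral_add (integrable_coeFn_mul F hφ hM) (integrable_coeFn_mul b hφ hM)]
  refine integral_congr_ae ?_
  filter_upwards [hflt, hglt, hF, hf.ae_eq, hbt] with z hzf hzg hzF hz₀ hzb
  rw [hzF, hz₀, hzb, ENNReal.toReal_add hzf.ne hzg.ne, add_mul]

lemma integral_eSolution_mul {ψ : Phase → ℝ} (hψ : Measurable ψ) (ht : 0 ≤ t) :
    ∫ z, (eSolution g₀ g f t z).toReal * ψ z
      = ∫ p in {p | p.1 ≤ t}, damped (lossRate g₀) ψ (t - p.1) p.2 ∂emission g₀ g f := by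
  have hm := hb.measurable_eSolution_apply hf.measurable t
  have hL := hb.measurable_lossRate
  have hlin := integral_eq_of_lintegral_eq (μ := volume)
    (e := fun p : ℝ × Phase => survival (lossRate g₀) (t - p.1) p.2.2)
    (θ := fun p : ℝ × Phase => freeFlow (t - p.1) p.2) hm (by fun_prop) (by fun_prop)
    (ae_lt_top hm (hb.lintegral_eSolution_lt_top hf ht).ne)
    (Filter.Eventually.of_forall fun p => ENNReal.ofReal_lt_top)
    (hb.evolves_eSolution hf.measurable t ht) hψ
  simpa only [damped, emission, survival, ENNReal.toReal_ofReal (Real.exp_nonneg _)] using hlin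

lemma integral_integral_solution_mul_dampedGenerator (ht : 0 ≤ t) {φ : Phase → ℝ}
    (hφ : IsTestFunction φ) :
    ∫ z, (∫ θ in (0 : ℝ)..t, hb.solution hf θ : L1) z * dampedGenerator (lossRate g₀) φ z
      = ∫ p in {p | p.1 ≤ t}, (damped (lossRate g₀) φ (t - p.1) p.2 - φ p.2)
          ∂emission g₀ g f := by
  obtain ⟨C, hC⟩ := hb.exists_lossRate_le
  obtain ⟨M, hM⟩ := hφ.exists_norm_dampedGenerator_le hb.lossRate_nonneg hC
  have hηm := hφ.measurable_dampedGenerator hb.measurable_lossRate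
  set η := dampedGenerator (lossRate g₀) φ
  have hsol : Integrable (Function.uncurry fun s z => realSolution g₀ g f s z * η z)
      ((volume.restrict (Ioc 0 t)).prod volume) :=
    (hb.integrable_realSolution_prod hf t).mul_bdd (hηm.comp measurable_snd).aestronglyMeasurable
      (Filter.Eventually.of_forall fun p => hM p.2)
  have := hb.isFiniteMeasure_emission_restrict hf ht
  calc ∫ z, (∫ θ in (0 : ℝ)..t, hb.solution hf θ : L1) z * η z
      = ∫ z, ∫ s in Ioc 0 t, realSolution g₀ g f s z * η z := by
        refine integral_congr_ae ?_
        filter_upwards [hb.coeFn_integral_solution hf ht] with z hz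
        rw [hz, integral_mul_const]
    _ = ∫ s in Ioc 0 t, ∫ z, realSolution g₀ g f s z * η z := (integral_integral_swap hsol).symm
    _ = ∫ s in Ioc 0 t, ∫ p in {p | p.1 ≤ s}, damped (lossRate g₀) η (s - p.1) p.2
          ∂emission g₀ g f := by
        refine setIntegral_congr_fun measurableSet_Ioc fun s hs => ?_
        simp only [realSolution, max_eq_left hs.1.le]
        exact hb.integral_eSolution_mul hf hηm hs.1.le
    _ = ∫ p in {p | p.1 ≤ t}, (∫ s in Ioc p.1 t, damped (lossRate g₀) η (s - p.1) p.2)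
          ∂emission g₀ g f :=
        integral_Ioc_integral_fst_le (F := fun s p => damped (lossRate g₀) η (s - p.1) p.2)
          (ae_emission_fst_nonneg g₀ g f)
          (measurable_damped hb.measurable_lossRate hηm (by fun_prop) (by fun_prop))
          fun s p hps => norm_damped_le hb.lossRate_nonneg hM (sub_nonneg.2 hps) p.2
    _ = _ := setIntegral_congr_fun (measurableSet_fst_le t) fun p hp =>
        hφ.integral_damped_dampedGenerator (lossRate g₀) p.2 hp

lemma isA_solution (ht : 0 ≤ t) {F b : L1} (hF : F =ᵐ[volume] f₀)
    (hbt : b =ᵐ[volume] fun z => (eGain g (eTimeIntegral g₀ g f t) z).toReal) :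
    IsA g₀ (∫ θ in (0 : ℝ)..t, hb.solution hf θ) (hb.solution hf t - F - b) := by
  intro φ hφ
  obtain ⟨M, hM⟩ := hφ.2.exists_bound_of_continuous hφ.continuous
  have hφm : Measurable φ := hφ.continuous.measurable
  have := hb.isFiniteMeasure_emission_restrict hf ht
  have hdamped : Integrable (fun p : ℝ × Phase => damped (lossRate g₀) φ (t - p.1) p.2)
      ((emission g₀ g f).restrict {p | p.1 ≤ t}) := by
    refine Integrable.of_bound (measurable_damped hb.measurable_lossRate hφm
      (by fun_prop) (by fun_prop)).aestronglyMeasurable M ?_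
    filter_upwards [ae_restrict_mem (measurableSet_fst_le t)] with p hp
    exact norm_damped_le hb.lossRate_nonneg hM (sub_nonneg.2 hp) p.2
  have hsnd : Integrable (fun p : ℝ × Phase => φ p.2)
      ((emission g₀ g f).restrict {p | p.1 ≤ t}) :=
    Integrable.of_bound (hφm.comp measurable_snd).aestronglyMeasurable M
      (Filter.Eventually.of_forall fun p => hM p.2)
  calc ∫ z, (∫ θ in (0 : ℝ)..t, hb.solution hf θ : L1) z * dampedGenerator (lossRate g₀) φ z
      = (∫ z, (eSolution g₀ g f t z).toReal * φ z)
          - ((∫ z, F z * φ z) + ∫ z, b z * φ z) := by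
        rw [hb.integral_integral_solution_mul_dampedGenerator hf ht hφ,
          integral_sub hdamped hsnd, ← hb.integral_eSolution_mul hf hφm ht,
          hb.integral_emission_snd hf hφm hM ht hF hbt]
    _ = (∫ z, hb.solution hf t z * φ z) - ((∫ z, F z * φ z) + ∫ z, b z * φ z) := by
        congr 1
        exact integral_congr_ae ((hb.coeFn_solution hf ht).symm.mul (ae_eq_refl φ))
    _ = ∫ z, (hb.solution hf t - F - b : L1) z * φ z := by
        rw [integral_coeFn_sub_mul _ _ hφm hM, integral_coeFn_sub_mul _ _ hφm hM, sub_sub]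

lemma isMildSolution_solution {F : L1} (hF : F =ᵐ[volume] f₀) {T : ℝ} (hT : 0 ≤ T) :
    IsMildSolution (IsAPlusB g₀) T F (hb.solution hf) := by
  refine ⟨hb.intervalIntegrable_solution hf hT, fun t ht => ?_⟩
  obtain ⟨b, hB, hbt⟩ := hb.exists_isB (hb.measurable_eTimeIntegral hf t)
    (hb.coeFn_integral_solution_eq_eTimeIntegral hf ht.1)
    (hb.lintegral_eTimeIntegral_mul_eLossRate_lt_top hf t).ne
  exact ⟨_, b, hb.isA_solution hf ht.1 hF hbt, hB, (sub_add_cancel _ _).symm⟩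

end Existence

end IsBackground

/-! ### Fourier series on the torus -/

section Fourier

open UnitAddTorus

lemma ae_eq_zero_of_forall_integral_smul_eq_zero {X E : Type*} [TopologicalSpace X]
    [HasOuterApproxClosed X] [MeasurableSpace X] [BorelSpace X] {μ : Measure X}
    [NormedAddCommGroup E] [NormedSpace ℝ E] [CompleteSpace E] {u : X → E} (hu : Integrable u μ)
    (h : ∀ χ : BoundedContinuousFunction X ℝ, ∫ x, χ x • u x ∂μ = 0) : u =ᵐ[μ] 0 := by
  refine ae_eq_zero_of_forall_setIntegral_isClosed_eq_zero hu fun s hs => ?_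
  let χ (n : ℕ) : X → ℝ := fun x => hs.apprSeq n x
  have hχ (n : ℕ) : Continuous (χ n) := NNReal.continuous_coe.comp (hs.apprSeq n).continuous
  have hχ_le (n : ℕ) (x : X) : ‖χ n x‖ ≤ 1 := by
    simpa [χ] using HasOuterApproxClosed.apprSeq_apply_le_one hs n x
  have hlim (x : X) :
      Filter.Tendsto (fun n => χ n x • u x) Filter.atTop (nhds (s.indicator u x)) := by
    have hx := (NNReal.continuous_coe.tendsto _).comp
      (tendsto_pi_nhds.1 (HasOuterApproxClosed.tendsto_apprSeq hs) x)
    have hind : ((s.indicator (fun _ => 1) x : NNReal) : ℝ) • u x = s.indicator u x := by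
      by_cases hxs : x ∈ s <;> simp [hxs]
    exact hind ▸ hx.smul_const (u x)
  have hzero (n : ℕ) : ∫ x, χ n x • u x ∂μ = 0 :=
    h (BoundedContinuousFunction.ofNormedAddCommGroup (χ n) (hχ n) 1 (hχ_le n))
  have hconv := tendsto_integral_of_dominated_convergence (fun x => ‖u x‖)
    (fun n => (hχ n).aestronglyMeasurable.smul hu.aestronglyMeasurable) hu.norm
    (fun n => Filter.Eventually.of_forall fun x => by
      rw [Pi.smul_apply', norm_smul]
      exact mul_le_of_le_one_left (norm_nonneg _) (hχ_le n x))
    (Filter.Eventually.of_forall hlim)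
  rw [← integral_indicator hs.measurableSet]
  exact tendsto_nhds_unique hconv (tendsto_const_nhds.congr fun n => (hzero n).symm)

/-- Integration against `u`, as a continuous functional on the continuous functions. -/
def integralMulCLM {X : Type*} [TopologicalSpace X] [CompactSpace X] [MeasurableSpace X]
    [BorelSpace X] {μ : Measure X} {u : X → ℂ} (hu : Integrable u μ) : C(X, ℂ) →L[ℂ] ℂ :=
  have hint (χ : C(X, ℂ)) : Integrable (fun x => χ x * u x) μ :=
    hu.bdd_mul χ.continuous.aestronglyMeasurable (Filter.Eventually.of_forall χ.norm_coe_le_norm)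
  LinearMap.mkContinuous
    { toFun := fun χ => ∫ x, χ x * u x ∂μ
      map_add' := fun χ₁ χ₂ => by
        simp only [ContinuousMap.add_apply, add_mul, integral_add (hint χ₁) (hint χ₂)]
      map_smul' := fun c χ => by
        simp only [ContinuousMap.smul_apply, smul_eq_mul, mul_assoc, integral_const_mul,
          RingHom.id_apply] }
    (∫ x, ‖u x‖ ∂μ) fun χ => by
      rw [mul_comm, ← integral_const_mul]
      refine norm_integral_le_of_norm_le (hu.norm.const_mul _)
        (Filter.Eventually.of_forall fun x => ?_)
      rw [norm_mul]
      gcongr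
      exact χ.norm_coe_le_norm x

variable {d : Type*} [Fintype d]

lemma integral_mul_eq_zero_of_integral_mFourier_mul_eq_zero {u : UnitAddTorus d → ℂ}
    (hu : Integrable u) (h : ∀ k, ∫ x, mFourier k x * u x = 0) (χ : C(UnitAddTorus d, ℂ)) :
    ∫ x, χ x * u x = 0 := by
  have hker : (Submodule.span ℂ (range (mFourier (d := d)))).topologicalClosure
      ≤ LinearMap.ker (integralMulCLM hu).toLinearMap := by
    refine Submodule.topologicalClosure_minimal _ (Submodule.span_le.2 ?_)
      (integralMulCLM hu).isClosed_ker
    rintro _ ⟨k, rfl⟩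
    exact h k
  rw [span_mFourier_closure_eq_top] at hker
  exact hker (Submodule.mem_top (x := χ))

lemma ae_eq_zero_of_integral_mFourier_mul_eq_zero {u : UnitAddTorus d → ℂ} (hu : Integrable u)
    (h : ∀ k, ∫ x, mFourier k x * u x = 0) : u =ᵐ[volume] 0 :=
  ae_eq_zero_of_forall_integral_smul_eq_zero hu fun χ =>
    integral_mul_eq_zero_of_integral_mFourier_mul_eq_zero hu h
      ⟨fun x => (χ x : ℂ), Complex.continuous_ofReal.comp χ.continuous⟩

lemma norm_mFourier_apply_le (k : d → ℤ) (x : UnitAddTorus d) : ‖mFourier k x‖ ≤ 1 :=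
  ((mFourier k).norm_coe_le_norm x).trans_eq mFourier_norm

lemma integrable_mFourier_mul {u : UnitAddTorus d → ℝ} (hu : Integrable u) (k : d → ℤ) :
    Integrable fun x => mFourier k x * (u x : ℂ) :=
  hu.ofReal.bdd_mul (mFourier k).continuous.aestronglyMeasurable
    (Filter.Eventually.of_forall (norm_mFourier_apply_le k))

lemma ae_eq_of_integral_mFourier_mul_eq {u w : UnitAddTorus d → ℝ} (hu : Integrable u)
    (hw : Integrable w) (h : ∀ k, ∫ x, mFourier k x * (u x : ℂ) = ∫ x, mFourier k x * (w x : ℂ)) :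
    u =ᵐ[volume] w := by
  have huw : (fun x => (u x : ℂ) - w x) =ᵐ[volume] 0 :=
    ae_eq_zero_of_integral_mFourier_mul_eq_zero (hu.ofReal.sub hw.ofReal) fun k => by
      simp_rw [mul_sub]
      rw [integral_sub (integrable_mFourier_mul hu k) (integrable_mFourier_mul hw k), h k, sub_self]
  filter_upwards [huw] with x hx
  exact Complex.ofReal_injective (sub_eq_zero.1 hx)

/-- The frequency `2 π i k · v` of the Fourier mode `k` along a trajectory with velocity `v`. -/
def freq (k : Fin 3 → ℤ) (v : Vel) : ℂ :=
  ((2 * Real.pi * ∑ i, (k i : ℝ) * v i : ℝ) : ℂ) * Complex.I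

lemma freq_smul (k : Fin 3 → ℤ) (s : ℝ) (v : Vel) : freq k (s • v) = s * freq k v := by
  simp only [freq, PiLp.smul_apply, smul_eq_mul, mul_left_comm _ s, ← Finset.mul_sum]
  push_cast
  ring

lemma freq_add (k : Fin 3 → ℤ) (v w : Vel) : freq k (v + w) = freq k v + freq k w := by
  simp only [freq, PiLp.add_apply, mul_add, Finset.sum_add_distrib]
  push_cast
  ring

lemma re_freq (k : Fin 3 → ℤ) (v : Vel) : (freq k v).re = 0 := by
  simp [freq]

lemma contDiff_freq (k : Fin 3 → ℤ) : ContDiff ℝ ∞ (freq k) := by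
  have hcoord (i : Fin 3) : ContDiff ℝ ∞ fun v : Vel => v i :=
    (EuclideanSpace.proj (𝕜 := ℝ) i).contDiff
  exact (Complex.ofRealCLM.contDiff.comp (contDiff_const.mul
    (ContDiff.sum fun i _ => contDiff_const.mul (hcoord i)))).mul contDiff_const

lemma mFourier_toTorus (k : Fin 3 → ℤ) (y : Vel) :
    mFourier k (toTorus y) = Complex.exp (freq k y) := by
  simp only [mFourier, ContinuousMap.coe_mk, toTorus, fourier_coe_apply, freq, ← Complex.exp_sum]
  push_cast
  rw [Finset.mul_sum, Finset.sum_mul]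
  refine congrArg Complex.exp (Finset.sum_congr rfl fun i _ => ?_)
  ring

lemma mFourier_add_toTorus (k : Fin 3 → ℤ) (x : Torus) (y : Vel) :
    mFourier k (x + toTorus y) = Complex.exp (freq k y) * mFourier k x := by
  obtain ⟨w, rfl⟩ := isOpenQuotientMap_toTorus.surjective x
  rw [← toTorus_add, mFourier_toTorus, mFourier_toTorus, freq_add, Complex.exp_add, mul_comm]

end Fourier

/-! ### The resolvent of the transport operator at a fixed velocity -/

section TransportResolvent

open UnitAddTorus

variable {c : ℝ} {v : Vel} {m : Torus → ℝ}

/-- The kernel whose integral over `s > 0` is `(c + v · ∂ₓ)⁻¹ m` at the point `x`. -/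
def resolventKernel (c : ℝ) (v : Vel) (m : Torus → ℝ) (x : Torus) (s : ℝ) : ℝ :=
  Real.exp (-(c * s)) * m (x - toTorus (s • v))

/-- `(c + v · ∂ₓ)⁻¹ m`. -/
def transportResolvent (c : ℝ) (v : Vel) (m : Torus → ℝ) (x : Torus) : ℝ :=
  ∫ s in Ioi (0 : ℝ), resolventKernel c v m x s

lemma measurable_resolventKernel (c : ℝ) (v : Vel) (hm : Measurable m) :
    Measurable (Function.uncurry (resolventKernel c v m)) := by
  have := continuous_toTorus.measurable
  unfold resolventKernel
  fun_prop

lemma lintegral_exp_neg_mul_Ioi (hc : 0 < c) :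
    ∫⁻ s in Ioi (0 : ℝ), ENNReal.ofReal (Real.exp (-(c * s))) = ENNReal.ofReal c⁻¹ := by
  simp_rw [← neg_mul]
  rw [← ofReal_integral_eq_lintegral_ofReal (integrableOn_exp_mul_Ioi (neg_neg_of_pos hc) 0)
    (Filter.Eventually.of_forall fun s => Real.exp_nonneg _),
    integral_exp_mul_Ioi (neg_neg_of_pos hc)]
  simp

lemma lintegral_lintegral_enorm_resolventKernel (hc : 0 < c) (v : Vel) (hm : Measurable m) :
    ∫⁻ x, ∫⁻ s in Ioi (0 : ℝ), ‖resolventKernel c v m x s‖ₑ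
      = ENNReal.ofReal c⁻¹ * ∫⁻ x, ‖m x‖ₑ := by
  have hK := measurable_resolventKernel c v hm
  rw [lintegral_lintegral_swap hK.enorm.aemeasurable, ← lintegral_exp_neg_mul_Ioi hc,
    ← lintegral_mul_const _ (by fun_prop)]
  refine lintegral_congr fun s => ?_
  simp only [resolventKernel, enorm_mul, Real.enorm_of_nonneg (Real.exp_nonneg _)]
  rw [lintegral_const_mul _ (by fun_prop)]
  exact congrArg _ (lintegral_sub_right_eq_self (fun x => ‖m x‖ₑ) (toTorus (s • v)))

lemma integrable_resolventKernel (hc : 0 < c) (v : Vel) (hmm : Measurable m) (hm : Integrable m) :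
    Integrable (Function.uncurry (resolventKernel c v m))
      (volume.prod (volume.restrict (Ioi 0))) := by
  have hK := measurable_resolventKernel c v hmm
  refine ⟨hK.aestronglyMeasurable, ?_⟩
  rw [HasFiniteIntegral, lintegral_prod _ hK.enorm.aemeasurable]
  exact (lintegral_lintegral_enorm_resolventKernel hc v hmm).trans_lt
    (ENNReal.mul_lt_top ENNReal.ofReal_lt_top hm.2)

lemma integrable_transportResolvent (hc : 0 < c) (v : Vel) (hmm : Measurable m)
    (hm : Integrable m) : Integrable (transportResolvent c v m) :=
  (integrable_resolventKernel hc v hmm hm).integral_prod_left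

lemma ofReal_mul_lintegral_transportResolvent_le (hc : 0 < c) (v : Vel) (hm : Measurable m) :
    ENNReal.ofReal c * ∫⁻ x, ‖transportResolvent c v m x‖ₑ ≤ ∫⁻ x, ‖m x‖ₑ :=
  calc ENNReal.ofReal c * ∫⁻ x, ‖transportResolvent c v m x‖ₑ
      ≤ ENNReal.ofReal c * ∫⁻ x, ∫⁻ s in Ioi (0 : ℝ), ‖resolventKernel c v m x s‖ₑ := by
        gcongr
        exact enorm_integral_le_lintegral_enorm _
    _ = ∫⁻ x, ‖m x‖ₑ := by
        rw [lintegral_lintegral_enorm_resolventKernel hc v hm, ← mul_assoc,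
          ← ENNReal.ofReal_mul hc.le, mul_inv_cancel₀ hc.ne', ENNReal.ofReal_one, one_mul]

lemma integral_mFourier_mul_resolventKernel (c : ℝ) (v : Vel) (m : Torus → ℝ) (k : Fin 3 → ℤ)
    (s : ℝ) : ∫ x, mFourier k x * (resolventKernel c v m x s : ℂ)
      = Complex.exp (-(c - freq k v) * s) * ∫ x, mFourier k x * (m x : ℂ) := by
  rw [← integral_const_mul, ← integral_add_right_eq_self _ (toTorus (s • v))]
  refine integral_congr_ae (Filter.Eventually.of_forall fun x => ?_)
  have hexp : Complex.exp (-(c - freq k v) * s)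
      = Complex.exp (s * freq k v) * Complex.exp (-(c * s)) := by
    rw [← Complex.exp_add]
    ring_nf
  simp only [resolventKernel, add_sub_cancel_right, mFourier_add_toTorus, freq_smul, hexp]
  push_cast
  ring

lemma ofReal_sub_freq_ne_zero (hc : 0 < c) (k : Fin 3 → ℤ) (v : Vel) : (c - freq k v : ℂ) ≠ 0 :=
  fun h => hc.ne' (by simpa [re_freq] using congrArg Complex.re h)

lemma integral_mFourier_mul_transportResolvent (hc : 0 < c) (v : Vel) (hmm : Measurable m)
    (hm : Integrable m) (k : Fin 3 → ℤ) :
    (c - freq k v) * ∫ x, mFourier k x * (transportResolvent c v m x : ℂ)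
      = ∫ x, mFourier k x * (m x : ℂ) := by
  have hK : Integrable (fun p : Torus × ℝ => mFourier k p.1 * (resolventKernel c v m p.1 p.2 : ℂ))
      (volume.prod (volume.restrict (Ioi 0))) :=
    (integrable_resolventKernel hc v hmm hm).ofReal.bdd_mul
      ((mFourier k).continuous.comp continuous_fst).aestronglyMeasurable
      (Filter.Eventually.of_forall fun p => norm_mFourier_apply_le k p.1)
  have hexp : ∫ s in Ioi (0 : ℝ), Complex.exp (-(c - freq k v) * s) = (c - freq k v)⁻¹ := by
    rw [integral_exp_mul_complex_Ioi (by simp [re_freq, hc]), neg_div_neg_eq]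
    simp
  calc (c - freq k v) * ∫ x, mFourier k x * (transportResolvent c v m x : ℂ)
      = (c - freq k v)
          * ∫ x, ∫ s in Ioi (0 : ℝ), mFourier k x * (resolventKernel c v m x s : ℂ) := by
        simp only [transportResolvent, integral_const_mul, integral_complex_ofReal]
    _ = (c - freq k v)
          * ∫ s in Ioi (0 : ℝ), ∫ x, mFourier k x * (resolventKernel c v m x s : ℂ) := by
        rw [integral_integral_swap hK]
    _ = ∫ x, mFourier k x * (m x : ℂ) := by
        simp only [integral_mFourier_mul_resolventKernel]
        rw [integral_mul_const, hexp, mul_inv_cancel_left₀ (ofReal_sub_freq_ne_zero hc k v)]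

lemma ofReal_mul_lintegral_le_of_mFourier {H : Torus → ℝ} (hH : Integrable H) (hm : Integrable m)
    (hmm : Measurable m) (hc : 0 < c)
    (h : ∀ k, (c - freq k v) * ∫ x, mFourier k x * (H x : ℂ) = ∫ x, mFourier k x * (m x : ℂ)) :
    ENNReal.ofReal c * ∫⁻ x, ‖H x‖ₑ ≤ ∫⁻ x, ‖m x‖ₑ := by
  have hHR : H =ᵐ[volume] transportResolvent c v m :=
    ae_eq_of_integral_mFourier_mul_eq hH (integrable_transportResolvent hc v hmm hm) fun k =>
      mul_left_cancel₀ (ofReal_sub_freq_ne_zero hc k v)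
        ((h k).trans (integral_mFourier_mul_transportResolvent hc v hmm hm k).symm)
  have hnorm : ∫⁻ x, ‖H x‖ₑ = ∫⁻ x, ‖transportResolvent c v m x‖ₑ :=
    lintegral_congr_ae (hHR.fun_comp (‖·‖ₑ))
  rw [hnorm]
  exact ofReal_mul_lintegral_transportResolvent_le hc v hmm

end TransportResolvent

/-! ### Uniqueness of mild solutions -/

section Uniqueness

open UnitAddTorus

lemma isTestFunction_mode (k : Fin 3 → ℤ) (ℓ : ℂ →L[ℝ] ℝ) {β : Vel → ℝ} (hβ : ContDiff ℝ ∞ β)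
    (hβc : HasCompactSupport β) :
    IsTestFunction fun z : Phase => β z.2 * ℓ (mFourier k z.1) := by
  constructor
  · simp only [mFourier_toTorus]
    exact (hβ.comp contDiff_snd).mul
      (ℓ.contDiff.comp ((contDiff_freq k).comp contDiff_fst).cexp)
  · refine HasCompactSupport.intro (isCompact_univ.prod hβc) fun z hz => ?_
    have hz₂ : β z.2 = 0 := image_eq_zero_of_notMem_tsupport fun h => hz ⟨mem_univ _, h⟩
    rw [hz₂, zero_mul]

lemma transport_mode (k : Fin 3 → ℤ) (ℓ : ℂ →L[ℝ] ℝ) (β : Vel → ℝ) (z : Phase) :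
    transport (fun z : Phase => β z.2 * ℓ (mFourier k z.1)) z
      = β z.2 * ℓ (freq k z.2 * mFourier k z.1) := by
  have hphase : HasDerivAt (fun s : ℝ => (s : ℂ) * freq k z.2) (1 * freq k z.2) 0 :=
    Complex.ofRealCLM.hasDerivAt.mul_const _
  have hmode : HasDerivAt (fun s : ℝ => mFourier k (freeFlow s z).1)
      (freq k z.2 * mFourier k z.1) 0 := by
    simp only [freeFlow, mFourier_add_toTorus, freq_smul]
    simpa using hphase.cexp.mul_const (mFourier k z.1)
  exact ((ℓ.hasFDerivAt.comp_hasDerivAt (0 : ℝ) hmode).const_mul (β z.2)).deriv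

lemma dampedGenerator_mode (L : Vel → ℝ) (k : Fin 3 → ℤ) (ℓ : ℂ →L[ℝ] ℝ) (β : Vel → ℝ)
    (z : Phase) : dampedGenerator L (fun z : Phase => β z.2 * ℓ (mFourier k z.1)) z
      = β z.2 * ℓ ((freq k z.2 - L z.2) * mFourier k z.1) := by
  rw [dampedGenerator, transport_mode, sub_mul, map_sub, ← Complex.real_smul, map_smul, smul_eq_mul]
  ring

/-- The Fourier coefficient of order `k` in the position variable, at a fixed velocity. -/
def fourierMode (k : Fin 3 → ℤ) (H : Phase → ℝ) (v : Vel) : ℂ :=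
  ∫ x : Torus, mFourier k x * (H (x, v) : ℂ)

lemma integrable_mFourier_fst_mul {H : Phase → ℝ} (hH : Integrable H) (k : Fin 3 → ℤ) :
    Integrable fun z : Phase => mFourier k z.1 * (H z : ℂ) :=
  hH.ofReal.bdd_mul ((mFourier k).continuous.comp continuous_fst).aestronglyMeasurable
    (Filter.Eventually.of_forall fun z => norm_mFourier_apply_le k z.1)

lemma integrable_fourierMode {H : Phase → ℝ} (hH : Integrable H) (k : Fin 3 → ℤ) :
    Integrable (fourierMode k H) :=
  (integrable_mFourier_fst_mul hH k).integral_prod_right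

lemma integrable_mul_mFourier_fst_mul {H : Phase → ℝ} (hH : Integrable H) (k : Fin 3 → ℤ)
    {b : Vel → ℂ} (hbm : Measurable b) {M : ℝ} (hM : ∀ v, ‖b v‖ ≤ M) :
    Integrable fun z : Phase => b z.2 * (mFourier k z.1 * (H z : ℂ)) :=
  (integrable_mFourier_fst_mul hH k).bdd_mul (hbm.comp measurable_snd).aestronglyMeasurable
    (Filter.Eventually.of_forall fun z => hM z.2)

lemma integral_mul_fourierMode {H : Phase → ℝ} (hH : Integrable H) (k : Fin 3 → ℤ)
    {b : Vel → ℂ} (hbm : Measurable b) {M : ℝ} (hM : ∀ v, ‖b v‖ ≤ M) :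
    ∫ v, b v * fourierMode k H v = ∫ z : Phase, b z.2 * (mFourier k z.1 * (H z : ℂ)) := by
  rw [Measure.volume_eq_prod,
    integral_prod_symm _ (integrable_mul_mFourier_fst_mul hH k hbm hM)]
  simp only [integral_const_mul, fourierMode]

lemma locallyIntegrable_mul_of_norm_le {X : Type*} [TopologicalSpace X] [LocallyCompactSpace X]
    [T2Space X] [MeasurableSpace X] [OpensMeasurableSpace X] {μ : Measure X} {b F : X → ℂ}
    {p : X → ℝ} (hb : AEStronglyMeasurable b μ) (hp : Continuous p) (hbp : ∀ x, ‖b x‖ ≤ p x)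
    (hF : Integrable F μ) : LocallyIntegrable (fun x => b x * F x) μ := by
  refine locallyIntegrable_iff.2 fun K hK => ?_
  obtain ⟨M, hM⟩ := hK.exists_bound_of_continuousOn hp.continuousOn
  refine hF.restrict.bdd_mul hb.restrict (c := M) ?_
  filter_upwards [ae_restrict_mem hK.measurableSet] with x hx
  exact (hbp x).trans ((le_abs_self _).trans (hM x hx))

namespace IsBackground

variable {g₀ : Vel → ℝ} {g : Vel → ℝ≥0∞} (hb : IsBackground g₀ g)

include hb

lemma measurable_freq_sub_lossRate (k : Fin 3 → ℤ) :
    Measurable fun v => freq k v - (lossRate g₀ v : ℂ) :=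
  (contDiff_freq k).continuous.measurable.sub hb.measurable_lossRate.complex_ofReal

lemma exists_continuous_norm_freq_sub_lossRate_le (k : Fin 3 → ℤ) :
    ∃ p : Vel → ℝ, Continuous p ∧ ∀ v, ‖freq k v - (lossRate g₀ v : ℂ)‖ ≤ p v := by
  obtain ⟨C, hC⟩ := hb.exists_lossRate_le
  have hfreq := (contDiff_freq k).continuous
  refine ⟨fun v => ‖freq k v‖ + C * (1 + ‖v‖), by fun_prop, fun v => ?_⟩
  refine (norm_sub_le _ _).trans (add_le_add_right ?_ _)
  rw [Complex.norm_real, Real.norm_of_nonneg (hb.lossRate_nonneg v)]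
  exact hC v

end IsBackground

section Generator

variable {g₀ : Vel → ℝ} {g : Vel → ℝ≥0∞} {H a : L1}

lemma IsA.integral_smul_fourierMode (h : IsA g₀ H a) (hb : IsBackground g₀ g) (k : Fin 3 → ℤ)
    {β : Vel → ℝ} (hβ : ContDiff ℝ ∞ β) (hβc : HasCompactSupport β) :
    ∫ v, β v • ((freq k v - lossRate g₀ v) * fourierMode k H v)
      = ∫ v, β v • fourierMode k a v := by
  have hH := L1.integrable_coeFn H
  have ha := L1.integrable_coeFn a
  have hβm : Measurable fun v => (β v : ℂ) := hβ.continuous.measurable.complex_ofReal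
  have hbm : Measurable fun v => (β v : ℂ) * (freq k v - lossRate g₀ v) :=
    hβm.mul (hb.measurable_freq_sub_lossRate k)
  obtain ⟨p, hp, hfreq⟩ := hb.exists_continuous_norm_freq_sub_lossRate_le k
  obtain ⟨M, hM⟩ := hβc.exists_bound_of_continuous hβ.continuous
  obtain ⟨M', hM'⟩ := (hβc.mul_right (f' := p)).exists_bound_of_continuous
    (hβ.continuous.mul hp)
  have hβM : ∀ v, ‖(β v : ℂ)‖ ≤ M := fun v => (Complex.norm_real _).trans_le (hM v)
  have hbM : ∀ v, ‖(β v : ℂ) * (freq k v - lossRate g₀ v)‖ ≤ M' := fun v => by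
    refine le_trans ?_ (hM' v)
    rw [norm_mul, Pi.mul_apply, norm_mul, Complex.norm_real]
    gcongr
    exact (hfreq v).trans (le_abs_self _)
  simp only [Complex.real_smul, ← mul_assoc]
  rw [integral_mul_fourierMode hH k hbm hbM, integral_mul_fourierMode ha k hβm hβM]
  have hℓ (ℓ : ℂ →L[ℝ] ℝ) :
      ℓ (∫ z : Phase, (β z.2 * (freq k z.2 - lossRate g₀ z.2)) * (mFourier k z.1 * (H z : ℂ)))
        = ℓ (∫ z : Phase, β z.2 * (mFourier k z.1 * (a z : ℂ))) := by
    rw [← ℓ.integral_comp_comm (integrable_mul_mFourier_fst_mul hH k hbm hbM),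
      ← ℓ.integral_comp_comm (integrable_mul_mFourier_fst_mul ha k hβm hβM)]
    have hsmul (r s : ℝ) (w : ℂ) : ℓ (r * (w * s)) = s * (r * ℓ w) := by
      rw [mul_comm w, ← Complex.real_smul, ← Complex.real_smul, map_smul, map_smul, smul_eq_mul,
        smul_eq_mul, mul_left_comm]
    convert h _ (isTestFunction_mode k ℓ hβ hβc) using 3 with z z
    · rw [mul_assoc, ← mul_assoc (freq k z.2 - _), hsmul]
      exact congrArg _ (dampedGenerator_mode _ k ℓ β z).symm
    · exact hsmul _ _ _
  exact Complex.ext (hℓ Complex.reCLM) (hℓ Complex.imCLM)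

lemma IsA.fourierMode_eq (h : IsA g₀ H a) (hb : IsBackground g₀ g) (k : Fin 3 → ℤ) :
    ∀ᵐ v : Vel, (freq k v - lossRate g₀ v) * fourierMode k H v = fourierMode k a v := by
  obtain ⟨p, hp, hfreq⟩ := hb.exists_continuous_norm_freq_sub_lossRate_le k
  exact ae_eq_of_integral_contDiff_smul_eq
    (locallyIntegrable_mul_of_norm_le (hb.measurable_freq_sub_lossRate k).aestronglyMeasurable
      hp hfreq (integrable_fourierMode (L1.integrable_coeFn H) k))
    (integrable_fourierMode (L1.integrable_coeFn a) k).locallyIntegrable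
    fun β hβ hβc => h.integral_smul_fourierMode hb k hβ hβc

lemma lintegral_phase {F : Phase → ℝ≥0∞} (hF : Measurable F) :
    ∫⁻ z, F z = ∫⁻ v, ∫⁻ x, F (x, v) := by
  rw [Measure.volume_eq_prod, lintegral_prod_symm _ hF.aemeasurable]

lemma IsA.ae_mul_lintegral_le (h : IsA g₀ H a) (hb : IsBackground g₀ g) {r : ℝ} (hr : 0 < r) :
    ∀ᵐ v : Vel, ENNReal.ofReal (r + lossRate g₀ v) * ∫⁻ x : Torus, ‖H (x, v)‖ₑ
      ≤ ∫⁻ x : Torus, ‖r * H (x, v) - a (x, v)‖ₑ := by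
  have := (Lp.stronglyMeasurable H).measurable
  have := (Lp.stronglyMeasurable a).measurable
  filter_upwards [ae_all_iff.2 (h.fourierMode_eq hb), (L1.integrable_coeFn H).prod_left_ae,
    (L1.integrable_coeFn a).prod_left_ae] with v hv hH ha
  refine ofReal_mul_lintegral_le_of_mFourier (v := v) hH ((hH.const_mul r).sub ha) (by fun_prop)
    (by linarith [hb.lossRate_nonneg v]) fun k => ?_
  have hmode : ∫ x, mFourier k x * ((r * H (x, v) - a (x, v) : ℝ) : ℂ)
      = r * fourierMode k H v - fourierMode k a v := by
    rw [fourierMode, fourierMode, ← integral_const_mul, ← integral_sub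
      ((integrable_mFourier_mul hH k).const_mul _) (integrable_mFourier_mul ha k)]
    refine integral_congr_ae (Filter.Eventually.of_forall fun x => ?_)
    push_cast
    ring
  rw [hmode, ← hv k, fourierMode]
  push_cast
  ring

lemma IsA.resolvent_le (h : IsA g₀ H a) (hb : IsBackground g₀ g) {r : ℝ} (hr : 0 < r) :
    ENNReal.ofReal r * ‖H‖ₑ + ∫⁻ z, ‖H z‖ₑ * eLossRate g z.2 ≤ ‖r • H - a‖ₑ := by
  have := (Lp.stronglyMeasurable H).measurable
  have := (Lp.stronglyMeasurable a).measurable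
  have := measurable_eLossRate hb.measurable
  have := hb.measurable_lossRate
  have hsub : (r • H - a : L1) =ᵐ[volume] fun z => r * H z - a z := by
    filter_upwards [Lp.coeFn_sub (r • H) a, Lp.coeFn_smul r H] with z h₁ h₂
    rw [h₁, Pi.sub_apply, h₂, Pi.smul_apply, smul_eq_mul]
  calc ENNReal.ofReal r * ‖H‖ₑ + ∫⁻ z, ‖H z‖ₑ * eLossRate g z.2
      = ∫⁻ z, ENNReal.ofReal (r + lossRate g₀ z.2) * ‖H z‖ₑ := by
        rw [enorm_eq_lintegral_of_ae_eq Filter.EventuallyEq.rfl,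
          ← lintegral_const_mul _ (by fun_prop), ← lintegral_add_left (by fun_prop)]
        refine lintegral_congr fun z => ?_
        rw [ENNReal.ofReal_add hr.le (hb.lossRate_nonneg _), hb.ofReal_lossRate, add_mul,
          mul_comm ‖H z‖ₑ]
    _ = ∫⁻ v, ENNReal.ofReal (r + lossRate g₀ v) * ∫⁻ x : Torus, ‖H (x, v)‖ₑ := by
        rw [lintegral_phase (by fun_prop)]
        exact lintegral_congr fun v =>
          lintegral_const_mul (ENNReal.ofReal (r + lossRate g₀ v)) (by fun_prop)
    _ ≤ ∫⁻ v, ∫⁻ x : Torus, ‖r * H (x, v) - a (x, v)‖ₑ :=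
        lintegral_mono_ae (h.ae_mul_lintegral_le hb hr)
    _ = ‖r • H - a‖ₑ := by
        rw [enorm_eq_lintegral_of_ae_eq hsub, lintegral_phase (by fun_prop)]

lemma IsA.eq_zero (h : IsA g₀ 0 a) (hb : IsBackground g₀ g) : a = 0 := by
  have hsection : ∀ᵐ v : Vel, ∀ᵐ x : Torus, a (x, v) = 0 := by
    filter_upwards [ae_all_iff.2 (h.fourierMode_eq hb),
      (L1.integrable_coeFn a).prod_left_ae] with v hv ha
    refine ae_eq_of_integral_mFourier_mul_eq ha (integrable_zero Torus ℝ volume) fun k => ?_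
    rw [← fourierMode, ← hv k]
    simp [fourierMode]
  have hzero : MeasurableSet {z : Phase | a z = 0} :=
    (Lp.stronglyMeasurable a).measurable (measurableSet_singleton 0)
  rw [Lp.eq_zero_iff_ae_eq_zero]
  exact Measure.measurePreserving_swap.quasiMeasurePreserving.ae
    ((Measure.ae_prod_iff_ae_ae (measurable_swap hzero)).2 hsection)

lemma IsAPlusB.norm_le (h : IsAPlusB g₀ H a) (hb : IsBackground g₀ g) {s : ℝ} (hs : 0 < s) :
    ‖H‖ ≤ ‖H - s • a‖ := by
  obtain ⟨a, b, hA, hB, rfl⟩ := h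
  have hr : 0 < s⁻¹ := inv_pos.2 hs
  have hresolvent := hA.resolvent_le hb hr
  have hgain := hb.enorm_le_of_isB hB
    (ne_top_of_le_ne_top enorm_ne_top (le_add_self.trans hresolvent))
  have hsum : s⁻¹ * ‖H‖ + ‖b‖ ≤ ‖s⁻¹ • H - a‖ := by
    rw [← ENNReal.ofReal_le_ofReal_iff (norm_nonneg _), ENNReal.ofReal_add (by positivity)
      (norm_nonneg _), ENNReal.ofReal_mul hr.le]
    simp only [ofReal_norm]
    exact (add_le_add_right hgain _).trans hresolvent
  have htriangle : ‖s⁻¹ • H - a‖ ≤ ‖s⁻¹ • H - (a + b)‖ + ‖b‖ := by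
    simpa only [sub_add_eq_sub_sub, sub_add_cancel] using norm_add_le (s⁻¹ • H - (a + b)) b
  have hscale : ‖H - s • (a + b)‖ = s * ‖s⁻¹ • H - (a + b)‖ := by
    rw [← norm_smul_of_nonneg hs.le, smul_sub, smul_inv_smul₀ hs.ne']
  rw [hscale, ← inv_mul_le_iff₀ hs]
  linarith

lemma IsAPlusB.eq_zero (h : IsAPlusB g₀ 0 a) (hb : IsBackground g₀ g) : a = 0 := by
  obtain ⟨a, b, hA, hB, rfl⟩ := h
  have hloss : ∫⁻ z, ‖(0 : L1) z‖ₑ * eLossRate g z.2 = 0 := by simp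
  have hgain := hb.enorm_le_of_isB hB (by rw [hloss]; exact ENNReal.zero_ne_top)
  rw [hloss, nonpos_iff_eq_zero, enorm_eq_zero] at hgain
  rw [hA.eq_zero hb, hgain, add_zero]

end Generator

section Difference

variable {g₀ : Vel → ℝ} {g : Vel → ℝ≥0∞} {F F' h h' : L1}

lemma IsA.sub (hF : IsA g₀ F h) (hF' : IsA g₀ F' h') (hb : IsBackground g₀ g) :
    IsA g₀ (F - F') (h - h') := by
  intro φ hφ
  obtain ⟨C, hC⟩ := hb.exists_lossRate_le
  obtain ⟨M, hM⟩ := hφ.exists_norm_dampedGenerator_le hb.lossRate_nonneg hC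
  obtain ⟨M', hM'⟩ := hφ.2.exists_bound_of_continuous hφ.continuous
  exact (integral_coeFn_sub_mul _ _ (hφ.measurable_dampedGenerator hb.measurable_lossRate) hM).trans
    ((congrArg₂ _ (hF φ hφ) (hF' φ hφ)).trans
      (integral_coeFn_sub_mul _ _ hφ.continuous.measurable hM').symm)

lemma IsBackground.gainIntegrand_sub_ae_eq (hb : IsBackground g₀ g) :
    ∀ᵐ z : Phase, (fun p : Sph × Vel => gainIntegrand g₀ (F - F' : L1) z p.1 p.2)
      =ᵐ[surf.prod volume]
        fun p => gainIntegrand g₀ F z p.1 p.2 - gainIntegrand g₀ F' z p.1 p.2 := by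
  filter_upwards [hb.gainIntegrand_ae_eq (Lp.coeFn_sub F F'),
    hb.gainIntegrand_ae_eq (Filter.EventuallyEq.refl _ (F : Phase → ℝ)),
    hb.gainIntegrand_ae_eq (Filter.EventuallyEq.refl _ (F' : Phase → ℝ))] with z hsub hF hF'
  filter_upwards [hsub, hF, hF'] with p hsub hF hF'
  rw [hsub, hF, hF']
  simp only [gainVersion, Pi.sub_apply]
  ring

lemma IsB.sub (hF : IsB g₀ F h) (hF' : IsB g₀ F' h') (hb : IsBackground g₀ g) :
    IsB g₀ (F - F') (h - h') := by
  have hsub := hb.gainIntegrand_sub_ae_eq (F := F) (F' := F')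
  have hint : ∀ᵐ z : Phase, Integrable
      (fun p : Sph × Vel => gainIntegrand g₀ (F - F' : L1) z p.1 p.2) (surf.prod volume) := by
    filter_upwards [hsub, hF.1, hF'.1] with z hz hFz hFz'
    exact (hFz.sub hFz').congr hz.symm
  refine ⟨hint, ?_⟩
  filter_upwards [hsub, hint, hF.1, hF'.1, hF.2, hF'.2, Lp.coeFn_sub h h']
    with z hz hint hFi hFi' hFz hFz' hhz
  rw [hhz, Pi.sub_apply, hFz, hFz', gainTerm, gainTerm, gainTerm, ← integral_prod _ hint,
    ← integral_prod _ hFi, ← integral_prod _ hFi', ← integral_sub hFi hFi']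
  exact integral_congr_ae hz.symm

lemma IsAPlusB.sub (hF : IsAPlusB g₀ F h) (hF' : IsAPlusB g₀ F' h') (hb : IsBackground g₀ g) :
    IsAPlusB g₀ (F - F') (h - h') := by
  obtain ⟨a, b, hA, hB, rfl⟩ := hF
  obtain ⟨a', b', hA', hB', rfl⟩ := hF'
  exact ⟨a - a', b - b', hA.sub hA' hb, hB.sub hB' hb, add_sub_add_comm a b a' b'⟩

lemma IsMildSolution.unique (hb : IsBackground g₀ g) {T : ℝ} {u₀ : L1} {u u' : ℝ → L1}
    (hu : IsMildSolution (IsAPlusB g₀) T u₀ u) (hu' : IsMildSolution (IsAPlusB g₀) T u₀ u')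
    {t : ℝ} (ht : t ∈ Icc (0 : ℝ) T) : u' t = u t := by
  have hT : 0 ≤ T := ht.1.trans ht.2
  have hdiff : ∀ t ∈ Icc (0 : ℝ) T,
      IsAPlusB g₀ (∫ θ in (0 : ℝ)..t, (u' θ - u θ)) (u' t - u t) := by
    intro t ht
    have hsub : uIcc 0 t ⊆ uIcc 0 T := by
      rw [uIcc_of_le ht.1, uIcc_of_le hT]
      exact Icc_subset_Icc_right ht.2
    rw [intervalIntegral.integral_sub (hu'.1.mono_set hsub) (hu.1.mono_set hsub),
      ← sub_sub_sub_cancel_right (u' t) (u t) u₀]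
    exact (hu'.2 t ht).sub (hu.2 t ht) hb
  have hzero := hdiff t ht
  rw [integral_eq_zero_of_dissipative (fun x y hxy s hs => hxy.norm_le hb hs)
    (hu'.1.sub hu.1) hdiff ht] at hzero
  exact sub_eq_zero.1 (hzero.eq_zero hb)

end Difference

end Uniqueness

/-! ### The density of collision trees -/

section Splitting

variable {X Y : Type*} [MeasurableSpace X] [MeasurableSpace Y] {n : ℕ}

@[fun_prop]
lemma measurable_finInit {m : X → Fin (n + 1) → Y} (hm : Measurable m) :
    Measurable fun x => (Fin.init (m x) : Fin n → Y) :=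
  measurable_pi_lambda _ fun j => (measurable_pi_apply j.castSucc).comp hm

lemma measurePreserving_init_last (μ : Measure X) [SFinite μ] (ν : Measure Y) [SigmaFinite ν]
    (n : ℕ) : MeasurePreserving
      (fun p : X × (Fin (n + 1) → Y) => ((p.1, (Fin.init p.2 : Fin n → Y)), p.2 (Fin.last n)))
      (μ.prod (Measure.pi fun _ => ν)) ((μ.prod (Measure.pi fun _ => ν)).prod ν) := by
  have hsplit : MeasurePreserving
      (fun m : Fin (n + 1) → Y => ((Fin.init m : Fin n → Y), m (Fin.last n)))
      (Measure.pi fun _ => ν) ((Measure.pi fun _ => ν).prod ν) := by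
    convert Measure.measurePreserving_swap.comp
      (measurePreserving_piFinSuccAbove (fun _ : Fin (n + 1) => ν) (Fin.last n)) using 1
    ext m : 1
    exact Prod.ext (Fin.removeNth_last m).symm rfl
  exact (measurePreserving_prodAssoc μ (Measure.pi fun _ : Fin n => ν) ν).symm.comp
    ((MeasurePreserving.id μ).prod hsplit)

lemma ae_pi_injective {ν : Measure Y} [SigmaFinite ν] {Z : Type*} [MeasurableSpace Z]
    [MeasurableEq Z] {h : Y → Z} (hh : Measurable h) (hne : ∀ c, ∀ᵐ y ∂ν, h y ≠ c) (n : ℕ) :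
    ∀ᵐ m ∂(Measure.pi fun _ : Fin n => ν), Function.Injective fun j => h (m j) := by
  cases n with
  | zero => exact Filter.Eventually.of_forall fun m => Function.injective_of_subsingleton _
  | succ n =>
    have hpair (i : Fin (n + 1)) (k : Fin n) :
        ∀ᵐ m ∂(Measure.pi fun _ : Fin (n + 1) => ν), h (m i) ≠ h (m (i.succAbove k)) := by
      have hs : MeasurableSet {q : (Fin n → Y) × Y | h q.2 ≠ h (q.1 k)} :=
        (measurableSet_eq_fun (by fun_prop) (by fun_prop)).compl
      have hprod : ∀ᵐ q ∂((Measure.pi fun _ : Fin n => ν).prod ν), h q.2 ≠ h (q.1 k) :=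
        (Measure.ae_prod_iff_ae_ae hs).2 (Filter.Eventually.of_forall fun m => hne (h (m k)))
      exact (measurePreserving_piFinSuccAbove (fun _ => ν) i).quasiMeasurePreserving.ae
        (Measure.measurePreserving_swap.quasiMeasurePreserving.ae hprod)
    filter_upwards [ae_all_iff.2 fun i => ae_all_iff.2 (hpair i)] with m hm i j hij
    by_contra hne
    obtain ⟨k, rfl⟩ := Fin.exists_succAbove_eq (Ne.symm hne)
    exact hm i k hij

end Splitting

/-- The measure `dt dν dv` on markers. -/
def markerMeasure : Measure Marker := volume.prod (surf.prod volume)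

instance : SigmaFinite markerMeasure := by unfold markerMeasure; infer_instance

/-- The measure `dx₀ dv₀ ∏ⱼ dtⱼ dνⱼ dvⱼ` on the trees with `n` collisions. -/
def levelMeasure (n : ℕ) : Measure (Phase × (Fin n → Marker)) :=
  volume.prod (Measure.pi fun _ => markerMeasure)

instance (n : ℕ) : SigmaFinite (levelMeasure n) := by unfold levelMeasure; infer_instance

lemma ae_levelMeasure_injective_times (n : ℕ) :
    ∀ᵐ p ∂(levelMeasure n), Function.Injective fun j => (p.2 j).1 :=
  Measure.quasiMeasurePreserving_snd.ae <| ae_pi_injective measurable_fst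
    (fun c => Measure.quasiMeasurePreserving_fst.ae (Measure.ae_ne volume c)) n

/-- The solution of the idealized equation at time `t`, on the trees with `n` collisions: the
density of the root at the final collision, times the rate of that collision, times the probability
that no further collision occurs before time `t`. -/
def treeDensity (f₀ : Phase → ℝ) (g₀ : Vel → ℝ) : (n : ℕ) → Phase → (Fin n → Marker) → ℝ → ℝ
  | 0, z, _, t => f₀ z * Real.exp (-(t * lossRate g₀ z.2))
  | n + 1, z, m, t =>
      let last := m (Fin.last n)
      let before := rootAux n z (Fin.init m) last.1
      if last.1 ∈ Ioc 0 t then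
        treeDensity f₀ g₀ n z (Fin.init m) last.1
          * (g₀ last.2.2 * crossSection before.2 last.2.2 last.2.1)
          * Real.exp (-((t - last.1) * lossRate g₀ (scatter before.2 last.2.1 last.2.2)))
      else 0

/-- The density `treeDensity` of trees with `n` collisions, with values in `[0, ⊤]`. -/
def eTreeDensity (g₀ : Vel → ℝ) (g : Vel → ℝ≥0∞) (f : Phase → ℝ≥0∞) :
    (n : ℕ) → Phase → (Fin n → Marker) → ℝ → ℝ≥0∞
  | 0, z, _, t => f z * survival (lossRate g₀) t z.2
  | n + 1, z, m, t =>
      let last := m (Fin.last n)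
      let before := rootAux n z (Fin.init m) last.1
      if last.1 ∈ Ioc 0 t then
        eTreeDensity g₀ g f n z (Fin.init m) last.1
          * (g last.2.2 * ENNReal.ofReal (crossSection before.2 last.2.2 last.2.1))
          * survival (lossRate g₀) (t - last.1) (scatter before.2 last.2.1 last.2.2)
      else 0

section TreeDensity

variable {f₀ : Phase → ℝ} {g₀ : Vel → ℝ} {g : Vel → ℝ≥0∞} {f ψ : Phase → ℝ≥0∞} {n : ℕ} {t : ℝ}

lemma times_mem_Ioc_of_treeDensity_ne_zero {z : Phase} {m : Fin n → Marker}
    (h : treeDensity f₀ g₀ n z m t ≠ 0) (j : Fin n) : (m j).1 ∈ Ioc 0 t := by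
  induction n generalizing t with
  | zero => exact j.elim0
  | succ n ih =>
    simp only [treeDensity, ne_eq, ite_eq_right_iff, Classical.not_imp] at h
    obtain ⟨hlast, h⟩ := h
    have hinit := ih (m := Fin.init m) (left_ne_zero_of_mul (left_ne_zero_of_mul h))
    induction j using Fin.lastCases with
    | last => exact hlast
    | cast j => exact ⟨(hinit j).1, (hinit j).2.trans hlast.2⟩

lemma monotone_times_of_treeDensity_ne_zero {z : Phase} {m : Fin n → Marker}
    (h : treeDensity f₀ g₀ n z m t ≠ 0) : Monotone fun j => (m j).1 := by
  induction n generalizing t with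
  | zero => exact fun j => j.elim0
  | succ n ih =>
    simp only [treeDensity, ne_eq, ite_eq_right_iff, Classical.not_imp] at h
    have hinit := left_ne_zero_of_mul (left_ne_zero_of_mul h.2)
    intro i j hij
    induction j using Fin.lastCases with
    | last =>
      induction i using Fin.lastCases with
      | last => exact le_rfl
      | cast i => exact (times_mem_Ioc_of_treeDensity_ne_zero hinit i).2
    | cast j =>
      induction i using Fin.lastCases with
      | last => exact absurd hij (Fin.castSucc_lt_last j).not_ge
      | cast i => exact ih hinit (Fin.castSucc_le_castSucc_iff.1 hij)

lemma treeDensity_eq_toReal {z : Phase} {m : Fin n → Marker} (hz : f₀ z = (f z).toReal)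
    (hm : ∀ j, g₀ (m j).2.2 = (g (m j).2.2).toReal) (t : ℝ) :
    treeDensity f₀ g₀ n z m t = (eTreeDensity g₀ g f n z m t).toReal := by
  induction n generalizing t with
  | zero => simp [treeDensity, eTreeDensity, survival, hz, ENNReal.toReal_ofReal, Real.exp_nonneg]
  | succ n ih =>
    simp only [treeDensity, eTreeDensity]
    rw [ih (m := Fin.init m) fun j => hm j.castSucc]
    split_ifs
    · simp [survival, hm, ENNReal.toReal_ofReal, Real.exp_nonneg, crossSection_nonneg]
    · rfl

section Measurability

variable {α : Type*} [MeasurableSpace α] {z : α → Phase} {s : α → ℝ}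

@[fun_prop]
lemma measurable_rootAux {m : α → Fin n → Marker} (hz : Measurable z) (hm : Measurable m)
    (hs : Measurable s) : Measurable fun a => rootAux n (z a) (m a) (s a) := by
  induction n generalizing s with
  | zero => simp only [rootAux]; fun_prop
  | succ n ih =>
    have hlast : Measurable fun a => (m a (Fin.last n)).1 := by fun_prop
    have := ih (m := fun a => Fin.init (m a)) (by fun_prop) hlast
    exact Measurable.ite (measurableSet_lt hs hlast) (ih (by fun_prop) hs) (by fun_prop)

lemma IsBackground.measurable_eTreeDensity (hb : IsBackground g₀ g) (hf : Measurable f)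
    {m : α → Fin n → Marker} (hz : Measurable z) (hm : Measurable m) (hs : Measurable s) :
    Measurable fun a => eTreeDensity g₀ g f n (z a) (m a) (s a) := by
  have := hb.measurable_lossRate
  have := hb.measurable
  induction n generalizing s with
  | zero => simp only [eTreeDensity]; fun_prop
  | succ n ih =>
    have hlast : Measurable fun a => (m a (Fin.last n)).1 := by fun_prop
    have := ih (m := fun a => Fin.init (m a)) (by fun_prop) hlast
    exact Measurable.ite ((measurableSet_lt measurable_const hlast).inter
      (measurableSet_le hlast hs)) (by fun_prop) measurable_const

end Measurability

/-! ### The law of the tagged particle of a collision tree -/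

/-- The adjoint of the damped free transport over a time `s`. -/
def eTransportAdjoint (L : Vel → ℝ) (ψ : Phase → ℝ≥0∞) (s : ℝ) (z : Phase) : ℝ≥0∞ :=
  survival L s z.2 * ψ (freeFlow s z)

@[fun_prop]
lemma measurable_eTransportAdjoint {L : Vel → ℝ} (hL : Measurable L) (hψ : Measurable ψ)
    {α : Type*} [MeasurableSpace α] {s : α → ℝ} {z : α → Phase} (hs : Measurable s)
    (hz : Measurable z) : Measurable fun a => eTransportAdjoint L ψ (s a) (z a) := by
  unfold eTransportAdjoint; fun_prop

/-- The density of a tree whose final collision is `q.2`, at the time of that collision, times the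
weight `ψ` which its tagged particle carries at time `t`. -/
def lastCollisionWeight (g₀ : Vel → ℝ) (g : Vel → ℝ≥0∞) (f ψ : Phase → ℝ≥0∞) (n : ℕ) (t : ℝ)
    (q : (Phase × (Fin n → Marker)) × Marker) : ℝ≥0∞ :=
  let before := rootAux n q.1.1 q.1.2 q.2.1
  eTreeDensity g₀ g f n q.1.1 q.1.2 q.2.1 *
    (eTransportAdjoint (lossRate g₀) ψ (t - q.2.1) (before.1, scatter before.2 q.2.2.1 q.2.2.2) *
      g q.2.2.2 * ENNReal.ofReal (crossSection before.2 q.2.2.2 q.2.2.1))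

lemma mul_eTreeDensity_succ (z : Phase) (m : Fin (n + 1) → Marker) :
    ψ (rootAux (n + 1) z m t) * eTreeDensity g₀ g f (n + 1) z m t
      = {q : (Phase × (Fin n → Marker)) × Marker | q.2.1 ∈ Ioc 0 t}.indicator
          (lastCollisionWeight g₀ g f ψ n t) ((z, Fin.init m), m (Fin.last n)) := by
  by_cases ht : (m (Fin.last n)).1 ∈ Ioc 0 t
  · simp only [rootAux, eTreeDensity, indicator, mem_ofPred_eq, ht, if_true, ht.2.not_gt, if_false,
      lastCollisionWeight, eTransportAdjoint]
    ring
  · simp only [eTreeDensity, indicator, mem_ofPred_eq, ht, if_false, mul_zero]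

namespace IsBackground

variable (hb : IsBackground g₀ g) (hf : Measurable f) (hψ : Measurable ψ)
include hb hf hψ

lemma measurable_lastCollisionWeight : Measurable (lastCollisionWeight g₀ g f ψ n t) := by
  have := hb.measurable_lossRate
  have := hb.measurable
  have := hb.measurable_eTreeDensity hf (n := n)
    (α := (Phase × (Fin n → Marker)) × Marker) (z := fun q => q.1.1) (m := fun q => q.1.2)
    (s := fun q => q.2.1) (by fun_prop) (by fun_prop) (by fun_prop)
  unfold lastCollisionWeight
  dsimp only
  fun_prop

lemma lintegral_lastCollisionWeight (s : ℝ) :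
    ∫⁻ r : Sph × Vel, ∫⁻ p, lastCollisionWeight g₀ g f ψ n t (p, s, r) ∂(levelMeasure n)
        ∂(surf.prod volume)
      = ∫⁻ p, eGainAdjoint g (eTransportAdjoint (lossRate g₀) ψ (t - s)) (rootAux n p.1 p.2 s)
          * eTreeDensity g₀ g f n p.1 p.2 s ∂(levelMeasure n) := by
  have := hb.measurable_lossRate
  have := hb.measurable
  have := hb.measurable_lastCollisionWeight hf hψ (n := n) (t := t)
  rw [lintegral_lintegral_swap (by fun_prop)]
  refine lintegral_congr fun p => ?_
  simp only [lastCollisionWeight]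
  rw [lintegral_const_mul _ (by fun_prop), mul_comm, eGainAdjoint]

lemma lintegral_mul_eTreeDensity_succ :
    ∫⁻ p, ψ (rootAux (n + 1) p.1 p.2 t) * eTreeDensity g₀ g f (n + 1) p.1 p.2 t
        ∂(levelMeasure (n + 1))
      = ∫⁻ s in Ioc 0 t, ∫⁻ p,
          eGainAdjoint g (eTransportAdjoint (lossRate g₀) ψ (t - s)) (rootAux n p.1 p.2 s)
            * eTreeDensity g₀ g f n p.1 p.2 s ∂(levelMeasure n) := by
  have hG : Measurable ({q : (Phase × (Fin n → Marker)) × Marker | q.2.1 ∈ Ioc 0 t}.indicator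
      (lastCollisionWeight g₀ g f ψ n t)) :=
    (hb.measurable_lastCollisionWeight hf hψ).indicator
      (measurable_snd.fst measurableSet_Ioc)
  simp_rw [mul_eTreeDensity_succ]
  rw [levelMeasure, (measurePreserving_init_last volume markerMeasure n).lintegral_comp hG,
    ← levelMeasure, lintegral_prod_symm _ hG.aemeasurable, markerMeasure,
    lintegral_prod _ (by fun_prop), ← lintegral_indicator measurableSet_Ioc]
  refine lintegral_congr fun s => ?_
  by_cases hs : s ∈ Ioc 0 t
  · simp only [indicator, mem_ofPred_eq, hs, if_true]
    exact hb.lintegral_lastCollisionWeight hf hψ s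
  · simp only [indicator, mem_ofPred_eq, hs, if_false, lintegral_zero]

lemma lintegral_mul_collisionSeries_zero (ht : 0 ≤ t) :
    ∫⁻ z, ψ z * collisionSeries g₀ g f 0 t z
      = ∫⁻ z, f z * eTransportAdjoint (lossRate g₀) ψ t z := by
  have := hb.measurable_lossRate
  rw [collisionSeries, evolves_eTransport hb.measurable_lossRate hf t ht ψ hψ,
    lintegral_initMeasure hf (by fun_prop) ht]
  simp only [sub_zero, eTransportAdjoint]

lemma lintegral_mul_collisionSeries_succ (ht : 0 ≤ t) :
    ∫⁻ z, ψ z * collisionSeries g₀ g f (n + 1) t z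
      = ∫⁻ s in Ioc 0 t, ∫⁻ z, eGainAdjoint g (eTransportAdjoint (lossRate g₀) ψ (t - s)) z
          * collisionSeries g₀ g f n s z := by
  have := hb.measurable_lossRate
  have hq := measurable_eGain hb.measurable (hb.measurable_collisionSeries hf n)
  rw [collisionSeries, evolves_eDuhamel hb.measurable_lossRate hq t ht ψ hψ,
    lintegral_sourceMeasure hq (by fun_prop)]
  refine lintegral_congr fun s => ?_
  simp_rw [mul_comm (eGain _ _ _), mul_comm (eGainAdjoint _ _ _)]
  exact lintegral_mul_eGain hb.measurable (hb.measurable_collisionSeries_apply hf n s)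
    (ψ := eTransportAdjoint (lossRate g₀) ψ (t - s)) (by fun_prop)

lemma lintegral_mul_eTreeDensity (ht : 0 ≤ t) :
    ∫⁻ p, ψ (rootAux n p.1 p.2 t) * eTreeDensity g₀ g f n p.1 p.2 t ∂(levelMeasure n)
      = ∫⁻ z, ψ z * collisionSeries g₀ g f n t z := by
  have := hb.measurable_lossRate
  induction n generalizing t ψ with
  | zero =>
    rw [hb.lintegral_mul_collisionSeries_zero hf hψ ht, levelMeasure, Measure.pi_of_empty,
      Measure.prod_dirac, lintegral_map (by simp only [rootAux, eTreeDensity]; fun_prop)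
        (by fun_prop)]
    refine lintegral_congr fun z => ?_
    simp only [rootAux, eTreeDensity, eTransportAdjoint]
    ring
  | succ n ih =>
    rw [hb.lintegral_mul_eTreeDensity_succ hf hψ, hb.lintegral_mul_collisionSeries_succ hf hψ ht]
    refine setLIntegral_congr_fun measurableSet_Ioc fun s hs => ih ?_ hs.1.le
    exact measurable_eGainAdjoint hb.measurable (by fun_prop)

end IsBackground

end TreeDensity

/-! ### The idealized equation -/

section SigmaTypes

variable {ι : Type*} {β : ι → Type*} [∀ i, MeasurableSpace (β i)]

lemma measurableEmbedding_sigmaMk (i : ι) : MeasurableEmbedding (Sigma.mk (β := β) i) := by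
  have hset (s : Set (Sigma β)) : MeasurableSet s ↔ ∀ j, MeasurableSet (Sigma.mk j ⁻¹' s) := by
    simp only [MeasurableSpace.measurableSet_iInf]
    rfl
  refine ⟨sigma_mk_injective, fun s hs => (hset s).1 hs i, fun s hs => (hset _).2 fun j => ?_⟩
  by_cases hij : i = j
  · subst hij
    rwa [preimage_image_eq _ sigma_mk_injective]
  · rw [preimage_image_sigmaMk_of_ne (Ne.symm hij)]
    exact MeasurableSet.empty

lemma measurable_of_comp_sigmaMk {γ : Type*} [MeasurableSpace γ] {F : Sigma β → γ}
    (hF : ∀ i, Measurable fun x => F ⟨i, x⟩) : Measurable F := by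
  intro s hs
  simp only [MeasurableSpace.measurableSet_iInf]
  exact fun i => hF i hs

end SigmaTypes

lemma treeMeasure_eq : treeMeasure = Measure.sum fun n => (levelMeasure n).map (Sigma.mk n) := rfl

lemma ae_treeMeasure_iff {p : Tree → Prop} :
    (∀ᵐ Φ ∂treeMeasure, p Φ) ↔ ∀ n, ∀ᵐ q ∂(levelMeasure n), p ⟨n, q⟩ := by
  rw [treeMeasure_eq, Measure.ae_sum_iff]
  exact forall_congr' fun n => (measurableEmbedding_sigmaMk n).ae_map_iff

lemma lintegral_treeMeasure (F : Tree → ℝ≥0∞) :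
    ∫⁻ Φ, F Φ ∂treeMeasure = ∑' n, ∫⁻ q, F ⟨n, q⟩ ∂(levelMeasure n) := by
  rw [treeMeasure_eq, lintegral_sum_measure]
  exact tsum_congr fun n => (measurableEmbedding_sigmaMk n).lintegral_map F

lemma measurable_root (t : ℝ) : Measurable fun Φ => root Φ t :=
  measurable_of_comp_sigmaMk fun _ =>
    measurable_rootAux measurable_fst measurable_snd measurable_const

lemma integral_exp_decay (c l τ t : ℝ) :
    ∫ s in τ..t, c * Real.exp (-((s - τ) * l)) * l = c - c * Real.exp (-((t - τ) * l)) := by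
  have hderiv (s : ℝ) : HasDerivAt (fun s => -(c * Real.exp (-((s - τ) * l))))
      (c * Real.exp (-((s - τ) * l)) * l) s := by
    have hlin : HasDerivAt (fun s : ℝ => -((s - τ) * l)) (-(1 * l)) s :=
      (((hasDerivAt_id s).sub_const τ).mul_const l).neg
    exact (hlin.exp.const_mul c).neg.congr_deriv (by ring)
  rw [intervalIntegral.integral_eq_sub_of_hasDerivAt (fun s _ => hderiv s)
    (Continuous.intervalIntegrable (by fun_prop) _ _)]
  simp only [sub_self, zero_mul, neg_zero, Real.exp_zero]
  ring

lemma ite_mem_Ioc_eq_indicator {τ : ℝ} (hτ : 0 < τ) (h : ℝ → ℝ) :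
    (fun s => if τ ∈ Ioc 0 s then h s else 0) = (Ici τ).indicator h := by
  ext s
  simp [indicator_apply, hτ]

lemma integral_exp_decay_after {τ t : ℝ} (hτ : 0 < τ) (ht : 0 ≤ t) (c l : ℝ) :
    ∫ s in (0 : ℝ)..t, (if τ ∈ Ioc 0 s then c * Real.exp (-((s - τ) * l)) else 0) * l
      = if τ ∈ Ioc 0 t then c - c * Real.exp (-((t - τ) * l)) else 0 := by
  have hset : Ioc 0 t ∩ Ici τ = Icc τ t := by
    ext s
    exact ⟨fun h => ⟨h.2, h.1.2⟩, fun h => ⟨⟨hτ.trans_le h.1, h.2⟩, h.1⟩⟩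
  simp_rw [ite_mul, zero_mul]
  rw [ite_mem_Ioc_eq_indicator hτ fun s => c * Real.exp (-((s - τ) * l)) * l,
    intervalIntegral.integral_of_le ht, setIntegral_indicator measurableSet_Ici, hset]
  split_ifs with h
  · rw [integral_Icc_eq_integral_Ioc, ← intervalIntegral.integral_of_le h.2, integral_exp_decay]
  · rw [Icc_eq_empty fun h' => h ⟨hτ, h'⟩, setIntegral_empty]

/-- The solution of the idealized equation at time `t`. -/
def treeSolution (f₀ : Phase → ℝ) (g₀ : Vel → ℝ) (t : ℝ) (Φ : Tree) : ℝ :=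
  treeDensity f₀ g₀ Φ.1 Φ.2.1 Φ.2.2 t

/-- The solution of the idealized equation at time `t`, with values in `[0, ⊤]`. -/
def eTreeSolution (g₀ : Vel → ℝ) (g : Vel → ℝ≥0∞) (f : Phase → ℝ≥0∞) (t : ℝ) (Φ : Tree) : ℝ≥0∞ :=
  eTreeDensity g₀ g f Φ.1 Φ.2.1 Φ.2.2 t

section Idealized

variable {f₀ : Phase → ℝ} {g₀ : Vel → ℝ} {g : Vel → ℝ≥0∞} {f ψ : Phase → ℝ≥0∞} {T t : ℝ} {Φ : Tree}

lemma treeSolution_zero (f₀ : Phase → ℝ) (g₀ : Vel → ℝ) (Φ : Tree) :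
    treeSolution f₀ g₀ 0 Φ = if Φ.1 = 0 then f₀ Φ.2.1 else 0 := by
  rcases Φ with ⟨_ | n, z, m⟩ <;> simp [treeSolution, treeDensity]

lemma intervalIntegrable_treeSolution (hΦ : Φ ∈ MT T) (hT : 0 ≤ T) :
    IntervalIntegrable (fun s => treeSolution f₀ g₀ s Φ) volume 0 T := by
  rcases Φ with ⟨_ | n, z, m⟩
  · exact Continuous.intervalIntegrable (by simp only [treeSolution, treeDensity]; fun_prop) _ _
  · simp only [treeSolution, treeDensity]
    rw [ite_mem_Ioc_eq_indicator (hΦ.1 (Fin.last n)).1,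
      intervalIntegrable_iff_integrableOn_Ioc_of_le hT]
    exact (Continuous.intervalIntegrable (by fun_prop) 0 T).1.indicator measurableSet_Ici

lemma treeSolution_equation (hΦ : Φ ∈ MT T) (ht : 0 ≤ t) :
    treeSolution f₀ g₀ t Φ = treeSolution f₀ g₀ 0 Φ
      + (∫ s in Icc (0 : ℝ) t, treeGain g₀ (treeSolution f₀ g₀ s) Φ
          ∂(Measure.dirac (finalTime Φ)))
      - ∫ s in (0 : ℝ)..t, treeLoss g₀ (treeSolution f₀ g₀ s) Φ := by
  classical
  rw [setIntegral_dirac, treeSolution_zero]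
  rcases Φ with ⟨_ | n, z, m⟩
  · have hloss := integral_exp_decay (f₀ z) (lossRate g₀ z.2) 0 t
    simp only [sub_zero] at hloss
    simp [treeSolution, treeDensity, treeGain, treeLoss, root, rootAux, freeFlow_snd, hloss]
  · have hτ : 0 < (m (Fin.last n)).1 := (hΦ.1 (Fin.last n)).1
    have hv : (root ⟨n + 1, z, m⟩ (m (Fin.last n)).1).2
        = scatter (rootAux n z (Fin.init m) (m (Fin.last n)).1).2 (m (Fin.last n)).2.1
          (m (Fin.last n)).2.2 := by
      simp [root, rootAux]
    simp only [treeLoss, finalTime, hv, treeSolution, treeDensity, treeGain, prune]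
    rw [integral_exp_decay_after hτ ht]
    simp only [root, mem_Icc, mem_Ioc, hτ, hτ.le, true_and]
    split_ifs <;> simp_all

lemma ae_eq_zero_of_notMem_MT (ht : t ≤ T) :
    ∀ᵐ Φ ∂treeMeasure, Φ ∉ MT T → treeSolution f₀ g₀ t Φ = 0 := by
  refine ae_treeMeasure_iff.2 fun n => ?_
  filter_upwards [ae_levelMeasure_injective_times n] with q hq hΦ
  by_contra h
  refine hΦ ⟨fun j => ?_, (monotone_times_of_treeDensity_ne_zero h).strictMono_of_injective hq⟩
  exact Ioc_subset_Ioc_right ht (times_mem_Ioc_of_treeDensity_ne_zero h j)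

lemma setIntegral_treesIn (ht : t ≤ T) {Ω : Set Phase} (hΩ : MeasurableSet Ω) :
    ∫ Φ in treesIn T t Ω, treeSolution f₀ g₀ t Φ ∂treeMeasure
      = ∫ Φ in (root · t) ⁻¹' Ω, treeSolution f₀ g₀ t Φ ∂treeMeasure := by
  refine (setIntegral_eq_of_subset_of_ae_sdiff_eq_zero
    (measurable_root t hΩ).nullMeasurableSet (fun Φ hΦ => hΦ.2) ?_).symm
  filter_upwards [ae_eq_zero_of_notMem_MT (f₀ := f₀) (g₀ := g₀) ht] with Φ h hΦ
  exact h fun hMT => hΦ.2 ⟨hMT, hΦ.1⟩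

namespace IsBackground

variable (hb : IsBackground g₀ g)
include hb

lemma measurable_eTreeSolution (hf : Measurable f) (t : ℝ) :
    Measurable (eTreeSolution g₀ g f t) :=
  measurable_of_comp_sigmaMk fun _ =>
    hb.measurable_eTreeDensity hf measurable_fst measurable_snd measurable_const

lemma lintegral_mul_eTreeSolution (hf : Measurable f) (hψ : Measurable ψ) (ht : 0 ≤ t) :
    ∫⁻ Φ, ψ (root Φ t) * eTreeSolution g₀ g f t Φ ∂treeMeasure
      = ∫⁻ z, ψ z * eSolution g₀ g f t z := by
  rw [lintegral_treeMeasure, hb.lintegral_mul_eSolution hf hψ]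
  exact tsum_congr fun n => hb.lintegral_mul_eTreeDensity hf hψ ht

lemma setLIntegral_eTreeSolution (hf : Measurable f) (ht : 0 ≤ t) {Ω : Set Phase}
    (hΩ : MeasurableSet Ω) :
    ∫⁻ Φ in (root · t) ⁻¹' Ω, eTreeSolution g₀ g f t Φ ∂treeMeasure
      = ∫⁻ z in Ω, eSolution g₀ g f t z := by
  rw [← lintegral_indicator (measurable_root t hΩ), ← lintegral_indicator hΩ]
  have h := hb.lintegral_mul_eTreeSolution hf (measurable_one.indicator hΩ) ht
  refine Eq.trans (lintegral_congr fun Φ => ?_) (h.trans (lintegral_congr fun z => ?_))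
  · by_cases hΦ : root Φ t ∈ Ω <;> simp [hΦ]
  · by_cases hz : z ∈ Ω <;> simp [hz]

variable (hf : IsInitial f₀ f)
include hf

lemma lintegral_eTreeSolution_ne_top (ht : 0 ≤ t) :
    ∫⁻ Φ, eTreeSolution g₀ g f t Φ ∂treeMeasure ≠ ⊤ := by
  have h := hb.setLIntegral_eTreeSolution hf.measurable ht MeasurableSet.univ
  simp only [preimage_univ, Measure.restrict_univ] at h
  exact h ▸ (hb.lintegral_eSolution_lt_top hf ht).ne

lemma treeSolution_ae_eq (t : ℝ) :
    treeSolution f₀ g₀ t =ᵐ[treeMeasure] fun Φ => (eTreeSolution g₀ g f t Φ).toReal := by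
  refine ae_treeMeasure_iff.2 fun n => ?_
  have hroot : ∀ᵐ q ∂(levelMeasure n), f₀ q.1 = (f q.1).toReal :=
    Measure.quasiMeasurePreserving_fst.ae hf.ae_eq
  have hmarker : ∀ᵐ a ∂markerMeasure, g₀ a.2.2 = (g a.2.2).toReal :=
    (Measure.quasiMeasurePreserving_snd.comp Measure.quasiMeasurePreserving_snd).ae hb.ae_eq
  have hmarkers : ∀ᵐ q ∂(levelMeasure n), ∀ j, g₀ (q.2 j).2.2 = (g (q.2 j).2.2).toReal :=
    ae_all_iff.2 fun j => Measure.quasiMeasurePreserving_snd.ae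
      ((Measure.quasiMeasurePreserving_eval (μ := fun _ : Fin n => markerMeasure) j).ae hmarker)
  filter_upwards [hroot, hmarkers] with q hq hq'
  exact treeDensity_eq_toReal hq hq' t

lemma integrable_treeSolution (ht : 0 ≤ t) : Integrable (treeSolution f₀ g₀ t) treeMeasure :=
  (integrable_toReal_of_lintegral_ne_top (hb.measurable_eTreeSolution hf.measurable t).aemeasurable
    (hb.lintegral_eTreeSolution_ne_top hf ht)).congr (hb.treeSolution_ae_eq hf t).symm

lemma isIdealizedSolution_treeSolution (hT : 0 ≤ T) :
    IsIdealizedSolution f₀ g₀ T (treeSolution f₀ g₀) where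
  integrable _ ht := (hb.integrable_treeSolution hf ht.1).integrableOn
  initial Φ _ := treeSolution_zero f₀ g₀ Φ
  time_integrable _ hΦ := intervalIntegrable_treeSolution hΦ hT
  equation _ hΦ _ ht := treeSolution_equation hΦ ht.1

lemma setIntegral_solution_eq (ht : t ∈ Icc 0 T) {Ω : Set Phase} (hΩ : MeasurableSet Ω) :
    ∫ z in Ω, hb.solution hf t z
      = ∫ Φ in treesIn T t Ω, treeSolution f₀ g₀ t Φ ∂treeMeasure := by
  have hsol := hb.measurable_eSolution_apply hf.measurable t
  have htree := hb.measurable_eTreeSolution hf.measurable t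
  have hsol_top : ∀ᵐ z, eSolution g₀ g f t z < ⊤ :=
    ae_lt_top hsol (hb.lintegral_eSolution_lt_top hf ht.1).ne
  have htree_top : ∀ᵐ Φ ∂treeMeasure, eTreeSolution g₀ g f t Φ < ⊤ :=
    ae_lt_top htree (hb.lintegral_eTreeSolution_ne_top hf ht.1)
  calc ∫ z in Ω, hb.solution hf t z
      = (∫⁻ z in Ω, eSolution g₀ g f t z).toReal := by
        rw [integral_congr_ae (ae_restrict_of_ae (hb.coeFn_solution hf ht.1)),
          integral_toReal hsol.aemeasurable (ae_restrict_of_ae hsol_top)]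
    _ = (∫⁻ Φ in (root · t) ⁻¹' Ω, eTreeSolution g₀ g f t Φ ∂treeMeasure).toReal := by
        rw [hb.setLIntegral_eTreeSolution hf.measurable ht.1 hΩ]
    _ = ∫ Φ in treesIn T t Ω, treeSolution f₀ g₀ t Φ ∂treeMeasure := by
        rw [setIntegral_treesIn ht.2 hΩ,
          integral_congr_ae (ae_restrict_of_ae (hb.treeSolution_ae_eq hf t)),
          integral_toReal htree.aemeasurable (ae_restrict_of_ae htree_top)]

end IsBackground

end Idealized

lemma Admissible.integrable_first_moment {f₀ : Phase → ℝ} {g₀ : Vel → ℝ} (h : Admissible f₀ g₀) :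
    Integrable fun z : Phase => f₀ z * (1 + ‖z.2‖) := by
  refine (h.f_moment.const_mul 2).mono'
    (h.f_integrable.aestronglyMeasurable.mul (by fun_prop)) ?_
  filter_upwards [h.f_nonneg] with z hz
  rw [Real.norm_of_nonneg (by positivity), mul_left_comm]
  exact mul_le_mul_of_nonneg_left (by nlinarith [sq_nonneg (‖z.2‖ - 1)]) hz

theorem theorem3p1_general {T : ℝ} (hT : 0 ≤ T) {f₀ : Phase → ℝ} {g₀ : Vel → ℝ}
    (hf : Integrable f₀) (hf0 : 0 ≤ᵐ[volume] f₀)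
    (hfm : Integrable fun z : Phase => f₀ z * (1 + ‖z.2‖))
    (hg : AEMeasurable g₀) (hg0 : 0 ≤ᵐ[volume] g₀)
    (hgm : Integrable fun v : Vel => g₀ v * (1 + ‖v‖ ^ 2)) :
    ∃ f : ℝ → L1,
      IsMildSolution (IsAPlusB g₀) T (hf.toL1 f₀) f ∧
      (∀ f' : ℝ → L1, IsMildSolution (IsAPlusB g₀) T (hf.toL1 f₀) f' →
        ∀ t ∈ Icc 0 T, f' t = f t) ∧
      ∃ P : ℝ → Tree → ℝ,
        IsIdealizedSolution f₀ g₀ T P ∧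
        ∀ t ∈ Icc 0 T, ∀ Ω : Set Phase, MeasurableSet Ω →
          ∫ z in Ω, f t z = ∫ Φ in treesIn T t Ω, P t Φ ∂treeMeasure := by
  obtain ⟨g, hb⟩ := exists_isBackground hg hg0 hgm
  obtain ⟨f, hfi⟩ := exists_isInitial hf.aemeasurable hf0 hfm
  have hmild := hb.isMildSolution_solution hfi hf.coeFn_toL1 hT
  exact ⟨hb.solution hfi, hmild, fun f' hf' t ht => hmild.unique hb hf' ht,
    treeSolution f₀ g₀, hb.isIdealizedSolution_treeSolution hfi hT,
    fun t ht Ω hΩ => hb.setIntegral_solution_eq hfi ht hΩ⟩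

end RayleighGas

end

theorem theorem3p1 (T : ℝ) (hT : 0 < T)
    (f₀ : RayleighGas.Phase → ℝ) (g₀ : RayleighGas.Vel → ℝ)
    (h : RayleighGas.Admissible f₀ g₀) :
    ∃ f : ℝ → RayleighGas.L1,
      RayleighGas.IsMildSolution (RayleighGas.IsAPlusB g₀) T (h.f_integrable.toL1 f₀) f ∧
      (∀ f' : ℝ → RayleighGas.L1,
        RayleighGas.IsMildSolution (RayleighGas.IsAPlusB g₀) T (h.f_integrable.toL1 f₀) f' →
          ∀ t ∈ Set.Icc (0 : ℝ) T, f' t = f t) ∧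
      ∃ P : ℝ → RayleighGas.Tree → ℝ,
        RayleighGas.IsIdealizedSolution f₀ g₀ T P ∧
        ∀ t ∈ Set.Icc (0 : ℝ) T, ∀ Ω : Set RayleighGas.Phase, MeasurableSet Ω →
          ∫ z in Ω, f t z = ∫ Φ in RayleighGas.treesIn T t Ω, P t Φ ∂(RayleighGas.treeMeasure) :=
  RayleighGas.theorem3p1_general hT.le h.f_integrable h.f_nonneg h.integrable_first_moment
    h.g_integrable.aemeasurable h.g_nonneg h.g_moment
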